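/- Let $(X_0,X_1)$ be an interpolation pair of complex Banach spaces, $\Sigma=X_0+X_1$, let $\mathbb S=\{0<\operatorname{Re} z<1\}$, and for $0<t<1$ let $X_t=(X_0,X_1)_t$ be the Calder\'on complex interpolation space, with norm $\|\cdot\|_t$. Let $\mathcal F^\infty$ be the space of analytic functions $F:\mathbb S\to\Sigma$ that are the Poisson integral of strongly measurable, essentially bounded boundary values $F(j+i\,\cdot)\in L_\infty(\mathbb R,X_j)$, $j=0,1$, with norm $\|F\|=\max_j \operatorname{ess\,sup}_s\|F(j+is)\|_{X_j}$. A minimal function for $x\in X_\theta$ at $\theta$ is an $F\in\mathcal F^\infty$ with $F(\theta)=x$ and $\|F\|=\|x\|_\theta$. If every $x\in X_\theta$ has a unique minimal function $B_\theta x$ at $\theta$, the differential $\Omega_\theta=\Omega_\theta(X_0,X_1):X_\theta\to\Sigma$ is $\Omega_\theta x=(B_\theta x)'(\theta)$. The pair is regular if $X_0\cap X_1$ is dense in $X_0$ and in $X_1$; it is optimal if it is regular and minimal functions exist and are unique for all $0<\theta<1$ and $x\in X_\theta$. It is rigid if it is optimal and, for every $0<\theta<1$, whenever $Y_0,Y_1\subset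 X_0+X_1$ (continuously) is another regular pair for which $\Omega_\theta(Y_0,Y_1)$ is defined, with $Y_\theta=X_\theta$ isometrically and $\Omega_\theta(Y_0,Y_1)=\Omega_\theta(X_0,X_1)$, then $Y_t=X_t$ isometrically for all $0<t<1$. Theorem. Let $(X_0,X_1)$ be a rigid interpolation pair, let $0<\theta<1$, and let $G$ be a group acting by bounded linear automorphisms of $X_0+X_1$ which restrict to isometries of $X_\theta$ onto itself. Then (b) $\Omega_\theta$ is $G$-equivariant on $X_\theta$, i.e. $g\,\Omega_\theta x=\Omega_\theta(gx)$ for all $g\in G$, $x\in X_\theta$ if and only if (c) $G$ acts as a group of isometries on $X_t$ for every $0<t<1$. Moreover, if $Y_{00}$ is any $G$-invariant dense subspace of $X_0\cap X_1$ (with the norm $\max(\|\cdot\|_0,\|\cdot\|_1)$), then (b) and (c) are also equivalent to (a) $g\,\Omega_\theta x=\Omega_\theta(gx)$ for all $g\in G$, $x\in Y_{00}$. -/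

import Mathlib

open MeasureTheory Set
open scoped ENNReal BoundedContinuousFunction

universe u

noncomputable section

/-- A pair of complex Banach spaces `X₀`, `X₁`, both linearly and continuously contained
in `E` (the inclusions are `emb₀`, `emb₁`). -/
structure InterpolationPair (E : Type u) [NormedAddCommGroup E] [NormedSpace ℂ E] where
  X₀ : Type u
  X₁ : Type u
  [normedGroup₀ : NormedAddCommGroup X₀]
  [normedGroup₁ : NormedAddCommGroup X₁]
  [normedSpace₀ : NormedSpace ℂ X₀]
  [normedSpace₁ : NormedSpace ℂ X₁]
  [complete₀ : CompleteSpace X₀]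
  [complete₁ : CompleteSpace X₁]
  emb₀ : X₀ →L[ℂ] E
  emb₁ : X₁ →L[ℂ] E
  emb₀_injective : Function.Injective emb₀
  emb₁_injective : Function.Injective emb₁

attribute [instance] InterpolationPair.normedGroup₀ InterpolationPair.normedGroup₁
  InterpolationPair.normedSpace₀ InterpolationPair.normedSpace₁
  InterpolationPair.complete₀ InterpolationPair.complete₁

/-- The open strip `0 < Re z < 1`. -/
def openStrip : Set ℂ := {z | 0 < z.re ∧ z.re < 1}

/-- The closed strip `0 ≤ Re z ≤ 1`. -/
def closedStrip : Set ℂ := {z | 0 ≤ z.re ∧ z.re ≤ 1}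

/-- The Poisson kernel of the strip for the boundary line `Re z = 0`. -/
def stripPoisson₀ (z : ℂ) (t : ℝ) : ℝ :=
  Real.sin (Real.pi * z.re) /
    (2 * (Real.cosh (Real.pi * (z.im - t)) - Real.cos (Real.pi * z.re)))

/-- The Poisson kernel of the strip for the boundary line `Re z = 1`. -/
def stripPoisson₁ (z : ℂ) (t : ℝ) : ℝ :=
  Real.sin (Real.pi * z.re) /
    (2 * (Real.cosh (Real.pi * (z.im - t)) + Real.cos (Real.pi * z.re)))

namespace InterpolationPair

variable {E : Type u} [NormedAddCommGroup E] [NormedSpace ℂ E]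

/-- `E` is the sum `X₀ + X₁`. When `E` is complete, its norm is then equivalent to
`inf {‖a‖₀ + ‖b‖₁ : x = a + b}`, by the open mapping theorem. -/
def IsSum (P : InterpolationPair E) : Prop :=
  ∀ x : E, ∃ (a : P.X₀) (b : P.X₁), x = P.emb₀ a + P.emb₁ b

/-- `X₀ ∩ X₁` is dense in `X₀` and in `X₁`. -/
def IsRegular (P : InterpolationPair E) : Prop :=
  Dense {a : P.X₀ | ∃ b : P.X₁, P.emb₁ b = P.emb₀ a} ∧
  Dense {b : P.X₁ | ∃ a : P.X₀, P.emb₀ a = P.emb₁ b}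

/-- The Calderón space: bounded continuous functions on the closed strip, analytic on the open
strip, whose restrictions to the two boundary lines are bounded continuous functions with values
in `X₀` and in `X₁`. Only the values on the closed strip matter. -/
structure CalderonFun (P : InterpolationPair E) where
  toFun : ℂ → E
  continuousOn : ContinuousOn toFun closedStrip
  bounded : ∃ C : ℝ, ∀ z ∈ closedStrip, ‖toFun z‖ ≤ C
  analytic : DifferentiableOn ℂ toFun openStrip
  bd₀ : ℝ →ᵇ P.X₀
  bd₁ : ℝ →ᵇ P.X₁
  eq_bd₀ : ∀ t : ℝ, toFun (t * Complex.I) = P.emb₀ (bd₀ t)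
  eq_bd₁ : ∀ t : ℝ, toFun (1 + t * Complex.I) = P.emb₁ (bd₁ t)

/-- The norm of the Calderón space, `sup {‖F(k + it)‖_k : t ∈ ℝ, k = 0, 1}`. -/
def CalderonFun.norm {P : InterpolationPair E} (F : P.CalderonFun) : ℝ :=
  max ‖F.bd₀‖ ‖F.bd₁‖

/-- The norm `‖x‖_t` of the interpolation space `X_t`, with value `∞` for `x ∉ X_t`. -/
def interpNorm (P : InterpolationPair E) (t : ℝ) (x : E) : ℝ≥0∞ :=
  ⨅ (F : P.CalderonFun) (_ : F.toFun (t : ℂ) = x), ENNReal.ofReal F.norm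

/-- The interpolation space `X_t`, as a subset of `X₀ + X₁`. -/
def interpSpace (P : InterpolationPair E) (t : ℝ) : Set E := {x | P.interpNorm t x < ∞}

/-- The space `𝓕^∞`, in which continuity on the boundary is relaxed to an `L_∞` condition:
functions analytic on the open strip that are the Poisson integral of (strongly measurable,
essentially bounded) boundary values in `L_∞(ℝ, X₀)` and `L_∞(ℝ, X₁)`.
Only the values on the open strip matter. -/
structure HInftyFun (P : InterpolationPair E) where
  toFun : ℂ → E
  analytic : DifferentiableOn ℂ toFun openStrip
  bd₀ : Lp P.X₀ ∞ (volume : Measure ℝ)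
  bd₁ : Lp P.X₁ ∞ (volume : Measure ℝ)
  eq_poisson : ∀ z ∈ openStrip, toFun z =
    (∫ t : ℝ, (stripPoisson₀ z t : ℂ) • P.emb₀ (bd₀ t)) +
      ∫ t : ℝ, (stripPoisson₁ z t : ℂ) • P.emb₁ (bd₁ t)

/-- The norm of `𝓕^∞`: the larger of the two essential suprema on the boundary lines. -/
def HInftyFun.norm {P : InterpolationPair E} (F : P.HInftyFun) : ℝ :=
  max ‖F.bd₀‖ ‖F.bd₁‖

/-- `F` is a minimal function for `x` at `θ`: `F(θ) = x` and `‖F‖ = ‖x‖_θ`. -/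
def IsMinimal (P : InterpolationPair E) (θ : ℝ) (x : E) (F : P.HInftyFun) : Prop :=
  F.toFun (θ : ℂ) = x ∧ ENNReal.ofReal F.norm = P.interpNorm θ x

/-- Every point of `X_θ` has a unique minimal function at `θ`. -/
def HasUniqueMinimal (P : InterpolationPair E) (θ : ℝ) : Prop :=
  ∀ x ∈ P.interpSpace θ, (∃ F : P.HInftyFun, P.IsMinimal θ x F) ∧
    ∀ F F' : P.HInftyFun, P.IsMinimal θ x F → P.IsMinimal θ x F' →
      EqOn F.toFun F'.toFun openStrip

/-- Optimal pairs: regular, with unique minimal functions for every `0 < θ < 1`. -/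
def IsOptimal (P : InterpolationPair E) : Prop :=
  P.IsRegular ∧ ∀ θ ∈ Ioo (0 : ℝ) 1, P.HasUniqueMinimal θ

open Classical in
/-- The differential `Ω_θ(x) = (B_θ x)'(θ)`, where `B_θ x` is the minimal function for `x` at `θ`;
it is canonical when `P.HasUniqueMinimal θ` and `x ∈ X_θ`. -/
def differential (P : InterpolationPair E) (θ : ℝ) (x : E) : E :=
  if h : ∃ F : P.HInftyFun, P.IsMinimal θ x F then deriv h.choose.toFun (θ : ℂ) else 0

/-- `θ`-rigidity: every regular pair `Q` in `X₀ + X₁` with a canonical differential at `θ` that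
has the same interpolation space (isometrically) and the same differential at `θ` as `P`
has the same interpolation spaces (isometrically) for all `0 < t < 1`. -/
def IsRigidAt (P : InterpolationPair E) (θ : ℝ) : Prop :=
  ∀ Q : InterpolationPair E, Q.IsRegular → Q.HasUniqueMinimal θ →
    (∀ x, Q.interpNorm θ x = P.interpNorm θ x) →
    (∀ x ∈ P.interpSpace θ, Q.differential θ x = P.differential θ x) →
    ∀ t ∈ Ioo (0 : ℝ) 1, ∀ x, Q.interpNorm t x = P.interpNorm t x

/-- Rigid pairs: optimal, and `θ`-rigid for every `0 < θ < 1`. -/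
def IsRigid (P : InterpolationPair E) : Prop :=
  P.IsOptimal ∧ ∀ θ ∈ Ioo (0 : ℝ) 1, P.IsRigidAt θ

/-- `D` is a dense subspace of `X₀ ∩ X₁` (with the norm `max ‖x‖₀ ‖x‖₁`). -/
def IsDenseInInter (P : InterpolationPair E) (D : Submodule ℂ E) : Prop :=
  (∀ x ∈ D, x ∈ range P.emb₀ ∧ x ∈ range P.emb₁) ∧
  ∀ (a : P.X₀) (b : P.X₁), P.emb₀ a = P.emb₁ b → ∀ ε > (0 : ℝ),
    ∃ (a' : P.X₀) (b' : P.X₁), P.emb₀ a' = P.emb₁ b' ∧ P.emb₀ a' ∈ D ∧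
      ‖a - a'‖ < ε ∧ ‖b - b'‖ < ε

/-- `G`, acting on `X₀ + X₁` through `ρ`, acts on `X_t` as a group of (onto) isometries. Both
sides are `∞` off `X_t`, so this includes the invariance of `X_t`. -/
def ActsIsometricallyOn (P : InterpolationPair E) {G : Type*} [Group G]
    (ρ : G →* (E ≃L[ℂ] E)) (t : ℝ) : Prop :=
  ∀ (g : G) (x : E), P.interpNorm t (ρ g x) = P.interpNorm t x

/-- `Ω_θ`, defined on the set `D`, is `G`-equivariant: `g Ω_θ x = Ω_θ (g x)` for `x ∈ D`. -/
def IsEquivariantOn (P : InterpolationPair E) {G : Type*} [Group G]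
    (ρ : G →* (E ≃L[ℂ] E)) (θ : ℝ) (D : Set E) : Prop :=
  ∀ (g : G), ∀ x ∈ D, ρ g (P.differential θ x) = P.differential θ (ρ g x)

end InterpolationPair

end

/-! The argument is carried out on the disc. A conformal map ψ with ψ(θ) = 0 sends the strip to the
disc and harmonic measure at θ to normalized arc length. With χ the coordinate on the circle, a
member of 𝓕^∞ is the same thing as a bounded boundary function f whose positive moments ∫ χ^k f
vanish (`isAnalyticData_iff`). Its value at θ is the mean of f, and its derivative there is ψ'(θ)
times the moment against χ̄ (`HInftyFun.hasDerivAt_center`). Competitors are therefore built by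
prescribing moments while controlling pointwise norms. That they do compete, i.e. ‖F(θ)‖_θ ≤ ‖F‖ on
𝓕^∞ although ‖·‖_θ is defined by continuous boundary values, is `interpNorm_toFun_le`. It rests on
moving averages of the boundary values and on the bound of ‖G(θ)‖_θ by the harmonic mean of the
boundary norms (`interpNorm_le_integral`).

(b) ⇒ (c): g carries the pair P to a pair gP. Isometry on X_θ and equivariance say that gP and P
have the same X_θ and Ω_θ, and rigidity gives the other X_t (`IsEquivariantOn.actsIsometricallyOn`).

(c) ⇒ (b): the obstacle is that g is not known to act on X₀ and X₁, so g ∘ B_θ x need not lie in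
𝓕^∞. Let F be minimal for x. For a point w near the circle, the minimal function through gF(w), at
the level of w, has norm at most ‖F‖, since g is isometric on the intermediate spaces. Multiplied by
the Poisson kernel P_w it has exactly the nonnegative moments of g(P_w F), and nearly the same
moment against χ̄ (`exists_realizes_poisson`). Nonnegative combinations of such P_w form a series
with sum 1 (`mem_closure_of_poisson`, `exists_series_eq_one`). Superposing gives a function of norm
at most ‖F‖ with value gx at θ. It is minimal for gx, and its derivative is as close to g Ω_θ x as
desired; uniqueness removes the error (`map_normDifferential`).

(a) ⇒ (b): Ω_θ is nonlinear and not assumed continuous, so density alone does not suffice. Two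
functions with the same value at θ can be glued with weights (1 ± Re b)/2, which moves the value by
a quarter of the difference of the normalized derivatives without increasing the norm bound
(`interpNorm_add_slope_sub_le`). Applied to minimal functions, this controls the failure Δ of
equivariance: x ± Δx/8 both have norm at most ‖x‖_θ. Then x is a midpoint of points of no larger
norm, where averages of minimal functions are minimal, so Δ is affine there. Iterating x ↦ x ± Δx/8
gives a bounded array in which each entry is the mean of two neighbours, and a Liouville argument
(`eq_of_bounded_mean`) forces Δ = 0 (`defect_eq_zero`, `IsEquivariantOn.of_dense`). -/

noncomputable section

/-! ### The conformal map of the strip and its Poisson kernel. -/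

namespace Strip

open Complex Filter Topology ComplexConjugate

/-- The exponential `e^{iπz}` maps the strip onto the upper half plane. -/
def halfPlane (z : ℂ) : ℂ := exp (Real.pi * z * I)

/-- The conformal map of the strip onto the unit disc, with value `0` at `θ`. -/
def toDisc (θ : Ioo (0 : ℝ) 1) (z : ℂ) : ℂ :=
  (halfPlane z - halfPlane (θ : ℝ)) / (halfPlane z - conj (halfPlane (θ : ℝ)))

/-- The image in the real line of a point of one of the two boundary lines. -/
def lineCoord : ℝ ⊕ ℝ → ℝ :=
  Sum.elim (fun t => Real.exp (-(Real.pi * t))) (fun t => -Real.exp (-(Real.pi * t)))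

/-- The point of the boundary of the strip with parameter `x`. -/
def bdry : ℝ ⊕ ℝ → ℂ := Sum.elim (fun t => t * I) (fun t => 1 + t * I)

/-- The Poisson kernel of the strip on the two boundary lines. -/
def poisson (z : ℂ) : ℝ ⊕ ℝ → ℝ := Sum.elim (stripPoisson₀ z) (stripPoisson₁ z)

lemma halfPlane_re (z : ℂ) :
    (halfPlane z).re = Real.exp (-(Real.pi * z.im)) * Real.cos (Real.pi * z.re) := by
  simp [halfPlane, exp_re]

lemma halfPlane_im (z : ℂ) :
    (halfPlane z).im = Real.exp (-(Real.pi * z.im)) * Real.sin (Real.pi * z.re) := by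
  simp [halfPlane, exp_im]

lemma halfPlane_im_pos {z : ℂ} (hz : z ∈ openStrip) : 0 < (halfPlane z).im := by
  rw [halfPlane_im]
  have := Real.sin_pos_of_pos_of_lt_pi (mul_pos Real.pi_pos hz.1)
    (by nlinarith [Real.pi_pos, hz.2])
  positivity

lemma halfPlane_im_nonneg {z : ℂ} (hz : z ∈ closedStrip) : 0 ≤ (halfPlane z).im := by
  rw [halfPlane_im]
  have := Real.sin_nonneg_of_nonneg_of_le_pi (mul_nonneg Real.pi_pos.le hz.1)
    (by nlinarith [Real.pi_pos, hz.2])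
  positivity

lemma mem_openStrip (θ : Ioo (0 : ℝ) 1) : ((θ : ℝ) : ℂ) ∈ openStrip := by
  exact ⟨by simpa using θ.2.1, by simpa using θ.2.2⟩

lemma openStrip_subset : openStrip ⊆ closedStrip := fun _ h => ⟨h.1.le, h.2.le⟩

lemma isOpen_openStrip : IsOpen openStrip :=
  (isOpen_lt continuous_const continuous_re).inter (isOpen_lt continuous_re continuous_const)

lemma halfPlane_bdry (x : ℝ ⊕ ℝ) : halfPlane (bdry x) = lineCoord x := by
  apply Complex.ext
  · rw [halfPlane_re, ofReal_re]
    rcases x with t | t <;> simp [bdry, lineCoord]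
  · rcases x with t | t <;> simp [halfPlane_im, bdry]

lemma bdry_mem_closedStrip (x : ℝ ⊕ ℝ) : bdry x ∈ closedStrip := by
  rcases x with t | t <;> simp [bdry, closedStrip]

lemma lineCoord_ne_zero (x : ℝ ⊕ ℝ) : lineCoord x ≠ 0 := by
  rcases x with t | t <;> simp [lineCoord, Real.exp_ne_zero]

lemma sub_conj_ne_zero {w w₀ : ℂ} (hw : 0 ≤ w.im) (hw₀ : 0 < w₀.im) : w - conj w₀ ≠ 0 := by
  intro h
  have := congrArg Complex.im h
  simp at this
  linarith

lemma center_im_pos (θ : Ioo (0 : ℝ) 1) : 0 < (halfPlane (θ : ℝ)).im :=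
  halfPlane_im_pos (mem_openStrip θ)

lemma bdry_sub_ne_zero (θ : Ioo (0 : ℝ) 1) (x : ℝ ⊕ ℝ) :
    (lineCoord x : ℂ) - conj (halfPlane (θ : ℝ)) ≠ 0 :=
  sub_conj_ne_zero (by simp) (center_im_pos θ)

/-- The boundary values of the conformal map `toDisc`. -/
def bdryPt (θ : Ioo (0 : ℝ) 1) (x : ℝ ⊕ ℝ) : Circle :=
  Circle.ofConjDivSelf (lineCoord x - conj (halfPlane (θ : ℝ))) (bdry_sub_ne_zero θ x)

lemma coe_bdryPt (θ : Ioo (0 : ℝ) 1) (x : ℝ ⊕ ℝ) : (bdryPt θ x : ℂ) =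
    (lineCoord x - halfPlane (θ : ℝ)) / (lineCoord x - conj (halfPlane (θ : ℝ))) := by
  simp [bdryPt, Circle.ofConjDivSelf]

lemma toDisc_bdry (θ : Ioo (0 : ℝ) 1) (x : ℝ ⊕ ℝ) : toDisc θ (bdry x) = bdryPt θ x := by
  rw [toDisc, halfPlane_bdry, coe_bdryPt]

lemma toDisc_self (θ : Ioo (0 : ℝ) 1) : toDisc θ (θ : ℝ) = 0 := by simp [toDisc]

lemma hasDerivAt_halfPlane (z : ℂ) :
    HasDerivAt halfPlane (halfPlane z * (Real.pi * I)) z := by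
  have : HasDerivAt (fun z : ℂ => Real.pi * z * I) (Real.pi * I) z := by
    simpa using ((hasDerivAt_id z).const_mul (Real.pi : ℂ)).mul_const I
  exact this.cexp

lemma denom_ne_zero (θ : Ioo (0 : ℝ) 1) {z : ℂ} (hz : z ∈ closedStrip) :
    halfPlane z - conj (halfPlane (θ : ℝ)) ≠ 0 :=
  sub_conj_ne_zero (halfPlane_im_nonneg hz) (center_im_pos θ)

lemma differentiableAt_toDisc (θ : Ioo (0 : ℝ) 1) {z : ℂ} (hz : z ∈ closedStrip) :
    DifferentiableAt ℂ (toDisc θ) z := by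
  unfold toDisc
  exact (((hasDerivAt_halfPlane z).differentiableAt.sub_const _)).div
    ((hasDerivAt_halfPlane z).differentiableAt.sub_const _) (denom_ne_zero θ hz)

lemma continuousOn_toDisc (θ : Ioo (0 : ℝ) 1) : ContinuousOn (toDisc θ) closedStrip :=
  fun _ hz => (differentiableAt_toDisc θ hz).continuousAt.continuousWithinAt

lemma deriv_toDisc_ne_zero (θ : Ioo (0 : ℝ) 1) : deriv (toDisc θ) (θ : ℝ) ≠ 0 := by
  have h := denom_ne_zero θ (openStrip_subset (mem_openStrip θ))
  have := ((hasDerivAt_halfPlane (θ : ℝ)).sub_const (halfPlane (θ : ℝ))).div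
    ((hasDerivAt_halfPlane (θ : ℝ)).sub_const (conj (halfPlane (θ : ℝ)))) h
  have e : deriv (toDisc θ) (θ : ℝ) = _ := this.deriv
  rw [e]
  simp only [sub_self, zero_mul, sub_zero]
  have : halfPlane (θ : ℝ) ≠ 0 := exp_ne_zero _
  have hp : (Real.pi : ℂ) ≠ 0 := by exact_mod_cast Real.pi_ne_zero
  field_simp
  simp [*]

/-- The gap to the unit circle in closed form. Its positivity puts the strip inside the disc, and
its exact value is the numerator of the disc kernel in `poisson_eq_mul`. -/
lemma one_sub_normSq_moebius {w w₀ : ℂ} (hw : 0 ≤ w.im) (hw₀ : 0 < w₀.im) :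
    1 - normSq ((w - w₀) / (w - conj w₀)) = 4 * w.im * w₀.im / normSq (w - conj w₀) := by
  have h := sub_conj_ne_zero hw hw₀
  have h' : normSq (w - conj w₀) ≠ 0 := by simpa [normSq_eq_zero] using h
  rw [normSq_div]
  field_simp
  simp [normSq_apply]
  ring

lemma norm_toDisc_lt_one (θ : Ioo (0 : ℝ) 1) {z : ℂ} (hz : z ∈ openStrip) :
    ‖toDisc θ z‖ < 1 := by
  have h := one_sub_normSq_moebius (halfPlane_im_nonneg (openStrip_subset hz)) (center_im_pos θ)
  have h2 : 0 < normSq (halfPlane z - conj (halfPlane (θ : ℝ))) :=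
    normSq_pos.2 (denom_ne_zero θ (openStrip_subset hz))
  have h3 : 0 < 1 - normSq (toDisc θ z) := by
    rw [toDisc, h]
    have := halfPlane_im_pos hz
    have := center_im_pos θ
    positivity
  rw [normSq_eq_norm_sq] at h3
  nlinarith [norm_nonneg (toDisc θ z)]

/-- This is the half-plane kernel pulled back by the exponential; the factor |`lineCoord x`| is, up
to π, the Jacobian of the parametrization of the real line. In this form the two boundary lines are
treated together. -/
lemma poisson_eq (z : ℂ) (x : ℝ ⊕ ℝ) :
    poisson z x = (halfPlane z).im * |lineCoord x| / normSq (halfPlane z - lineCoord x) := by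
  have hp : ∀ s : ℝ, Real.exp (-(Real.pi * s)) ≠ 0 := fun s => Real.exp_ne_zero _
  have key : ∀ t : ℝ, Real.exp (Real.pi * (z.im - t)) =
      Real.exp (-(Real.pi * t)) / Real.exp (-(Real.pi * z.im)) := by
    intro t; rw [← Real.exp_sub]; ring_nf
  have key' : ∀ t : ℝ, Real.exp (-(Real.pi * (z.im - t))) =
      Real.exp (-(Real.pi * z.im)) / Real.exp (-(Real.pi * t)) := by
    intro t; rw [← Real.exp_sub]; ring_nf
  have hcs := Real.sin_sq_add_cos_sq (Real.pi * z.re)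
  set a := Real.exp (-(Real.pi * z.im)) with ha
  rcases x with t | t
  · have e : normSq (halfPlane z - (lineCoord (Sum.inl t) : ℝ)) = a * Real.exp (-(Real.pi * t)) *
        (2 * (Real.cosh (Real.pi * (z.im - t)) - Real.cos (Real.pi * z.re))) := by
      rw [Real.cosh_eq, key, key']
      have h1 := hp t; have h2 := hp z.im
      rw [← ha] at h2
      simp only [normSq_apply, sub_re, sub_im, halfPlane_re, halfPlane_im, lineCoord, Sum.elim_inl,
        ofReal_re, ofReal_im, ← ha]
      field_simp
      linear_combination a ^ 2 * hcs
    rw [e, halfPlane_im, ← ha]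
    simp only [poisson, Sum.elim_inl, stripPoisson₀, lineCoord, abs_of_pos (Real.exp_pos _)]
    rw [show a * Real.sin (Real.pi * z.re) * Real.exp (-(Real.pi * t)) =
      (a * Real.exp (-(Real.pi * t))) * Real.sin (Real.pi * z.re) by ring]
    rw [mul_div_mul_left _ _ (mul_ne_zero (hp _) (hp _))]
  · have e : normSq (halfPlane z - (lineCoord (Sum.inr t) : ℝ)) = a * Real.exp (-(Real.pi * t)) *
        (2 * (Real.cosh (Real.pi * (z.im - t)) + Real.cos (Real.pi * z.re))) := by
      rw [Real.cosh_eq, key, key']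
      have h1 := hp t; have h2 := hp z.im
      rw [← ha] at h2
      simp only [normSq_apply, sub_re, sub_im, halfPlane_re, halfPlane_im, lineCoord, Sum.elim_inr,
        ofReal_re, ofReal_im, ← ha]
      field_simp
      linear_combination a ^ 2 * hcs
    rw [e, halfPlane_im, ← ha]
    simp only [poisson, Sum.elim_inr, stripPoisson₁, lineCoord, abs_neg,
      abs_of_pos (Real.exp_pos _)]
    rw [show a * Real.sin (Real.pi * z.re) * Real.exp (-(Real.pi * t)) =
      (a * Real.exp (-(Real.pi * t))) * Real.sin (Real.pi * z.re) by ring]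
    rw [mul_div_mul_left _ _ (mul_ne_zero (hp _) (hp _))]

lemma sub_lineCoord_ne_zero {z : ℂ} (hz : z ∈ openStrip) (x : ℝ ⊕ ℝ) :
    halfPlane z - lineCoord x ≠ 0 := by
  intro h
  have := congrArg Complex.im h
  have h2 := halfPlane_im_pos hz
  simp at this
  linarith

lemma poisson_pos {z : ℂ} (hz : z ∈ openStrip) (x : ℝ ⊕ ℝ) : 0 < poisson z x := by
  rw [poisson_eq]
  have h1 := halfPlane_im_pos hz
  have h2 := normSq_pos.2 (sub_lineCoord_ne_zero hz x)
  have h3 := abs_pos.2 (lineCoord_ne_zero x)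
  positivity

/-- Change of the base point in the Poisson kernel. -/
lemma poisson_eq_mul (θ : Ioo (0 : ℝ) 1) {z : ℂ} (hz : z ∈ openStrip) (x : ℝ ⊕ ℝ) :
    poisson z x = poisson (θ : ℝ) x *
      ((1 - normSq (toDisc θ z)) / normSq ((bdryPt θ x : ℂ) - toDisc θ z)) := by
  have hw := halfPlane_im_pos hz
  have hw₀ := center_im_pos θ
  have h0 := denom_ne_zero θ (openStrip_subset hz)
  have h1 := bdry_sub_ne_zero θ x
  have h2 := sub_lineCoord_ne_zero hz x
  rw [poisson_eq, poisson_eq]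
  have e1 : (1 - normSq (toDisc θ z)) = _ := one_sub_normSq_moebius hw.le hw₀
  rw [e1, coe_bdryPt, toDisc]
  set w := halfPlane z
  set w₀ := halfPlane (θ : ℝ)
  set ξ := lineCoord x
  have e2 : ((ξ : ℂ) - w₀) / (ξ - conj w₀) - (w - w₀) / (w - conj w₀) =
      (ξ - w) * (w₀ - conj w₀) / ((ξ - conj w₀) * (w - conj w₀)) := by
    field_simp
    ring
  have e3 : normSq (w₀ - conj w₀) = 4 * w₀.im ^ 2 := by simp [normSq_apply]; ring
  have e4 : normSq ((ξ : ℂ) - conj w₀) = normSq (w₀ - ξ) := by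
    simp [normSq_apply]; ring
  have e5 : normSq ((ξ : ℂ) - w) = normSq (w - ξ) := by rw [← normSq_neg]; congr 1; ring
  rw [e2, normSq_div, normSq_mul, normSq_mul, e3, e4, e5]
  have n1 : normSq (w - ξ) ≠ 0 := by simpa [normSq_eq_zero] using h2
  have n2 : normSq (w₀ - ξ) ≠ 0 := by rw [← e4]; simpa [normSq_eq_zero] using h1
  have n3 : normSq (w - conj w₀) ≠ 0 := by simpa [normSq_eq_zero] using h0
  field_simp

end Strip

/-! ### Harmonic measure on the two boundary lines. -/

lemma measurableEmbedding_sumInl {α β : Type*} [MeasurableSpace α] [MeasurableSpace β] :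
    MeasurableEmbedding (Sum.inl : α → α ⊕ β) :=
  ⟨Sum.inl_injective, measurable_inl, fun _ hs => measurableSet_inl_image.2 hs⟩

lemma measurableEmbedding_sumInr {α β : Type*} [MeasurableSpace α] [MeasurableSpace β] :
    MeasurableEmbedding (Sum.inr : β → α ⊕ β) :=
  ⟨Sum.inr_injective, measurable_inr, fun _ hs => measurableSet_inr_image.2 hs⟩

lemma integrable_of_hasDerivAt_of_nonneg {g g' : ℝ → ℝ} {l m : ℝ}
    (hd : ∀ x, HasDerivAt g (g' x) x) (hpos : ∀ x, 0 ≤ g' x)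
    (hb : Filter.Tendsto g Filter.atBot (nhds m)) (ht : Filter.Tendsto g Filter.atTop (nhds l)) :
    Integrable g' := by
  rw [← integrableOn_univ, ← Iic_union_Ioi (a := (0 : ℝ))]
  refine IntegrableOn.union ?_
    (integrableOn_Ioi_deriv_of_nonneg' (fun x _ => hd x) (fun x _ => hpos x) ht)
  have h : IntegrableOn (fun x => g' (-x)) (Ioi 0) := by
    have h1 : ∀ x, HasDerivAt (fun x => -g (-x)) (g' (-x)) x := fun x => by
      simpa [Function.comp_def] using! ((hd (-x)).scomp x (hasDerivAt_neg x)).neg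
    exact integrableOn_Ioi_deriv_of_nonneg' (fun x _ => h1 x) (fun x _ => hpos _)
      ((hb.comp Filter.tendsto_neg_atTop_atBot).neg)
  have := (integrableOn_Iic_iff_integrableOn_Iio (f := g') (b := (0 : ℝ)) (μ := volume)).2
  apply this
  have h2 := (Measure.measurePreserving_neg (volume : Measure ℝ)).integrableOn_comp_preimage
    (Homeomorph.neg ℝ).measurableEmbedding (f := g') (s := Iio 0)
  rw [← h2]
  simpa [Function.comp_def] using h

namespace Strip

open Complex Filter Topology ComplexConjugate

/-- Lebesgue measure on the two boundary lines of the strip. -/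
def lines : Measure (ℝ ⊕ ℝ) := volume.map Sum.inl + volume.map Sum.inr

lemma integrable_lines {F : Type*} [NormedAddCommGroup F] {f : ℝ ⊕ ℝ → F} :
    Integrable f lines ↔
      Integrable (fun t => f (Sum.inl t)) ∧ Integrable (fun t => f (Sum.inr t)) := by
  rw [lines, integrable_add_measure, measurableEmbedding_sumInl.integrable_map_iff,
    measurableEmbedding_sumInr.integrable_map_iff]
  rfl

lemma ae_lines {p : ℝ ⊕ ℝ → Prop} :
    (∀ᵐ x ∂lines, p x) ↔ (∀ᵐ t : ℝ, p (Sum.inl t)) ∧ ∀ᵐ t : ℝ, p (Sum.inr t) := by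
  rw [lines, ae_add_measure_iff, measurableEmbedding_sumInl.ae_map_iff,
    measurableEmbedding_sumInr.ae_map_iff]

lemma aestronglyMeasurable_lines {F : Type*} [TopologicalSpace F]
    [TopologicalSpace.PseudoMetrizableSpace F] {f : ℝ ⊕ ℝ → F} : AEStronglyMeasurable f lines ↔
      AEStronglyMeasurable (fun t => f (Sum.inl t)) ∧
      AEStronglyMeasurable (fun t => f (Sum.inr t)) := by
  rw [lines, aestronglyMeasurable_add_measure_iff,
    measurableEmbedding_sumInl.aestronglyMeasurable_map_iff,
    measurableEmbedding_sumInr.aestronglyMeasurable_map_iff]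
  rfl

lemma integral_lines {F : Type*} [NormedAddCommGroup F] [NormedSpace ℝ F] {f : ℝ ⊕ ℝ → F}
    (hf : Integrable f lines) :
    ∫ x, f x ∂lines = (∫ t, f (Sum.inl t)) + ∫ t, f (Sum.inr t) := by
  have h := integrable_add_measure.1 hf
  rw [lines, integral_add_measure h.1 h.2, measurableEmbedding_sumInl.integral_map,
    measurableEmbedding_sumInr.integral_map]

lemma measurable_sum_of_continuous {F : Type*} [TopologicalSpace F] [MeasurableSpace F]
    [BorelSpace F] {f : ℝ ⊕ ℝ → F} (hf : Continuous f) : Measurable f :=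
  measurable_fun_sum (hf.comp continuous_inl).measurable (hf.comp continuous_inr).measurable

lemma continuous_lineCoord : Continuous lineCoord :=
  Continuous.sumElim (by fun_prop) (by fun_prop)

lemma continuous_bdryPt (θ : Ioo (0 : ℝ) 1) : Continuous (bdryPt θ) := by
  refine continuous_induced_rng.2 ?_
  have : (fun x => (bdryPt θ x : ℂ)) = fun x => (lineCoord x - halfPlane (θ : ℝ)) /
      (lineCoord x - conj (halfPlane (θ : ℝ))) := funext fun x => coe_bdryPt θ x
  change Continuous fun x => (bdryPt θ x : ℂ)
  rw [this]
  have := continuous_lineCoord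
  exact Continuous.div (by fun_prop) (by fun_prop) (bdry_sub_ne_zero θ)

lemma continuous_poisson {z : ℂ} (hz : z ∈ openStrip) : Continuous (poisson z) := by
  have : poisson z = fun x => (halfPlane z).im * |lineCoord x| /
    normSq (halfPlane z - lineCoord x) := funext fun x => poisson_eq z x
  rw [this]
  have := continuous_lineCoord
  refine Continuous.div (by fun_prop) (by fun_prop) fun x => ?_
  simpa [normSq_eq_zero] using sub_lineCoord_ne_zero hz x

/-- Harmonic measure of the strip at `θ`. -/
def harmonicMeasure (θ : Ioo (0 : ℝ) 1) : Measure (ℝ ⊕ ℝ) :=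
  lines.withDensity fun x => ENNReal.ofReal (poisson (θ : ℝ) x)

lemma poisson_nonneg (θ : Ioo (0 : ℝ) 1) (x : ℝ ⊕ ℝ) : 0 ≤ poisson (θ : ℝ) x :=
  (poisson_pos (mem_openStrip θ) x).le

lemma integral_harmonicMeasure {F : Type*} [NormedAddCommGroup F] [NormedSpace ℝ F]
    (θ : Ioo (0 : ℝ) 1) (f : ℝ ⊕ ℝ → F) :
    ∫ x, f x ∂harmonicMeasure θ = ∫ x, poisson (θ : ℝ) x • f x ∂lines := by
  rw [harmonicMeasure, integral_withDensity_eq_integral_toReal_smul₀]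
  · simp only [ENNReal.toReal_ofReal (poisson_nonneg θ _)]
  · exact (measurable_sum_of_continuous
      (continuous_poisson (mem_openStrip θ))).ennreal_ofReal.aemeasurable
  · simp

lemma integrable_harmonicMeasure {F : Type*} [NormedAddCommGroup F] [NormedSpace ℝ F]
    (θ : Ioo (0 : ℝ) 1) {f : ℝ ⊕ ℝ → F} :
    Integrable f (harmonicMeasure θ) ↔ Integrable (fun x => poisson (θ : ℝ) x • f x) lines := by
  rw [harmonicMeasure, integrable_withDensity_iff_integrable_smul']
  · simp only [ENNReal.toReal_ofReal (poisson_nonneg θ _)]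
  · exact (measurable_sum_of_continuous
      (continuous_poisson (mem_openStrip θ))).ennreal_ofReal
  · simp

lemma harmonicMeasure_absolutelyContinuous (θ : Ioo (0 : ℝ) 1) : harmonicMeasure θ ≪ lines :=
  withDensity_absolutelyContinuous _ _

/-- The substitution ξ = e^{-πt} turns the integrand into a Cauchy density on a half line, with an
arctangent as primitive. The two boundary lines have opposite `a`, so their arctangents cancel and
the total mass is 1. -/
lemma integrable_exp_poisson (a : ℝ) {b : ℝ} (hb : 0 < b) :
    Integrable (fun t : ℝ => b * Real.exp (-(Real.pi * t)) /
      ((Real.exp (-(Real.pi * t)) - a) ^ 2 + b ^ 2)) ∧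
    ∫ t : ℝ, b * Real.exp (-(Real.pi * t)) /
      ((Real.exp (-(Real.pi * t)) - a) ^ 2 + b ^ 2) =
      1 / 2 + Real.arctan (a / b) / Real.pi := by
  set g : ℝ → ℝ := fun t => -(Real.arctan ((Real.exp (-(Real.pi * t)) - a) / b) / Real.pi) with hg
  have hd : ∀ t, HasDerivAt g (b * Real.exp (-(Real.pi * t)) /
      ((Real.exp (-(Real.pi * t)) - a) ^ 2 + b ^ 2)) t := fun t => by
    have h1 : HasDerivAt (fun t : ℝ => Real.exp (-(Real.pi * t)))
        (Real.exp (-(Real.pi * t)) * -(Real.pi)) t := by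
      simpa using (((hasDerivAt_id t).const_mul Real.pi).neg).exp
    have h2 := ((((h1.sub_const a).div_const b).arctan).div_const Real.pi).neg
    refine h2.congr_deriv ?_
    have := Real.pi_pos.ne'
    have h3 : (Real.exp (-(Real.pi * t)) - a) ^ 2 + b ^ 2 ≠ 0 := by positivity
    have h4 : 1 + ((Real.exp (-(Real.pi * t)) - a) / b) ^ 2 ≠ 0 := by positivity
    field_simp
    ring
  have hpi : Tendsto (fun t : ℝ => Real.pi * t) atTop atTop :=
    tendsto_id.const_mul_atTop Real.pi_pos
  have ht : Tendsto g atTop (𝓝 (Real.arctan (a / b) / Real.pi)) := by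
    have h1 : Tendsto (fun t : ℝ => Real.exp (-(Real.pi * t))) atTop (𝓝 0) :=
      Real.tendsto_exp_neg_atTop_nhds_zero.comp hpi
    have h2 := ((((Real.continuous_arctan.tendsto _).comp
      ((h1.sub_const a).div_const b))).div_const Real.pi).neg
    refine h2.congr' (Eventually.of_forall fun _ => rfl) |>.trans (le_of_eq ?_)
    rw [show (0 - a) / b = -(a / b) by ring, Real.arctan_neg, neg_div, neg_neg]
  have hbot : Tendsto g atBot (𝓝 (-(1 / 2))) := by
    have h1 : Tendsto (fun t : ℝ => Real.exp (-(Real.pi * t))) atBot atTop := by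
      refine Real.tendsto_exp_atTop.comp ?_
      exact tendsto_neg_atBot_atTop.comp (tendsto_id.const_mul_atBot Real.pi_pos)
    have h2 : Tendsto (fun t : ℝ => (Real.exp (-(Real.pi * t)) - a) / b) atBot atTop :=
      (tendsto_atTop_add_const_right _ (-a) h1).atTop_div_const hb
    have h3 := (((tendsto_nhds_of_tendsto_nhdsWithin Real.tendsto_arctan_atTop).comp
      h2).div_const Real.pi).neg
    refine h3.congr' (Eventually.of_forall fun _ => rfl) |>.trans (le_of_eq ?_)
    have := Real.pi_pos.ne'
    congr 1
    field_simp
  have hi := integrable_of_hasDerivAt_of_nonneg hd (fun t => by positivity) hbot ht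
  refine ⟨hi, ?_⟩
  rw [integral_of_hasDerivAt_of_tendsto hd hi hbot ht]
  ring

lemma poisson_inl (θ : Ioo (0 : ℝ) 1) (t : ℝ) : poisson (θ : ℝ) (Sum.inl t) =
    (halfPlane (θ : ℝ)).im * Real.exp (-(Real.pi * t)) /
      ((Real.exp (-(Real.pi * t)) - (halfPlane (θ : ℝ)).re) ^ 2 + (halfPlane (θ : ℝ)).im ^ 2) := by
  rw [poisson_eq]
  simp only [lineCoord, Sum.elim_inl, abs_of_pos (Real.exp_pos _), normSq_apply, sub_re, sub_im,
    ofReal_re, ofReal_im]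
  ring_nf

lemma poisson_inr (θ : Ioo (0 : ℝ) 1) (t : ℝ) : poisson (θ : ℝ) (Sum.inr t) =
    (halfPlane (θ : ℝ)).im * Real.exp (-(Real.pi * t)) /
      ((Real.exp (-(Real.pi * t)) - -(halfPlane (θ : ℝ)).re) ^ 2 + (halfPlane (θ : ℝ)).im ^ 2) := by
  rw [poisson_eq]
  simp only [lineCoord, Sum.elim_inr, abs_neg, abs_of_pos (Real.exp_pos _), normSq_apply, sub_re,
    sub_im, ofReal_re, ofReal_im]
  ring_nf

lemma integrable_poisson (θ : Ioo (0 : ℝ) 1) : Integrable (poisson (θ : ℝ)) lines := by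
  rw [integrable_lines]
  simp only [poisson_inl, poisson_inr]
  exact ⟨(integrable_exp_poisson _ (center_im_pos θ)).1,
    (integrable_exp_poisson _ (center_im_pos θ)).1⟩

instance (θ : Ioo (0 : ℝ) 1) : IsProbabilityMeasure (harmonicMeasure θ) := by
  constructor
  have h : ∫ x, poisson (θ : ℝ) x ∂lines = 1 := by
    rw [integral_lines (integrable_poisson θ)]
    simp only [poisson_inl, poisson_inr]
    rw [(integrable_exp_poisson _ (center_im_pos θ)).2,
      (integrable_exp_poisson _ (center_im_pos θ)).2, neg_div, Real.arctan_neg]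
    ring
  rw [harmonicMeasure, withDensity_apply _ MeasurableSet.univ, setLIntegral_univ,
    ← ofReal_integral_eq_lintegral_ofReal (integrable_poisson θ)
      (Eventually.of_forall (poisson_nonneg θ)), h, ENNReal.ofReal_one]

/-- Along a boundary line the image point turns with angular speed 2π times the (signed) kernel:
harmonic measure is normalized arc length. The hypothesis on ξ covers both e^{-πt} and its negative.
-/
lemma hasDerivAt_bdryPt_aux (θ : Ioo (0 : ℝ) 1) {ξ : ℝ → ℝ} {t : ℝ}
    (hξ : HasDerivAt ξ (-(Real.pi * ξ t)) t) :
    HasDerivAt (fun t => ((ξ t : ℂ) - halfPlane (θ : ℝ)) / (ξ t - conj (halfPlane (θ : ℝ))))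
      (-(2 * Real.pi * I) * ((halfPlane (θ : ℝ)).im * ξ t / normSq (halfPlane (θ : ℝ) - ξ t) : ℝ) *
        (((ξ t : ℂ) - halfPlane (θ : ℝ)) / (ξ t - conj (halfPlane (θ : ℝ))))) t := by
  have h1 : HasDerivAt (fun t => (ξ t : ℂ)) ((-(Real.pi * ξ t) : ℝ) : ℂ) t := hξ.ofReal_comp
  have hne : (ξ t : ℂ) - conj (halfPlane (θ : ℝ)) ≠ 0 :=
    sub_conj_ne_zero (by simp) (center_im_pos θ)
  have hne' : (ξ t : ℂ) - halfPlane (θ : ℝ) ≠ 0 := fun h => hne (by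
    have := congrArg conj h; simpa using this)
  refine ((h1.sub_const (halfPlane (θ : ℝ))).div (h1.sub_const _) hne).congr_deriv ?_
  set w := halfPlane (θ : ℝ)
  have e1 : (normSq (w - ξ t) : ℂ) = (ξ t - w) * (ξ t - conj w) := by
    rw [normSq_eq_conj_mul_self]; simp; ring
  have e2 : (w.im : ℂ) * (2 * I) = w - conj w := by
    apply Complex.ext <;> simp; ring
  push_cast
  rw [e1]
  field_simp
  linear_combination (ξ t : ℂ) * e2

lemma tendsto_bdryPt_aux (θ : Ioo (0 : ℝ) 1) {ξ : ℝ → ℝ} {l : Filter ℝ}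
    (hξ : Tendsto ξ l (cocompact ℝ)) :
    Tendsto (fun t => ((ξ t : ℂ) - halfPlane (θ : ℝ)) / (ξ t - conj (halfPlane (θ : ℝ)))) l
      (𝓝 1) := by
  have h0 : Tendsto (fun t => (ξ t : ℂ) - conj (halfPlane (θ : ℝ))) l (Bornology.cobounded ℂ) := by
    have h1 : Tendsto (fun t => ‖(ξ t : ℂ)‖) l atTop := by
      simp only [norm_real]
      rw [← Metric.cobounded_eq_cocompact] at hξ
      exact tendsto_norm_cobounded_atTop.comp hξ
    rw [← tendsto_norm_atTop_iff_cobounded]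
    refine tendsto_atTop_mono (fun t => ?_)
      (tendsto_atTop_add_const_right _ (-‖conj (halfPlane (θ : ℝ))‖) h1)
    have := norm_sub_norm_le (ξ t : ℂ) (conj (halfPlane (θ : ℝ)))
    linarith
  have h2 : Tendsto (fun t => 1 + (conj (halfPlane (θ : ℝ)) - halfPlane (θ : ℝ)) *
      ((ξ t : ℂ) - conj (halfPlane (θ : ℝ)))⁻¹) l (𝓝 (1 + (conj (halfPlane (θ : ℝ)) -
        halfPlane (θ : ℝ)) * 0)) :=
    ((tendsto_inv₀_cobounded.comp h0).const_mul _).const_add _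
  simp only [mul_zero, add_zero] at h2
  refine h2.congr fun t => ?_
  have hne : (ξ t : ℂ) - conj (halfPlane (θ : ℝ)) ≠ 0 :=
    sub_conj_ne_zero (by simp) (center_im_pos θ)
  field_simp
  ring

/-- Since b' = -2πi (kernel) b, the integrand has the exact primitive -b^k/(2πik). The end values
are b → 1 where ξ is unbounded and b → w/w̄ where ξ → 0. -/
lemma integral_poisson_mul_pow (θ : Ioo (0 : ℝ) 1) {ξ : ℝ → ℝ} {k : ℕ} (hk : k ≠ 0)
    (hξ : ∀ t, HasDerivAt ξ (-(Real.pi * ξ t)) t)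
    (hint : Integrable fun t => (halfPlane (θ : ℝ)).im * ξ t / normSq (halfPlane (θ : ℝ) - ξ t))
    (hbot : Tendsto ξ atBot (cocompact ℝ)) (htop : Tendsto ξ atTop (𝓝 0)) :
    ∫ t, (((halfPlane (θ : ℝ)).im * ξ t / normSq (halfPlane (θ : ℝ) - ξ t) : ℝ) : ℂ) *
        (((ξ t : ℂ) - halfPlane (θ : ℝ)) / (ξ t - conj (halfPlane (θ : ℝ)))) ^ k =
      (1 - (halfPlane (θ : ℝ) / conj (halfPlane (θ : ℝ))) ^ k) / (2 * Real.pi * I * k) := by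
  set w := halfPlane (θ : ℝ) with hw
  set b : ℝ → ℂ := fun t => ((ξ t : ℂ) - w) / (ξ t - conj w) with hbdef
  have hpi : (Real.pi : ℂ) ≠ 0 := by exact_mod_cast Real.pi_ne_zero
  have hk' : (k : ℂ) ≠ 0 := by exact_mod_cast hk
  have hd : ∀ t, HasDerivAt (fun t => -(b t ^ k / (2 * Real.pi * I * k)))
      (((w.im * ξ t / normSq (w - ξ t) : ℝ) : ℂ) * b t ^ k) t := fun t => by
    refine (((hasDerivAt_bdryPt_aux θ (hξ t)).pow k).div_const (2 * Real.pi * I * k)).neg.congr_deriv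
      ?_
    rw [← hw, ← show b t = ((ξ t : ℂ) - w) / (ξ t - conj w) from rfl]
    obtain ⟨m, rfl⟩ := Nat.exists_eq_succ_of_ne_zero hk
    simp only [Nat.succ_eq_add_one, Nat.add_sub_cancel, pow_succ]
    field_simp
  have hne : conj w ≠ 0 := by simp [hw, halfPlane]
  have htop' : Tendsto b atTop (𝓝 (w / conj w)) := by
    have h1 : Tendsto (fun t => (ξ t : ℂ)) atTop (𝓝 ((0 : ℝ) : ℂ)) :=
      (continuous_ofReal.tendsto _).comp htop
    have := (h1.sub_const w).div (h1.sub_const (conj w)) (by simpa using hne)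
    simpa using! this
  have hcont : Continuous ξ := continuous_iff_continuousAt.2 fun t => (hξ t).continuousAt
  have hbn : ∀ t, ‖b t‖ = 1 := fun t => by
    have : b t = conj (ξ t - conj w) / (ξ t - conj w) := by simp [hbdef]
    rw [this, norm_div, RCLike.norm_conj, div_self]
    exact norm_ne_zero_iff.2 (sub_conj_ne_zero (by simp) (center_im_pos θ))
  have hbc : Continuous b := by
    refine Continuous.div (by fun_prop) (by fun_prop) fun t => ?_
    exact sub_conj_ne_zero (by simp) (center_im_pos θ)
  have hi : Integrable fun t => ((w.im * ξ t / normSq (w - ξ t) : ℝ) : ℂ) * b t ^ k := by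
    refine (hint.ofReal (𝕜 := ℂ)).mul_bdd (c := 1) (hbc.pow k).aestronglyMeasurable
      (Eventually.of_forall fun t => ?_)
    simp [hbn]
  rw [integral_of_hasDerivAt_of_tendsto hd hi
    (((tendsto_bdryPt_aux θ hbot).pow k).div_const _).neg ((htop'.pow k).div_const _).neg]
  field_simp
  ring

/-- The lines cover the two complementary arcs with opposite orientations between the same end
points, so the two primitives contribute opposite amounts. -/
lemma integral_bdryPt_pow (θ : Ioo (0 : ℝ) 1) {k : ℕ} (hk : k ≠ 0) :
    ∫ x, (bdryPt θ x : ℂ) ^ k ∂harmonicMeasure θ = 0 := by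
  have hc : Continuous fun x => (bdryPt θ x : ℂ) ^ k :=
    (continuous_subtype_val.comp (continuous_bdryPt θ)).pow k
  have hint : Integrable (fun x => (bdryPt θ x : ℂ) ^ k) (harmonicMeasure θ) :=
    Integrable.of_bound (measurable_sum_of_continuous hc).aestronglyMeasurable 1
      (Eventually.of_forall fun x => by rw [norm_pow, Circle.norm_coe, one_pow])
  rw [integral_harmonicMeasure, integral_lines ((integrable_harmonicMeasure θ).1 hint)]
  have hpi : Tendsto (fun t : ℝ => Real.pi * t) atTop atTop :=
    tendsto_id.const_mul_atTop Real.pi_pos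
  have h1 : Tendsto (fun t : ℝ => Real.exp (-(Real.pi * t))) atTop (𝓝 0) :=
    Real.tendsto_exp_neg_atTop_nhds_zero.comp hpi
  have h2 : Tendsto (fun t : ℝ => Real.exp (-(Real.pi * t))) atBot atTop :=
    Real.tendsto_exp_atTop.comp
      (tendsto_neg_atBot_atTop.comp (tendsto_id.const_mul_atBot Real.pi_pos))
  have hd : ∀ t, HasDerivAt (fun t : ℝ => Real.exp (-(Real.pi * t)))
      (-(Real.pi * Real.exp (-(Real.pi * t)))) t := fun t => by
    refine ((((hasDerivAt_id t).const_mul Real.pi).neg).exp).congr_deriv ?_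
    simp; ring
  have hP := integrable_lines.1 (integrable_poisson θ)
  have A := integral_poisson_mul_pow θ hk hd (by
      refine hP.1.congr (Eventually.of_forall fun t => ?_)
      simp [poisson_eq, lineCoord, abs_of_pos (Real.exp_pos _)])
      (h2.mono_right atTop_le_cocompact) h1
  have B := integral_poisson_mul_pow θ hk (ξ := fun t => -Real.exp (-(Real.pi * t)))
      (fun t => ((hd t).neg).congr_deriv (by ring)) (by
      refine hP.2.neg.congr (Eventually.of_forall fun t => ?_)
      simp [poisson_eq, lineCoord, abs_of_pos (Real.exp_pos _)]
      ring)
      ((tendsto_neg_atTop_atBot.comp h2).mono_right atBot_le_cocompact) (by simpa using h1.neg)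
  have A' : ∫ t, poisson (θ : ℝ) (Sum.inl t) • (bdryPt θ (Sum.inl t) : ℂ) ^ k =
      (1 - (halfPlane (θ : ℝ) / conj (halfPlane (θ : ℝ))) ^ k) / (2 * Real.pi * I * k) := by
    rw [← A]
    congr with t
    rw [real_smul, coe_bdryPt, poisson_eq]
    simp [lineCoord, abs_of_pos (Real.exp_pos _)]
  have B' : ∫ t, poisson (θ : ℝ) (Sum.inr t) • (bdryPt θ (Sum.inr t) : ℂ) ^ k =
      -((1 - (halfPlane (θ : ℝ) / conj (halfPlane (θ : ℝ))) ^ k) / (2 * Real.pi * I * k)) := by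
    rw [← B, ← integral_neg]
    congr with t
    rw [real_smul, coe_bdryPt, poisson_eq]
    simp [lineCoord, abs_of_pos (Real.exp_pos _)]
    ring
  rw [A', B', add_neg_cancel]

end Strip

/-! ### The inverse map, the disc kernel and the moments of boundary functions. -/

namespace Strip

open Complex Filter Topology ComplexConjugate

/-- The inverse of the conformal map `toDisc`. -/
def ofDisc (θ : Ioo (0 : ℝ) 1) (ζ : ℂ) : ℂ :=
  log ((halfPlane (θ : ℝ) - conj (halfPlane (θ : ℝ)) * ζ) / (1 - ζ)) / (Real.pi * I)

lemma one_sub_ne_zero {ζ : ℂ} (hζ : ζ ∈ Metric.ball (0 : ℂ) 1) : 1 - ζ ≠ 0 := by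
  intro h
  have : ζ = 1 := by linear_combination -h
  simp [this] at hζ

lemma ofDisc_aux {w ζ : ℂ} (hw : 0 < w.im) (hζ : ζ ∈ Metric.ball (0 : ℂ) 1) :
    0 < ((w - conj w * ζ) / (1 - ζ)).im := by
  have h1 := one_sub_ne_zero hζ
  have h2 : (w - conj w * ζ) / (1 - ζ) =
      ((w - conj w * ζ) * conj (1 - ζ)) * ((normSq (1 - ζ))⁻¹ : ℝ) := by
    rw [div_eq_mul_inv, inv_def]; push_cast; ring
  have h3 : normSq ζ < 1 := by
    rw [normSq_eq_norm_sq]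
    have : ‖ζ‖ < 1 := by simpa using hζ
    nlinarith [norm_nonneg ζ]
  rw [h2, im_mul_ofReal]
  refine mul_pos ?_ (inv_pos.2 (normSq_pos.2 h1))
  have : ((w - conj w * ζ) * conj (1 - ζ)).im = w.im * (1 - normSq ζ) := by
    simp [normSq_apply]; ring
  rw [this]
  exact mul_pos hw (by linarith)

lemma halfPlane_ofDisc (θ : Ioo (0 : ℝ) 1) {ζ : ℂ} (hζ : ζ ∈ Metric.ball (0 : ℂ) 1) :
    halfPlane (ofDisc θ ζ) =
      (halfPlane (θ : ℝ) - conj (halfPlane (θ : ℝ)) * ζ) / (1 - ζ) := by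
  have h := ofDisc_aux (center_im_pos θ) hζ
  have hp : (Real.pi : ℂ) ≠ 0 := by exact_mod_cast Real.pi_ne_zero
  have h0 : (halfPlane (θ : ℝ) - conj (halfPlane (θ : ℝ)) * ζ) / (1 - ζ) ≠ 0 := fun h' => by
    rw [h'] at h; simp at h
  rw [halfPlane, ofDisc]
  convert exp_log h0 using 2
  field_simp

lemma ofDisc_mem (θ : Ioo (0 : ℝ) 1) {ζ : ℂ} (hζ : ζ ∈ Metric.ball (0 : ℂ) 1) :
    ofDisc θ ζ ∈ openStrip := by
  have h := ofDisc_aux (center_im_pos θ) hζ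
  set v := (halfPlane (θ : ℝ) - conj (halfPlane (θ : ℝ)) * ζ) / (1 - ζ) with hv
  have e : (ofDisc θ ζ).re = arg v / Real.pi := by
    have : ofDisc θ ζ = log v * (-I) * ((Real.pi)⁻¹ : ℝ) := by
      rw [ofDisc, ← hv]
      have hp : (Real.pi : ℂ) ≠ 0 := by exact_mod_cast Real.pi_ne_zero
      push_cast
      field_simp
      rw [I_sq]; ring
    rw [this, re_mul_ofReal]
    simp [log_im, div_eq_mul_inv]
  have h1 : 0 < arg v := by
    rcases (arg_nonneg_iff.2 h.le).lt_or_eq with h' | h'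
    · exact h'
    · exact absurd (arg_eq_zero_iff.1 h'.symm).2 h.ne'
  have h2 : arg v < Real.pi := (arg_le_pi v).lt_of_ne fun h' => h.ne' (arg_eq_pi_iff.1 h').2
  constructor
  · rw [e]; exact div_pos h1 Real.pi_pos
  · rw [e, div_lt_one Real.pi_pos]; exact h2

lemma toDisc_ofDisc (θ : Ioo (0 : ℝ) 1) {ζ : ℂ} (hζ : ζ ∈ Metric.ball (0 : ℂ) 1) :
    toDisc θ (ofDisc θ ζ) = ζ := by
  have hd := denom_ne_zero θ (openStrip_subset (ofDisc_mem θ hζ))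
  have h1 := one_sub_ne_zero hζ
  rw [toDisc, div_eq_iff hd, halfPlane_ofDisc θ hζ]
  field_simp
  ring

lemma differentiableOn_ofDisc (θ : Ioo (0 : ℝ) 1) :
    DifferentiableOn ℂ (ofDisc θ) (Metric.ball 0 1) := fun ζ hζ => by
  have h := ofDisc_aux (center_im_pos θ) hζ
  have h1 := one_sub_ne_zero hζ
  refine DifferentiableAt.differentiableWithinAt ?_
  unfold ofDisc
  have h2 : DifferentiableAt ℂ (fun ζ => (halfPlane (θ : ℝ) - conj (halfPlane (θ : ℝ)) * ζ) /
      (1 - ζ)) ζ := DifferentiableAt.div (by fun_prop) (by fun_prop) h1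
  exact (h2.clog (Or.inr h.ne')).div_const _

/-- The coordinate function on the circle. -/
def chi : C(Circle, ℂ) := ⟨fun b => (b : ℂ), continuous_induced_dom⟩

@[simp] lemma chi_apply (b : Circle) : chi b = b := rfl

lemma norm_chi : ‖chi‖ = 1 := by
  refine le_antisymm ((ContinuousMap.norm_le _ zero_le_one).2 fun b => by
    rw [chi_apply, Circle.norm_coe]) ?_
  simpa using chi.norm_coe_le_norm (1 : Circle)

lemma chi_mul_star : chi * star chi = 1 := by
  ext b
  have : (b : ℂ) * conj (b : ℂ) = 1 := by rw [mul_conj]; simp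
  simpa using this

lemma isUnit_one_sub {a : C(Circle, ℂ)} (ha : ‖a‖ ≤ 1) {w : ℂ} (hw : ‖w‖ < 1) :
    IsUnit (1 - w • a) := by
  refine isUnit_one_sub_of_norm_lt_one ?_
  calc ‖w • a‖ ≤ ‖w‖ * ‖a‖ := norm_smul_le _ _
    _ ≤ ‖w‖ := mul_le_of_le_one_right (norm_nonneg _) ha
    _ < 1 := hw

lemma inverse_apply {a : C(Circle, ℂ)} (ha : IsUnit a) (b : Circle) :
    (Ring.inverse a) b = (a b)⁻¹ := by
  have := DFunLike.congr_fun (Ring.inverse_mul_cancel a ha) b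
  exact eq_inv_of_mul_eq_one_left this

/-- The Poisson kernel of the disc, as a continuous function on the circle. -/
def discPoisson (w : ℂ) : C(Circle, ℂ) :=
  Ring.inverse (1 - w • star chi) + Ring.inverse (1 - conj w • chi) - 1

/-- The definition by resolvents separates the holomorphic from the antiholomorphic dependence on w,
which the moment arguments need; this recovers the classical formula, which the estimates need. On
the circle b̄ = 1/b. -/
lemma discPoisson_apply {w : ℂ} (hw : ‖w‖ < 1) (b : Circle) :
    discPoisson w b = ((1 - normSq w) / normSq ((b : ℂ) - w) : ℝ) := by
  have h1 := isUnit_one_sub (a := star chi) (by rw [norm_star, norm_chi]) hw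
  have h2 := isUnit_one_sub (a := chi) norm_chi.le (w := conj w) (by simpa using hw)
  simp only [discPoisson, ContinuousMap.sub_apply, ContinuousMap.add_apply, inverse_apply h1,
    inverse_apply h2, ContinuousMap.smul_apply, ContinuousMap.one_apply, ContinuousMap.star_apply,
    chi_apply, smul_eq_mul, star_def]
  have hb : (b : ℂ) * conj (b : ℂ) = 1 := by rw [mul_conj]; simp
  have hn : ‖(b : ℂ)‖ = 1 := Circle.norm_coe b
  generalize (b : ℂ) = c at *
  have hb0 : c ≠ 0 := left_ne_zero_of_mul_eq_one hb
  have n1 : c - w ≠ 0 := by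
    intro h
    rw [sub_eq_zero.1 h] at hn
    linarith
  have n2 : conj c - conj w ≠ 0 := by
    rw [← map_sub]; exact (map_ne_zero _).2 n1
  have n3 : 1 - w * conj c ≠ 0 := by
    intro h; apply n1; linear_combination c * h + w * hb
  have n4 : 1 - conj w * c ≠ 0 := by
    intro h; apply n2; linear_combination conj c * h + conj w * hb
  push_cast
  rw [← mul_conj, ← mul_conj]
  simp only [map_sub]
  rw [eq_div_iff (mul_ne_zero n1 n2)]
  have e1 : (1 - w * conj c)⁻¹ = c * (c - w)⁻¹ := by
    field_simp
    linear_combination w * hb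
  have e2 : (1 - conj w * c)⁻¹ = conj c * (conj c - conj w)⁻¹ := by
    field_simp
    linear_combination conj w * hb
  rw [e1, e2]
  field_simp
  linear_combination hb

lemma integrable_smul_bdry {E : Type*} [NormedAddCommGroup E] [NormedSpace ℂ E]
    {θ : Ioo (0 : ℝ) 1} {u : ℝ ⊕ ℝ → E} (hu : Integrable u (harmonicMeasure θ))
    (m : C(Circle, ℂ)) : Integrable (fun x => m (bdryPt θ x) • u x) (harmonicMeasure θ) :=
  hu.bdd_smul ‖m‖ (measurable_sum_of_continuous
    (m.continuous.comp (continuous_bdryPt θ))).aestronglyMeasurable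
    (Eventually.of_forall fun _ => m.norm_coe_le_norm _)

/-- The pairing of an integrable boundary function with the continuous functions on the circle. -/
def pairing {E : Type*} [NormedAddCommGroup E] [NormedSpace ℂ E] (θ : Ioo (0 : ℝ) 1)
    {u : ℝ ⊕ ℝ → E} (hu : Integrable u (harmonicMeasure θ)) : C(Circle, ℂ) →L[ℂ] E :=
  LinearMap.mkContinuous
    { toFun := fun m => ∫ x, m (bdryPt θ x) • u x ∂harmonicMeasure θ
      map_add' := fun m m' => by
        simp only [ContinuousMap.add_apply, add_smul]
        exact integral_add (integrable_smul_bdry hu m) (integrable_smul_bdry hu m')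
      map_smul' := fun c m => by
        simp only [ContinuousMap.smul_apply, smul_assoc, RingHom.id_apply]
        exact integral_smul c _ }
    (∫ x, ‖u x‖ ∂harmonicMeasure θ) fun m => by
      refine (norm_integral_le_integral_norm _).trans ?_
      rw [← integral_mul_const]
      refine integral_mono_of_nonneg (Eventually.of_forall fun x => norm_nonneg _)
        (hu.norm.mul_const _) (Eventually.of_forall fun x => ?_)
      simp only [norm_smul]
      rw [mul_comm]
      exact mul_le_mul_of_nonneg_left (m.norm_coe_le_norm _) (norm_nonneg _)

section pairing

variable {E : Type*} [NormedAddCommGroup E] [NormedSpace ℂ E] {θ : Ioo (0 : ℝ) 1}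
    {u : ℝ ⊕ ℝ → E} (hu : Integrable u (harmonicMeasure θ))

lemma pairing_apply (m : C(Circle, ℂ)) :
    pairing θ hu m = ∫ x, m (bdryPt θ x) • u x ∂harmonicMeasure θ := rfl

lemma norm_pairing_le {C : ℝ} (hC : ∀ᵐ x ∂harmonicMeasure θ, ‖u x‖ ≤ C) (m : C(Circle, ℂ)) :
    ‖pairing θ hu m‖ ≤ C * ∫ x, ‖m (bdryPt θ x)‖ ∂harmonicMeasure θ := by
  rw [pairing_apply, ← integral_const_mul]
  refine norm_integral_le_of_norm_le ?_ ?_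
  · refine Integrable.const_mul (Integrable.of_bound (measurable_sum_of_continuous
      ((m.continuous.comp (continuous_bdryPt θ)).norm)).aestronglyMeasurable ‖m‖
      (Eventually.of_forall fun x => ?_)) _
    simpa using m.norm_coe_le_norm _
  · filter_upwards [hC] with x hx
    rw [norm_smul, mul_comm]
    exact mul_le_mul_of_nonneg_right hx (norm_nonneg _)

end pairing

section moments

variable {E : Type*} [NormedAddCommGroup E] [NormedSpace ℂ E] (L : C(Circle, ℂ) →L[ℂ] E)

/-- Neumann series: the coefficients are L(a^n). For a = χ these are the moments required to vanish,
for a = χ̄ the Taylor coefficients of the analytic function. -/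
lemma hasFPowerSeriesOnBall_inverse {a : C(Circle, ℂ)} (ha : ‖a‖ = 1) :
    HasFPowerSeriesOnBall (fun z : ℂ => L (Ring.inverse (1 - z • a)))
      (L.compFormalMultilinearSeries
        (fun n => ContinuousMultilinearMap.mkPiRing ℂ (Fin n) (a ^ n))) 0 1 := by
  have := L.comp_hasFPowerSeriesOnBall (spectrum.hasFPowerSeriesOnBall_inverse_one_sub_smul ℂ a)
  have h1 : ‖a‖₊ = 1 := by ext; simpa using ha
  rw [h1] at this
  simpa using! this

lemma eball_one : Metric.eball (0 : ℂ) 1 = Metric.ball 0 1 := by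
  rw [← ENNReal.ofReal_one, Metric.eball_ofReal]

lemma differentiableOn_inverse [CompleteSpace E] {a : C(Circle, ℂ)} (ha : ‖a‖ = 1) :
    DifferentiableOn ℂ (fun z : ℂ => L (Ring.inverse (1 - z • a))) (Metric.ball 0 1) := by
  rw [← eball_one]
  exact (hasFPowerSeriesOnBall_inverse L ha).differentiableOn

lemma hasDerivAt_inverse {a : C(Circle, ℂ)} (ha : ‖a‖ = 1) :
    HasDerivAt (fun z : ℂ => L (Ring.inverse (1 - z • a))) (L a) 0 := by
  have h := (hasFPowerSeriesOnBall_inverse L ha).hasFPowerSeriesAt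
  have := h.hasDerivAt
  simpa [ContinuousLinearMap.compFormalMultilinearSeries] using this

/-- The real derivative of the composition is v ↦ v̄ m; being also complex linear, it takes
compatible values at 1 and I only if m = 0. -/
lemma deriv_eq_zero_of_conj {M : ℂ → E} {m c : E} {z : ℂ} (h : HasDerivAt M m (conj z))
    (h' : HasDerivAt (fun z => M (conj z)) c z) : m = 0 := by
  have h1 : HasFDerivAt (𝕜 := ℝ) (fun z => M (conj z)) _ z :=
    (h.hasFDerivAt.restrictScalars ℝ).comp z
      (conjCLE.toContinuousLinearMap.hasFDerivAt (x := z))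
  have h2 := h1.unique (h'.hasFDerivAt.restrictScalars ℝ)
  have e1 := DFunLike.congr_fun h2 1
  have e2 := DFunLike.congr_fun h2 I
  simp at e1 e2
  rw [← e1, ← add_eq_zero_iff_neg_eq, ← two_smul ℂ (I • m), smul_smul] at e2
  simpa using e2

/-- If the Poisson integral is analytic then the positive moments vanish. -/
lemma moments_eq_zero [CompleteSpace E]
    (hL : DifferentiableOn ℂ (fun ζ => L (discPoisson ζ)) (Metric.ball 0 1)) {k : ℕ}
    (hk : k ≠ 0) : L (chi ^ k) = 0 := by
  set M : ℂ → E := fun ζ => L (Ring.inverse (1 - ζ • chi)) with hM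
  have hd := differentiableOn_inverse L norm_chi
  -- The antiholomorphic part is the Poisson integral minus its holomorphic part and a constant,
  -- hence is holomorphic as well, hence constant.
  have hd' : DifferentiableOn ℂ (fun ζ => M (conj ζ)) (Metric.ball 0 1) := by
    have := (hL.sub (differentiableOn_inverse L (a := star chi)
      (by rw [norm_star, norm_chi]))).add_const (L 1)
    refine this.congr fun ζ _ => ?_
    simp [hM, discPoisson]
    abel
  have hz : ∀ z ∈ Metric.ball (0 : ℂ) 1, deriv M z = 0 := fun z hz => by
    have hz' : conj z ∈ Metric.ball (0 : ℂ) 1 := by simpa using hz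
    have h1 := (hd.differentiableAt (Metric.isOpen_ball.mem_nhds hz)).hasDerivAt
    rw [← conj_conj z] at h1
    have := deriv_eq_zero_of_conj h1
      (hd'.differentiableAt (Metric.isOpen_ball.mem_nhds hz')).hasDerivAt
    simpa using! this
  have hconst : ∀ z ∈ Metric.ball (0 : ℂ) 1, M z = M 0 := fun z hz' =>
    Metric.isOpen_ball.is_const_of_deriv_eq_zero (convex_ball _ _).isPreconnected hd hz hz'
      (Metric.mem_ball_self one_pos)
  have h1 := (hasFPowerSeriesOnBall_inverse L norm_chi).hasFPowerSeriesAt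
  have h2 : HasFPowerSeriesAt M (constFormalMultilinearSeries ℂ ℂ (M 0)) 0 :=
    (hasFPowerSeriesAt_const (c := M 0)).congr (by
      filter_upwards [Metric.isOpen_ball.mem_nhds (Metric.mem_ball_self one_pos)] with z hz'
      exact (hconst z hz').symm)
  have h3 := h1.eq_formalMultilinearSeries h2
  have h4 := congrArg (fun p : FormalMultilinearSeries ℂ ℂ E => p k fun _ => 1) h3
  simp [ContinuousLinearMap.compFormalMultilinearSeries] at h4
  rw [h4, FormalMultilinearSeries.coeff, constFormalMultilinearSeries_apply_of_nonzero hk]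
  simp

variable {L}

lemma pairing_pow_mul_inverse (hL : ∀ k : ℕ, k ≠ 0 → L (chi ^ k) = 0) {k : ℕ} (hk : k ≠ 0) {ζ : ℂ} (hζ : ‖ζ‖ < 1) :
    L (chi ^ k * Ring.inverse (1 - ζ • chi)) = 0 := by
  have h := hasFPowerSeriesOnBall_inverse
    (L.comp (ContinuousLinearMap.mul ℂ C(Circle, ℂ) (chi ^ k))) norm_chi
  have h1 := h.hasSum (y := ζ) (by rw [eball_one]; simpa using hζ)
  have h2 : (fun n => (L.comp (ContinuousLinearMap.mul ℂ C(Circle, ℂ)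
      (chi ^ k))).compFormalMultilinearSeries
      (fun n => ContinuousMultilinearMap.mkPiRing ℂ (Fin n) (chi ^ n)) n fun _ : Fin n => ζ) =
      fun _ => 0 := by
    funext n
    simp [ContinuousLinearMap.compFormalMultilinearSeries, ← pow_add, hL (k + n) (by omega)]
  rw [h2] at h1
  simpa using h1.unique hasSum_zero

lemma pairing_inverse (hL : ∀ k : ℕ, k ≠ 0 → L (chi ^ k) = 0) {ζ : ℂ} (hζ : ‖ζ‖ < 1) : L (Ring.inverse (1 - ζ • chi)) = L 1 := by
  have h := isUnit_one_sub norm_chi.le hζ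
  have e : Ring.inverse (1 - ζ • chi) = 1 + ζ • (chi ^ 1 * Ring.inverse (1 - ζ • chi)) := by
    have h2 := Ring.mul_inverse_cancel _ h
    rw [sub_mul, one_mul, smul_mul_assoc] at h2
    rw [pow_one]
    exact eq_add_of_sub_eq h2
  rw [e, map_add, map_smul, pairing_pow_mul_inverse hL one_ne_zero hζ, smul_zero, add_zero]

/-- When the positive moments vanish, the antiholomorphic resolvent contributes only L 1, which
cancels the term -1 of the kernel. -/
lemma pairing_discPoisson (hL : ∀ k : ℕ, k ≠ 0 → L (chi ^ k) = 0) {w : ℂ} (hw : ‖w‖ < 1) :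
    L (discPoisson w) = L (Ring.inverse (1 - w • star chi)) := by
  rw [discPoisson, map_sub, map_add, pairing_inverse hL (by simpa using hw), add_sub_cancel_right]

/-- The Poisson integral of χ^k f at w is w^k f(w). By χ(1 - wχ̄)⁻¹ = χ + w(1 - wχ̄)⁻¹ each factor χ
is traded for a factor w, and the leftover positive power of χ is killed by L. Hence P_w f has
nonnegative moments that depend on f(w) alone. -/
lemma pairing_pow_mul_discPoisson (hL : ∀ k : ℕ, k ≠ 0 → L (chi ^ k) = 0) (k : ℕ) {w : ℂ} (hw : ‖w‖ < 1) :
    L (chi ^ k * discPoisson w) = w ^ k • L (discPoisson w) := by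
  have h := isUnit_one_sub (a := star chi) (by rw [norm_star, norm_chi]) hw
  have e : chi * Ring.inverse (1 - w • star chi) =
      chi + w • Ring.inverse (1 - w • star chi) := by
    have h2 := congrArg (chi * ·) (Ring.mul_inverse_cancel _ h)
    simp only [mul_one] at h2
    rw [← mul_assoc, mul_sub, mul_smul_comm, chi_mul_star, mul_one, sub_mul, smul_mul_assoc,
      one_mul] at h2
    rw [← sub_eq_iff_eq_add]
    exact h2
  have key : ∀ k : ℕ, L (chi ^ k * Ring.inverse (1 - w • star chi)) =
      w ^ k • L (Ring.inverse (1 - w • star chi)) := by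
    intro k
    induction k with
    | zero => simp
    | succ k ih =>
      rw [pow_succ, mul_assoc, e, mul_add, ← pow_succ, map_add, hL _ (Nat.succ_ne_zero k), zero_add,
        mul_smul_comm, map_smul, ih, smul_smul, ← pow_succ']
  rcases eq_or_ne k 0 with rfl | hk
  · simp
  · rw [pairing_discPoisson hL hw, ← key, discPoisson, mul_sub, mul_add, mul_one, map_sub, map_add,
      hL _ hk, pairing_pow_mul_inverse hL hk (by simpa using hw), sub_zero, add_zero]

end moments

end Strip

/-! ### Boundary functions and the space 𝓕^∞. -/

namespace InterpolationPair

open Complex Filter Topology ComplexConjugate Strip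

variable {E : Type u} [NormedAddCommGroup E] [NormedSpace ℂ E] (P : InterpolationPair E)

/-- Pairs of essentially bounded boundary functions on the two lines. -/
abbrev BdryFun : Type u :=
  Lp P.X₀ ∞ (volume : Measure ℝ) × Lp P.X₁ ∞ (volume : Measure ℝ)

variable {P}

/-- The values in `E` of boundary functions. -/
def eval (f : P.BdryFun) : ℝ ⊕ ℝ → E :=
  Sum.elim (fun t => P.emb₀ (f.1 t)) (fun t => P.emb₁ (f.2 t))

/-- The pointwise norms of boundary functions. -/
def normAt (f : P.BdryFun) : ℝ ⊕ ℝ → ℝ := Sum.elim (fun t => ‖f.1 t‖) (fun t => ‖f.2 t‖)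

variable (P) in
/-- A bound for the norms of the two embeddings. -/
def embNorm : ℝ := max ‖P.emb₀‖ ‖P.emb₁‖

variable (P) in
lemma embNorm_nonneg : 0 ≤ P.embNorm := (norm_nonneg _).trans (le_max_left _ _)

lemma norm_emb₀_le (a : P.X₀) : ‖P.emb₀ a‖ ≤ P.embNorm * ‖a‖ :=
  (P.emb₀.le_opNorm a).trans (mul_le_mul_of_nonneg_right (le_max_left _ _) (norm_nonneg _))

lemma norm_emb₁_le (a : P.X₁) : ‖P.emb₁ a‖ ≤ P.embNorm * ‖a‖ :=
  (P.emb₁.le_opNorm a).trans (mul_le_mul_of_nonneg_right (le_max_right _ _) (norm_nonneg _))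

lemma norm_eval_le (f : P.BdryFun) (x : ℝ ⊕ ℝ) : ‖eval f x‖ ≤ P.embNorm * normAt f x := by
  rcases x with t | t
  · exact norm_emb₀_le _
  · exact norm_emb₁_le _

lemma normAt_nonneg (f : P.BdryFun) (x : ℝ ⊕ ℝ) : 0 ≤ normAt f x := by
  rcases x with t | t <;> exact norm_nonneg _

lemma ae_norm_le_Lp {X : Type*} [NormedAddCommGroup X] (f : Lp X ∞ (volume : Measure ℝ)) :
    ∀ᵐ t, ‖f t‖ ≤ ‖f‖ := by
  filter_upwards [ae_le_eLpNormEssSup (f := f) (μ := volume)] with t ht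
  rw [Lp.norm_def, eLpNorm_exponent_top, ← toReal_enorm]
  refine ENNReal.toReal_mono ?_ ht
  rw [← eLpNorm_exponent_top]
  exact (Lp.memLp f).eLpNorm_ne_top

lemma ae_normAt_le (f : P.BdryFun) : ∀ᵐ x ∂lines, normAt f x ≤ ‖f‖ := by
  rw [ae_lines]
  constructor
  · filter_upwards [ae_norm_le_Lp f.1] with t ht using ht.trans (norm_fst_le f)
  · filter_upwards [ae_norm_le_Lp f.2] with t ht using ht.trans (norm_snd_le f)

lemma norm_Lp_le {X : Type*} [NormedAddCommGroup X] {f : Lp X ∞ (volume : Measure ℝ)} {C : ℝ}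
    (hC : 0 ≤ C) (h : ∀ᵐ t, ‖f t‖ ≤ C) : ‖f‖ ≤ C := by
  rw [Lp.norm_def]
  refine ENNReal.toReal_le_of_le_ofReal hC ?_
  rw [eLpNorm_exponent_top]
  exact eLpNormEssSup_le_of_ae_bound h

lemma norm_bdryFun_le {f : P.BdryFun} {C : ℝ} (hC : 0 ≤ C)
    (h : ∀ᵐ x ∂lines, normAt f x ≤ C) : ‖f‖ ≤ C := by
  rw [ae_lines] at h
  exact norm_prod_le_iff.2 ⟨norm_Lp_le hC h.1, norm_Lp_le hC h.2⟩

lemma aestronglyMeasurable_eval (f : P.BdryFun) : AEStronglyMeasurable (eval f) lines := by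
  rw [aestronglyMeasurable_lines]
  exact ⟨P.emb₀.continuous.comp_aestronglyMeasurable (Lp.aestronglyMeasurable f.1),
    P.emb₁.continuous.comp_aestronglyMeasurable (Lp.aestronglyMeasurable f.2)⟩

lemma ae_norm_eval_le (f : P.BdryFun) : ∀ᵐ x ∂lines, ‖eval f x‖ ≤ P.embNorm * ‖f‖ := by
  filter_upwards [ae_normAt_le f] with x hx
  exact (norm_eval_le f x).trans (mul_le_mul_of_nonneg_left hx P.embNorm_nonneg)

lemma integrable_eval (θ : Ioo (0 : ℝ) 1) (f : P.BdryFun) :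
    Integrable (eval f) (harmonicMeasure θ) :=
  Integrable.of_bound ((aestronglyMeasurable_eval f).mono_ac
    (harmonicMeasure_absolutelyContinuous θ)) _
    ((harmonicMeasure_absolutelyContinuous θ).ae_le (ae_norm_eval_le f))

lemma aestronglyMeasurable_normAt (f : P.BdryFun) : AEStronglyMeasurable (normAt f) lines := by
  rw [aestronglyMeasurable_lines]
  exact ⟨(Lp.aestronglyMeasurable f.1).norm, (Lp.aestronglyMeasurable f.2).norm⟩

/-- Pairing of boundary functions with the continuous functions on the circle, with respect to
harmonic measure at `θ`. -/
def pair (θ : Ioo (0 : ℝ) 1) (f : P.BdryFun) : C(Circle, ℂ) →L[ℂ] E :=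
  pairing θ (integrable_eval θ f)

lemma eval_add (f g : P.BdryFun) : eval (f + g) =ᵐ[lines] eval f + eval g := by
  refine ae_lines.2 ⟨?_, ?_⟩
  · filter_upwards [Lp.coeFn_add f.1 g.1] with t ht
    exact (congrArg P.emb₀ ht).trans (map_add _ _ _)
  · filter_upwards [Lp.coeFn_add f.2 g.2] with t ht
    exact (congrArg P.emb₁ ht).trans (map_add _ _ _)

lemma eval_smul (c : ℂ) (f : P.BdryFun) : eval (c • f) =ᵐ[lines] c • eval f := by
  refine ae_lines.2 ⟨?_, ?_⟩
  · filter_upwards [Lp.coeFn_smul c f.1] with t ht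
    simp [eval, ht]
  · filter_upwards [Lp.coeFn_smul c f.2] with t ht
    simp [eval, ht]

lemma pair_congr {θ : Ioo (0 : ℝ) 1} {f : P.BdryFun} {m : C(Circle, ℂ)} {v : ℝ ⊕ ℝ → E}
    (h : ∀ᵐ x ∂lines, m (bdryPt θ x) • eval f x = v x) :
    pair θ f m = ∫ x, v x ∂harmonicMeasure θ :=
  integral_congr_ae ((harmonicMeasure_absolutelyContinuous θ).ae_le h)

lemma pair_add (θ : Ioo (0 : ℝ) 1) (f g : P.BdryFun) : pair θ (f + g) = pair θ f + pair θ g := by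
  ext m
  rw [_root_.add_apply]
  refine (pair_congr ?_).trans (integral_add (integrable_smul_bdry (integrable_eval θ f) m)
    (integrable_smul_bdry (integrable_eval θ g) m))
  filter_upwards [eval_add f g] with x hx
  rw [hx, Pi.add_apply, smul_add]

lemma pair_smul (θ : Ioo (0 : ℝ) 1) (c : ℂ) (f : P.BdryFun) :
    pair θ (c • f) = c • pair θ f := by
  ext m
  rw [_root_.smul_apply]
  refine (pair_congr ?_).trans (integral_smul c _)
  filter_upwards [eval_smul c f] with x hx
  rw [hx, Pi.smul_apply, smul_comm]

lemma norm_pair_le (θ : Ioo (0 : ℝ) 1) (f : P.BdryFun) (m : C(Circle, ℂ)) :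
    ‖pair θ f m‖ ≤ P.embNorm * ‖f‖ * ∫ x, ‖m (bdryPt θ x)‖ ∂harmonicMeasure θ :=
  norm_pairing_le _ ((harmonicMeasure_absolutelyContinuous θ).ae_le (ae_norm_eval_le f)) m

lemma norm_pair_le' (θ : Ioo (0 : ℝ) 1) (f : P.BdryFun) (m : C(Circle, ℂ)) :
    ‖pair θ f m‖ ≤ P.embNorm * ‖f‖ * ‖m‖ := by
  refine (norm_pair_le θ f m).trans (mul_le_mul_of_nonneg_left ?_
    (mul_nonneg P.embNorm_nonneg (norm_nonneg _)))
  have := norm_integral_le_of_norm_le_const (μ := harmonicMeasure θ) (C := ‖m‖)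
    (f := fun x => ‖m (bdryPt θ x)‖) (Eventually.of_forall fun x => by
      simpa using m.norm_coe_le_norm _)
  simp only [probReal_univ, mul_one] at this
  exact (Real.le_norm_self _).trans this

variable (P) in
/-- `pair`, as a continuous linear map of the boundary function. -/
def pairL (θ : Ioo (0 : ℝ) 1) (m : C(Circle, ℂ)) : P.BdryFun →L[ℂ] E :=
  LinearMap.mkContinuous
    { toFun := fun f => pair θ f m
      map_add' := fun f g => by rw [pair_add]; rfl
      map_smul' := fun c f => by rw [pair_smul]; rfl }
    (P.embNorm * ‖m‖) fun f => (norm_pair_le' θ f m).trans (le_of_eq (by ring))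

@[simp] lemma pairL_apply (θ : Ioo (0 : ℝ) 1) (m : C(Circle, ℂ)) (f : P.BdryFun) :
    P.pairL θ m f = pair θ f m := rfl

lemma pair_sub (θ : Ioo (0 : ℝ) 1) (f g : P.BdryFun) (m : C(Circle, ℂ)) :
    pair θ (f - g) m = pair θ f m - pair θ g m := map_sub (P.pairL θ m) f g

/-- The boundary values of a function in `𝓕^∞`. -/
def HInftyFun.data (F : P.HInftyFun) : P.BdryFun := (F.bd₀, F.bd₁)

lemma HInftyFun.norm_data (F : P.HInftyFun) : ‖F.data‖ = F.norm := rfl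

lemma integrable_poisson_smul {z : ℂ} (hz : z ∈ openStrip) (f : P.BdryFun) :
    Integrable (fun x => (poisson z x : ℂ) • eval f x) lines := by
  -- Only integrability is at stake, so any base point will do.
  let θ : Ioo (0 : ℝ) 1 := ⟨1 / 2, by norm_num, by norm_num⟩
  have h1 := (integrable_harmonicMeasure θ).1
    (integrable_smul_bdry (integrable_eval θ f) (discPoisson (toDisc θ z)))
  refine h1.congr (Eventually.of_forall fun x => ?_)
  simp only
  rw [discPoisson_apply (norm_toDisc_lt_one θ hz), poisson_eq_mul θ hz]
  push_cast
  rw [mul_smul, coe_smul]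

lemma pair_discPoisson (θ : Ioo (0 : ℝ) 1) {z : ℂ} (hz : z ∈ openStrip) (f : P.BdryFun) :
    pair θ f (discPoisson (toDisc θ z)) =
      (∫ t : ℝ, (stripPoisson₀ z t : ℂ) • P.emb₀ (f.1 t)) +
        ∫ t : ℝ, (stripPoisson₁ z t : ℂ) • P.emb₁ (f.2 t) := by
  have h := integral_lines (integrable_poisson_smul hz f)
  rw [pair, pairing_apply, integral_harmonicMeasure]
  refine Eq.trans (integral_congr_ae (Eventually.of_forall fun x => ?_)) h
  simp only
  rw [discPoisson_apply (norm_toDisc_lt_one θ hz), poisson_eq_mul θ hz]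
  push_cast
  rw [mul_smul, coe_smul]

lemma HInftyFun.toFun_eq (F : P.HInftyFun) (θ : Ioo (0 : ℝ) 1) {z : ℂ} (hz : z ∈ openStrip) :
    F.toFun z = pair θ F.data (discPoisson (toDisc θ z)) := by
  rw [pair_discPoisson θ hz]
  exact F.eq_poisson z hz

lemma HInftyFun.moments [CompleteSpace E] (F : P.HInftyFun) (θ : Ioo (0 : ℝ) 1) (k : ℕ)
    (hk : k ≠ 0) : pair θ F.data (chi ^ k) = 0 := by
  refine moments_eq_zero _ ?_ hk
  refine (F.analytic.comp (differentiableOn_ofDisc θ) fun ζ hζ => ofDisc_mem θ hζ).congr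
    fun ζ hζ => ?_
  rw [Function.comp_apply, F.toFun_eq θ (ofDisc_mem θ hζ), toDisc_ofDisc θ hζ]

lemma discPoisson_zero : discPoisson 0 = 1 := by
  simp [discPoisson]

lemma HInftyFun.toFun_center (F : P.HInftyFun) (θ : Ioo (0 : ℝ) 1) :
    F.toFun (θ : ℝ) = pair θ F.data 1 := by
  rw [F.toFun_eq θ (mem_openStrip θ), toDisc_self, discPoisson_zero]

lemma norm_star_chi : ‖star chi‖ = 1 := by rw [norm_star, norm_chi]

/-- In the disc coordinate ζ the function is ζ ↦ L((1 - ζχ̄)⁻¹), L being the pairing with the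
boundary values; its linear coefficient is L(χ̄), and the chain rule supplies the derivative of
`toDisc`. -/
lemma HInftyFun.hasDerivAt_center [CompleteSpace E] (F : P.HInftyFun) (θ : Ioo (0 : ℝ) 1) :
    HasDerivAt F.toFun (deriv (toDisc θ) (θ : ℝ) • pair θ F.data (star chi)) (θ : ℝ) := by
  have h1 := hasDerivAt_inverse (pair θ F.data) norm_star_chi
  rw [← toDisc_self θ] at h1
  have h2 := h1.scomp _
    (differentiableAt_toDisc θ (openStrip_subset (mem_openStrip θ))).hasDerivAt
  refine h2.congr_of_eventuallyEq ?_
  filter_upwards [isOpen_openStrip.mem_nhds (mem_openStrip θ)] with z hz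
  rw [F.toFun_eq θ hz, pairing_discPoisson (F.moments θ) (norm_toDisc_lt_one θ hz)]
  rfl

/-- Boundary functions with vanishing positive moments are boundary values of analytic
functions. -/
def HInftyFun.ofData [CompleteSpace E] (θ : Ioo (0 : ℝ) 1) (f : P.BdryFun)
    (hf : ∀ k : ℕ, k ≠ 0 → pair θ f (chi ^ k) = 0) : P.HInftyFun where
  toFun z := pair θ f (discPoisson (toDisc θ z))
  analytic := by
    refine ((differentiableOn_inverse (pair θ f) norm_star_chi).comp (f := toDisc θ)
      (fun z hz => (differentiableAt_toDisc θ
        (openStrip_subset hz)).differentiableWithinAt) fun z hz => ?_).congr fun z hz => ?_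
    · simpa using norm_toDisc_lt_one θ hz
    · exact pairing_discPoisson hf (norm_toDisc_lt_one θ hz)
  bd₀ := f.1
  bd₁ := f.2
  eq_poisson z hz := pair_discPoisson θ hz f

@[simp] lemma HInftyFun.data_ofData [CompleteSpace E] (θ : Ioo (0 : ℝ) 1) (f : P.BdryFun)
    (hf : ∀ k : ℕ, k ≠ 0 → pair θ f (chi ^ k) = 0) :
    (HInftyFun.ofData θ f hf).data = f := rfl

/-- Boundary values of analytic functions. -/
def IsAnalyticData (f : P.BdryFun) : Prop := ∃ F : P.HInftyFun, F.data = f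

/-- This reduces the construction of functions in 𝓕^∞ to moment conditions. The left side does not
involve θ, so the conditions may be checked at any convenient base point. -/
lemma isAnalyticData_iff [CompleteSpace E] (θ : Ioo (0 : ℝ) 1) {f : P.BdryFun} :
    IsAnalyticData f ↔ ∀ k : ℕ, k ≠ 0 → pair θ f (chi ^ k) = 0 :=
  ⟨fun ⟨F, hF⟩ k hk => hF ▸ F.moments θ k hk, fun h => ⟨HInftyFun.ofData θ f h, rfl⟩⟩

/-- Build boundary functions from functions on the two lines. -/
def BdryFun.mk' {f₀ : ℝ → P.X₀} {f₁ : ℝ → P.X₁} (h₀ : MemLp f₀ ∞ volume)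
    (h₁ : MemLp f₁ ∞ volume) : P.BdryFun := (h₀.toLp f₀, h₁.toLp f₁)

lemma eval_mk' {f₀ : ℝ → P.X₀} {f₁ : ℝ → P.X₁} (h₀ : MemLp f₀ ∞ volume)
    (h₁ : MemLp f₁ ∞ volume) : eval (BdryFun.mk' h₀ h₁) =ᵐ[lines]
      Sum.elim (fun t => P.emb₀ (f₀ t)) (fun t => P.emb₁ (f₁ t)) := by
  refine ae_lines.2 ⟨?_, ?_⟩
  · filter_upwards [h₀.coeFn_toLp] with t ht
    simp [eval, BdryFun.mk', ht]
  · filter_upwards [h₁.coeFn_toLp] with t ht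
    simp [eval, BdryFun.mk', ht]

lemma normAt_mk' {f₀ : ℝ → P.X₀} {f₁ : ℝ → P.X₁} (h₀ : MemLp f₀ ∞ volume)
    (h₁ : MemLp f₁ ∞ volume) : normAt (BdryFun.mk' h₀ h₁) =ᵐ[lines]
      Sum.elim (fun t => ‖f₀ t‖) (fun t => ‖f₁ t‖) := by
  refine ae_lines.2 ⟨?_, ?_⟩
  · filter_upwards [h₀.coeFn_toLp] with t ht
    simp [normAt, BdryFun.mk', ht]
  · filter_upwards [h₁.coeFn_toLp] with t ht
    simp [normAt, BdryFun.mk', ht]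

lemma memLp_bdryPt_smul {X : Type*} [NormedAddCommGroup X] [NormedSpace ℂ X]
    {b : ℝ → Circle} (hb : Continuous b) (m : C(Circle, ℂ)) (f : Lp X ∞ (volume : Measure ℝ)) :
    MemLp (fun t => m (b t) • f t) ∞ volume :=
  (Lp.memLp f).smul (memLp_top_of_bound (m.continuous.comp hb).aestronglyMeasurable ‖m‖
    (Eventually.of_forall fun _ => m.norm_coe_le_norm _))

/-- Multiplication of boundary functions by a continuous function on the circle. -/
def mulBdry (θ : Ioo (0 : ℝ) 1) (m : C(Circle, ℂ)) (f : P.BdryFun) : P.BdryFun :=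
  BdryFun.mk' (memLp_bdryPt_smul ((continuous_bdryPt θ).comp continuous_inl) m f.1)
    (memLp_bdryPt_smul ((continuous_bdryPt θ).comp continuous_inr) m f.2)

lemma eval_mulBdry (θ : Ioo (0 : ℝ) 1) (m : C(Circle, ℂ)) (f : P.BdryFun) :
    ∀ᵐ x ∂lines, eval (mulBdry θ m f) x = m (bdryPt θ x) • eval f x := by
  filter_upwards [eval_mk' (memLp_bdryPt_smul ((continuous_bdryPt θ).comp continuous_inl) m f.1)
    (memLp_bdryPt_smul ((continuous_bdryPt θ).comp continuous_inr) m f.2)] with x hx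
  rw [mulBdry, hx]
  rcases x with t | t <;> simp [eval]

lemma normAt_mulBdry (θ : Ioo (0 : ℝ) 1) (m : C(Circle, ℂ)) (f : P.BdryFun) :
    ∀ᵐ x ∂lines, normAt (mulBdry θ m f) x = ‖m (bdryPt θ x)‖ * normAt f x := by
  filter_upwards [normAt_mk' (memLp_bdryPt_smul ((continuous_bdryPt θ).comp continuous_inl) m f.1)
    (memLp_bdryPt_smul ((continuous_bdryPt θ).comp continuous_inr) m f.2)] with x hx
  rw [mulBdry, hx]
  rcases x with t | t <;> simp [normAt, norm_smul]

lemma pair_mulBdry (θ : Ioo (0 : ℝ) 1) (m n : C(Circle, ℂ)) (f : P.BdryFun) :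
    pair θ (mulBdry θ m f) n = pair θ f (m * n) := by
  refine pair_congr ?_
  filter_upwards [eval_mulBdry θ m f] with x hx
  rw [hx, ContinuousMap.mul_apply, mul_comm, mul_smul]

lemma normAt_add_le (f g : P.BdryFun) :
    ∀ᵐ x ∂lines, normAt (f + g) x ≤ normAt f x + normAt g x := by
  refine ae_lines.2 ⟨?_, ?_⟩
  · filter_upwards [Lp.coeFn_add f.1 g.1] with t ht
    exact (congrArg norm ht).trans_le (norm_add_le _ _)
  · filter_upwards [Lp.coeFn_add f.2 g.2] with t ht
    exact (congrArg norm ht).trans_le (norm_add_le _ _)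

lemma normAt_smul (c : ℂ) (f : P.BdryFun) :
    ∀ᵐ x ∂lines, normAt (c • f) x = ‖c‖ * normAt f x := by
  refine ae_lines.2 ⟨?_, ?_⟩
  · filter_upwards [Lp.coeFn_smul c f.1] with t ht
    simp [normAt, ht, norm_smul]
  · filter_upwards [Lp.coeFn_smul c f.2] with t ht
    simp [normAt, ht, norm_smul]

/-- Translation of boundary functions along the lines. -/
def translate (s : ℝ) (f : P.BdryFun) : P.BdryFun :=
  (Lp.compMeasurePreserving (· + s) (measurePreserving_add_right volume s) f.1,
    Lp.compMeasurePreserving (· + s) (measurePreserving_add_right volume s) f.2)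

lemma norm_translate (s : ℝ) (f : P.BdryFun) : ‖translate s f‖ = ‖f‖ := by
  simp [translate, Prod.norm_def, Lp.norm_compMeasurePreserving]

/-- Translation of the two lines. -/
def shift (s : ℝ) : ℝ ⊕ ℝ → ℝ ⊕ ℝ := Sum.map (· + s) (· + s)

lemma eval_translate (s : ℝ) (f : P.BdryFun) :
    ∀ᵐ x ∂lines, eval (translate s f) x = eval f (shift s x) := by
  refine ae_lines.2 ⟨?_, ?_⟩
  · filter_upwards [Lp.coeFn_compMeasurePreserving f.1
      (measurePreserving_add_right volume s)] with t ht
    exact congrArg P.emb₀ ht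
  · filter_upwards [Lp.coeFn_compMeasurePreserving f.2
      (measurePreserving_add_right volume s)] with t ht
    exact congrArg P.emb₁ ht

lemma add_mul_I_mem {z : ℂ} (hz : z ∈ openStrip) (s : ℝ) : z + s * I ∈ openStrip := by
  simpa [openStrip] using hz

/-- Vertical translation of a function in `𝓕^∞`. -/
def HInftyFun.shift (F : P.HInftyFun) (s : ℝ) : P.HInftyFun where
  toFun z := F.toFun (z + s * I)
  analytic := F.analytic.comp (by fun_prop) fun z hz => add_mul_I_mem hz s
  bd₀ := (translate s F.data).1
  bd₁ := (translate s F.data).2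
  eq_poisson z hz := by
    rw [F.eq_poisson _ (add_mul_I_mem hz s)]
    congr 1
    · rw [← integral_add_right_eq_self _ s]
      refine integral_congr_ae ?_
      filter_upwards [(ae_lines.1 (eval_translate s F.data)).1] with t ht
      simp only [eval, InterpolationPair.shift, Sum.elim_inl, Sum.map_inl] at ht
      rw [ht]
      simp [stripPoisson₀, HInftyFun.data]
    · rw [← integral_add_right_eq_self _ s]
      refine integral_congr_ae ?_
      filter_upwards [(ae_lines.1 (eval_translate s F.data)).2] with t ht
      simp only [eval, InterpolationPair.shift, Sum.elim_inr, Sum.map_inr] at ht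
      rw [ht]
      simp [stripPoisson₁, HInftyFun.data]

lemma HInftyFun.data_shift (F : P.HInftyFun) (s : ℝ) :
    (F.shift s).data = translate s F.data := rfl

lemma HInftyFun.norm_shift (F : P.HInftyFun) (s : ℝ) : (F.shift s).norm = F.norm := by
  rw [← HInftyFun.norm_data, HInftyFun.data_shift, norm_translate, HInftyFun.norm_data]

end InterpolationPair

/-! ### The Calderón space and the interpolation norms. -/

namespace InterpolationPair

open Complex Filter Topology ComplexConjugate Strip

variable {E : Type u} [NormedAddCommGroup E] [NormedSpace ℂ E] {P : InterpolationPair E}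

lemma mul_I_mem_closedStrip (t : ℝ) : (t * I : ℂ) ∈ closedStrip := by simp [closedStrip]

lemma one_add_mul_I_mem_closedStrip (t : ℝ) : (1 + t * I : ℂ) ∈ closedStrip := by
  simp [closedStrip]

lemma closure_openStrip : closure openStrip = closedStrip := by
  have h1 : openStrip = re ⁻¹' Ioo 0 1 := rfl
  have h2 : closedStrip = re ⁻¹' Icc 0 1 := rfl
  rw [h1, closure_preimage_re, closure_Ioo zero_ne_one, h2]

namespace CalderonFun

lemma norm_nonneg (F : P.CalderonFun) : 0 ≤ F.norm := (_root_.norm_nonneg F.bd₀).trans (le_max_left _ _)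

lemma norm_bd₀_le (F : P.CalderonFun) (t : ℝ) : ‖F.bd₀ t‖ ≤ F.norm :=
  (F.bd₀.norm_coe_le_norm t).trans (le_max_left _ _)

lemma norm_bd₁_le (F : P.CalderonFun) (t : ℝ) : ‖F.bd₁ t‖ ≤ F.norm :=
  (F.bd₁.norm_coe_le_norm t).trans (le_max_right _ _)

lemma norm_le {F : P.CalderonFun} {C : ℝ} (hC : 0 ≤ C) (h₀ : ∀ t, ‖F.bd₀ t‖ ≤ C)
    (h₁ : ∀ t, ‖F.bd₁ t‖ ≤ C) : F.norm ≤ C :=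
  max_le ((BoundedContinuousFunction.norm_le hC).2 h₀) ((BoundedContinuousFunction.norm_le hC).2 h₁)

/-- The maximum principle in the closed strip. -/
lemma norm_toFun_le (F : P.CalderonFun) {z : ℂ} (hz : z ∈ closedStrip) :
    ‖F.toFun z‖ ≤ P.embNorm * F.norm := by
  obtain ⟨C, hC⟩ := F.bounded
  refine PhragmenLindelof.vertical_strip (a := 0) (b := 1) (f := F.toFun) ⟨F.analytic, ?_⟩
    ⟨0, by simpa using Real.pi_pos, 0, ?_⟩ ?_ ?_ hz.1 hz.2
  · have : closure (re ⁻¹' Ioo 0 1) = closedStrip := closure_openStrip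
    rw [this]
    exact F.continuousOn
  · refine Asymptotics.IsBigO.of_bound C ?_
    refine eventually_inf_principal.2 (Eventually.of_forall fun w hw => ?_)
    simpa using hC w (openStrip_subset hw)
  · intro w hw
    have : w = w.im * I := by apply Complex.ext <;> simp [hw]
    rw [this, F.eq_bd₀]
    exact (norm_emb₀_le _).trans (mul_le_mul_of_nonneg_left (F.norm_bd₀_le _) P.embNorm_nonneg)
  · intro w hw
    have : w = 1 + w.im * I := by apply Complex.ext <;> simp [hw]
    rw [this, F.eq_bd₁]
    exact (norm_emb₁_le _).trans (mul_le_mul_of_nonneg_left (F.norm_bd₁_le _) P.embNorm_nonneg)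

/-- The product with a bounded analytic scalar function. -/
def mulScalar (F : P.CalderonFun) (h : ℂ → ℂ) (hc : ContinuousOn h closedStrip)
    (hd : DifferentiableOn ℂ h openStrip) (hb : ∃ C : ℝ, ∀ z ∈ closedStrip, ‖h z‖ ≤ C) :
    P.CalderonFun where
  toFun z := h z • F.toFun z
  continuousOn := hc.smul F.continuousOn
  bounded := by
    obtain ⟨C, hC⟩ := hb
    obtain ⟨D, hD⟩ := F.bounded
    refine ⟨C * D, fun z hz => ?_⟩
    rw [norm_smul]
    exact mul_le_mul (hC z hz) (hD z hz) (_root_.norm_nonneg _)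
      ((_root_.norm_nonneg _).trans (hC z hz))
  analytic := hd.smul F.analytic
  bd₀ := BoundedContinuousFunction.ofNormedAddCommGroup (fun t : ℝ => h (t * I) • F.bd₀ t)
    ((hc.comp_continuous (by fun_prop) mul_I_mem_closedStrip).smul F.bd₀.continuous)
    (hb.choose * F.norm) fun t => by
      rw [norm_smul]
      have h1 := hb.choose_spec _ (mul_I_mem_closedStrip t)
      exact mul_le_mul h1 (F.norm_bd₀_le t) (_root_.norm_nonneg _)
        ((_root_.norm_nonneg _).trans h1)
  bd₁ := BoundedContinuousFunction.ofNormedAddCommGroup (fun t : ℝ => h (1 + t * I) • F.bd₁ t)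
    ((hc.comp_continuous (by fun_prop) one_add_mul_I_mem_closedStrip).smul F.bd₁.continuous)
    (hb.choose * F.norm) fun t => by
      rw [norm_smul]
      have h1 := hb.choose_spec _ (one_add_mul_I_mem_closedStrip t)
      exact mul_le_mul h1 (F.norm_bd₁_le t) (_root_.norm_nonneg _)
        ((_root_.norm_nonneg _).trans h1)
  eq_bd₀ t := by simp [F.eq_bd₀]
  eq_bd₁ t := by simp [F.eq_bd₁]

section mulScalar

variable (F : P.CalderonFun) {h : ℂ → ℂ} (hc : ContinuousOn h closedStrip)
    (hd : DifferentiableOn ℂ h openStrip) (hb : ∃ C : ℝ, ∀ z ∈ closedStrip, ‖h z‖ ≤ C)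

@[simp] lemma mulScalar_toFun (z : ℂ) : (F.mulScalar h hc hd hb).toFun z = h z • F.toFun z := rfl

@[simp] lemma mulScalar_bd₀ (t : ℝ) :
    (F.mulScalar h hc hd hb).bd₀ t = h (t * I) • F.bd₀ t := rfl

@[simp] lemma mulScalar_bd₁ (t : ℝ) :
    (F.mulScalar h hc hd hb).bd₁ t = h (1 + t * I) • F.bd₁ t := rfl

end mulScalar

/-- Difference in the Calderón space. -/
def sub (F G : P.CalderonFun) : P.CalderonFun where
  toFun z := F.toFun z - G.toFun z
  continuousOn := F.continuousOn.sub G.continuousOn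
  bounded := by
    obtain ⟨C, hC⟩ := F.bounded
    obtain ⟨D, hD⟩ := G.bounded
    exact ⟨C + D, fun z hz => (norm_sub_le _ _).trans (add_le_add (hC z hz) (hD z hz))⟩
  analytic := F.analytic.sub G.analytic
  bd₀ := F.bd₀ - G.bd₀
  bd₁ := F.bd₁ - G.bd₁
  eq_bd₀ t := by simp [F.eq_bd₀, G.eq_bd₀]
  eq_bd₁ t := by simp [F.eq_bd₁, G.eq_bd₁]

/-- The constant function with a value in the intersection. -/
def const (a : P.X₀) (b : P.X₁) (h : P.emb₀ a = P.emb₁ b) : P.CalderonFun where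
  toFun _ := P.emb₀ a
  continuousOn := continuousOn_const
  bounded := ⟨_, fun _ _ => le_rfl⟩
  analytic := differentiableOn_const _
  bd₀ := BoundedContinuousFunction.const ℝ a
  bd₁ := BoundedContinuousFunction.const ℝ b
  eq_bd₀ _ := rfl
  eq_bd₁ _ := h

lemma norm_const_le (a : P.X₀) (b : P.X₁) (h : P.emb₀ a = P.emb₁ b) :
    (const a b h).norm ≤ max ‖a‖ ‖b‖ :=
  norm_le (le_max_of_le_left (_root_.norm_nonneg _)) (fun _ => le_max_left _ _)
    (fun _ => le_max_right _ _)

/-- Absolutely convergent series in the Calderón space. -/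
def series [CompleteSpace E] {ι : Type*} (F : ι → P.CalderonFun)
    (hF : Summable fun i => (F i).norm) : P.CalderonFun :=
  have hs₀ : Summable fun i => (F i).bd₀ :=
    Summable.of_norm_bounded hF fun i => le_max_left _ _
  have hs₁ : Summable fun i => (F i).bd₁ :=
    Summable.of_norm_bounded hF fun i => le_max_right _ _
  { toFun := fun z => ∑' i, (F i).toFun z
    continuousOn := continuousOn_tsum (fun i => (F i).continuousOn) (hF.mul_left P.embNorm)
      fun i z hz => (F i).norm_toFun_le hz
    bounded := ⟨∑' i, P.embNorm * (F i).norm, fun z hz =>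
      tsum_of_norm_bounded (hF.mul_left P.embNorm).hasSum fun i => (F i).norm_toFun_le hz⟩
    analytic := differentiableOn_tsum_of_summable_norm (hF.mul_left P.embNorm)
      (fun i => (F i).analytic) isOpen_openStrip
      fun i z hz => (F i).norm_toFun_le (openStrip_subset hz)
    bd₀ := ∑' i, (F i).bd₀
    bd₁ := ∑' i, (F i).bd₁
    eq_bd₀ := fun t => by
      have h := (hs₀.hasSum.mapL (BoundedContinuousFunction.evalCLM ℂ t)).mapL P.emb₀
      simpa [(F _).eq_bd₀] using h.tsum_eq
    eq_bd₁ := fun t => by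
      have h := (hs₁.hasSum.mapL (BoundedContinuousFunction.evalCLM ℂ t)).mapL P.emb₁
      simpa [(F _).eq_bd₁] using h.tsum_eq }

lemma norm_series_le [CompleteSpace E] {ι : Type*} (F : ι → P.CalderonFun)
    (hF : Summable fun i => (F i).norm) : (series F hF).norm ≤ ∑' i, (F i).norm :=
  max_le (tsum_of_norm_bounded hF.hasSum fun _ => le_max_left _ _)
    (tsum_of_norm_bounded hF.hasSum fun _ => le_max_right _ _)

end CalderonFun

lemma interpNorm_le (F : P.CalderonFun) (t : ℝ) :
    P.interpNorm t (F.toFun t) ≤ ENNReal.ofReal F.norm :=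
  iInf₂_le (f := fun (G : P.CalderonFun) (_ : G.toFun t = F.toFun t) => ENNReal.ofReal G.norm) F rfl

lemma exists_calderonFun_of_lt {t : ℝ} {x : E} {c : ℝ≥0∞} (h : P.interpNorm t x < c) :
    ∃ F : P.CalderonFun, F.toFun t = x ∧ ENNReal.ofReal F.norm < c := by
  obtain ⟨F, hF⟩ := iInf_lt_iff.1 h
  obtain ⟨hF, hF'⟩ := iInf_lt_iff.1 hF
  exact ⟨F, hF, hF'⟩

lemma interpNorm_smul_le (t : ℝ) (c : ℂ) (x : E) :
    P.interpNorm t (c • x) ≤ ENNReal.ofReal ‖c‖ * P.interpNorm t x := by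
  rcases eq_or_ne c 0 with rfl | hc
  -- The case c = 0 is apart: the norm of x may be infinite, with 0 · ∞ = 0, and moving the factor
  -- into the infimum needs c ≠ 0.
  · let F := CalderonFun.const (0 : P.X₀) (0 : P.X₁) (by simp)
    have h : F.norm ≤ 0 := by simpa using CalderonFun.norm_const_le (0 : P.X₀) (0 : P.X₁) (by simp)
    have : P.interpNorm t 0 ≤ ENNReal.ofReal F.norm := by
      have := P.interpNorm_le F t
      simpa [F, CalderonFun.const] using this
    simpa [ENNReal.ofReal_of_nonpos h] using this
  · rw [interpNorm, interpNorm, ENNReal.mul_iInf_of_ne (by simpa using hc) ENNReal.ofReal_ne_top]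
    refine le_iInf fun F => ?_
    rw [ENNReal.mul_iInf_of_ne (by simpa using hc) ENNReal.ofReal_ne_top]
    refine le_iInf fun hF => ?_
    let G := F.mulScalar (fun _ => c) continuousOn_const (differentiableOn_const _)
      ⟨‖c‖, fun _ _ => le_rfl⟩
    have hG : G.norm ≤ ‖c‖ * F.norm := by
      refine CalderonFun.norm_le (mul_nonneg (norm_nonneg _) F.norm_nonneg) (fun s => ?_)
        fun s => ?_
      · simpa [G, norm_smul] using mul_le_mul_of_nonneg_left (F.norm_bd₀_le s) (norm_nonneg c)
      · simpa [G, norm_smul] using mul_le_mul_of_nonneg_left (F.norm_bd₁_le s) (norm_nonneg c)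
    refine (iInf₂_le G (by simp [G, hF])).trans ?_
    rw [← ENNReal.ofReal_mul (norm_nonneg _)]
    exact ENNReal.ofReal_le_ofReal hG

lemma interpNorm_zero (t : ℝ) : P.interpNorm t 0 = 0 := by
  have := P.interpNorm_smul_le t 0 0
  simpa using this

lemma interpNorm_neg (t : ℝ) (x : E) : P.interpNorm t (-x) = P.interpNorm t x := by
  have h : ∀ y : E, P.interpNorm t (-y) ≤ P.interpNorm t y := fun y => by
    have := P.interpNorm_smul_le t (-1) y
    simpa using this
  refine le_antisymm (h x) ?_
  simpa using h (-x)

/-- Nearly optimal functions for the terms, with errors of total less than ε, are summed in the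
Calderón space. The series need only converge in `E`; this replaces the completeness of X_t in later
telescoping arguments. -/
lemma interpNorm_tsum_le [CompleteSpace E] {ι : Type*} [Countable ι] {t : ℝ} {x : ι → E} {y : E} (hy : HasSum x y) :
    P.interpNorm t y ≤ ∑' i, P.interpNorm t (x i) := by
  by_cases htop : ∑' i, P.interpNorm t (x i) = ∞
  · rw [htop]; exact le_top
  refine ENNReal.le_of_forall_pos_le_add fun ε hε _ => ?_
  obtain ⟨δ, hδ, hδε⟩ := ENNReal.exists_pos_sum_of_countable (ε := ε) (by simpa using hε.ne') ι
  have hx : ∀ i, P.interpNorm t (x i) < P.interpNorm t (x i) + δ i := fun i =>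
    ENNReal.lt_add_right (ENNReal.ne_top_of_tsum_ne_top htop i) (by simpa using (hδ i).ne')
  choose F hF hF' using fun i => P.exists_calderonFun_of_lt (hx i)
  have hle : ∑' i, ENNReal.ofReal (F i).norm ≤ ∑' i, P.interpNorm t (x i) + ε :=
    (ENNReal.tsum_le_tsum fun i => (hF' i).le).trans
      (ENNReal.tsum_add.trans_le (add_le_add le_rfl hδε.le))
  have hsum : Summable fun i => (F i).norm := by
    have := ENNReal.summable_toReal (f := fun i => ENNReal.ofReal (F i).norm)
      (ne_top_of_le_ne_top (ENNReal.add_ne_top.2 ⟨htop, ENNReal.coe_ne_top⟩) hle)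
    simpa [ENNReal.toReal_ofReal (F _).norm_nonneg] using this
  have h1 : (CalderonFun.series F hsum).toFun t = y := by
    change ∑' i, (F i).toFun t = y
    simp only [hF]
    exact hy.tsum_eq
  rw [← h1]
  refine (P.interpNorm_le _ t).trans (le_trans ?_ hle)
  rw [← ENNReal.ofReal_tsum_of_nonneg (fun i => (F i).norm_nonneg) hsum]
  exact ENNReal.ofReal_le_ofReal (CalderonFun.norm_series_le F hsum)

lemma interpNorm_add_le [CompleteSpace E] (t : ℝ) (x y : E) :
    P.interpNorm t (x + y) ≤ P.interpNorm t x + P.interpNorm t y := by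
  have h : HasSum (fun b : Bool => cond b x y) (x + y) := by
    have := hasSum_fintype (fun b : Bool => cond b x y)
    simpa using this
  have h2 := P.interpNorm_tsum_le (t := t) h
  rw [tsum_fintype] at h2
  simpa using h2

lemma interpNorm_const_le (t : ℝ) (a : P.X₀) (b : P.X₁) (h : P.emb₀ a = P.emb₁ b) :
    P.interpNorm t (P.emb₀ a) ≤ ENNReal.ofReal (max ‖a‖ ‖b‖) :=
  (P.interpNorm_le (CalderonFun.const a b h) t).trans
    (ENNReal.ofReal_le_ofReal (CalderonFun.norm_const_le a b h))

end InterpolationPair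

/-! ### The Poisson kernel as an approximate identity. -/

namespace Strip

open Complex Filter Topology ComplexConjugate

lemma injective_bdryPt (θ : Ioo (0 : ℝ) 1) : Function.Injective (bdryPt θ) := by
  have hl : Function.Injective lineCoord := by
    rintro (s | s) (t | t) h
    · have := Real.exp_injective h
      have := mul_left_cancel₀ Real.pi_ne_zero (neg_injective this)
      rw [this]
    · have h1 : Real.exp (-(Real.pi * s)) = -Real.exp (-(Real.pi * t)) := h
      linarith [Real.exp_pos (-(Real.pi * s)), Real.exp_pos (-(Real.pi * t))]
    · have h1 : -Real.exp (-(Real.pi * s)) = Real.exp (-(Real.pi * t)) := h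
      linarith [Real.exp_pos (-(Real.pi * s)), Real.exp_pos (-(Real.pi * t))]
    · have h1 : -Real.exp (-(Real.pi * s)) = -Real.exp (-(Real.pi * t)) := h
      have := Real.exp_injective (neg_injective h1)
      have := mul_left_cancel₀ Real.pi_ne_zero (neg_injective this)
      rw [this]
  intro x y h
  apply hl
  have h1 : (bdryPt θ x : ℂ) = bdryPt θ y := by rw [h]
  rw [coe_bdryPt, coe_bdryPt, div_eq_div_iff (bdry_sub_ne_zero θ x) (bdry_sub_ne_zero θ y)] at h1
  have h2 : halfPlane (θ : ℝ) - conj (halfPlane (θ : ℝ)) ≠ 0 :=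
    sub_conj_ne_zero (center_im_pos θ).le (center_im_pos θ)
  have h3 : (halfPlane (θ : ℝ) - conj (halfPlane (θ : ℝ))) * ((lineCoord x : ℂ) - lineCoord y) = 0 := by
    linear_combination h1
  have := (mul_eq_zero.1 h3).resolve_left h2
  exact_mod_cast sub_eq_zero.1 this

lemma integrable_bdryPt {F : Type*} [NormedAddCommGroup F] (θ : Ioo (0 : ℝ) 1)
    [MeasurableSpace F] [BorelSpace F] [SecondCountableTopology F] (m : C(Circle, F)) :
    Integrable (fun x => m (bdryPt θ x)) (harmonicMeasure θ) :=
  Integrable.of_bound (measurable_sum_of_continuous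
    (m.continuous.comp (continuous_bdryPt θ))).aestronglyMeasurable ‖m‖
    (Eventually.of_forall fun _ => m.norm_coe_le_norm _)

lemma discPoisson_apply_nonneg {w : ℂ} (hw : ‖w‖ < 1) (b : Circle) :
    0 ≤ (1 - normSq w) / normSq ((b : ℂ) - w) := by
  refine div_nonneg ?_ (normSq_nonneg _)
  rw [normSq_eq_norm_sq]
  nlinarith [norm_nonneg w]

lemma norm_discPoisson_apply {w : ℂ} (hw : ‖w‖ < 1) (b : Circle) :
    ‖discPoisson w b‖ = (1 - normSq w) / normSq ((b : ℂ) - w) := by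
  rw [discPoisson_apply hw, norm_real, Real.norm_of_nonneg (discPoisson_apply_nonneg hw b)]

/-- Harmonic measure has no nonzero moments, so each resolvent integrates to its constant term and
the total is 1 + 1 - 1. -/
lemma integral_discPoisson (θ : Ioo (0 : ℝ) 1) {w : ℂ} (hw : ‖w‖ < 1) :
    ∫ x, discPoisson w (bdryPt θ x) ∂harmonicMeasure θ = 1 := by
  have h1 : Integrable (fun _ : ℝ ⊕ ℝ => (1 : ℂ)) (harmonicMeasure θ) := integrable_const _
  have hp : ∀ m : C(Circle, ℂ), pairing θ h1 m = ∫ x, m (bdryPt θ x) ∂harmonicMeasure θ :=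
    fun m => by simp [pairing_apply]
  have hL : ∀ k : ℕ, k ≠ 0 → pairing θ h1 (chi ^ k) = 0 := fun k hk => by
    rw [hp]; exact integral_bdryPt_pow θ hk
  have e1 : ∀ {ζ : ℂ}, ‖ζ‖ < 1 →
      ∫ x, (Ring.inverse (1 - ζ • chi)) (bdryPt θ x) ∂harmonicMeasure θ = 1 := fun hζ => by
    rw [← hp, pairing_inverse hL hζ, hp]; simp
  rw [← hp, discPoisson, map_sub, map_add, hp, hp, hp, e1 (by simpa using hw)]
  have e2 : ∫ x, (Ring.inverse (1 - w • star chi)) (bdryPt θ x) ∂harmonicMeasure θ = 1 := by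
    have h := congrArg conj (e1 (ζ := conj w) (by simpa using hw))
    rw [← integral_conj, map_one] at h
    rw [← h]
    congr with x
    have hw' : ‖conj w‖ < 1 := by simpa using hw
    rw [inverse_apply (isUnit_one_sub norm_chi.le hw'),
      inverse_apply (isUnit_one_sub (by rw [norm_star, norm_chi]) hw)]
    simp
  rw [e2]
  simp

lemma integral_norm_discPoisson (θ : Ioo (0 : ℝ) 1) {w : ℂ} (hw : ‖w‖ < 1) :
    ∫ x, ‖discPoisson w (bdryPt θ x)‖ ∂harmonicMeasure θ = 1 := by
  have h := integral_discPoisson θ hw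
  simp only [discPoisson_apply hw] at h
  simp only [norm_discPoisson_apply hw]
  exact_mod_cast h

/-- The Poisson kernel is an approximate identity. -/
lemma norm_pairing_discPoisson_sub_le {E : Type*} [NormedAddCommGroup E] [NormedSpace ℂ E]
    [CompleteSpace E] {θ : Ioo (0 : ℝ) 1} {u : ℝ ⊕ ℝ → E} (hu : Integrable u (harmonicMeasure θ))
    {b : ℂ} {c : E} {M ε δ : ℝ} (hδ : 0 < δ) (hM0 : 0 ≤ M) (hε0 : 0 ≤ ε)
    (hM : ∀ᵐ x ∂harmonicMeasure θ, ‖u x - c‖ ≤ M)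
    (hε : ∀ᵐ x ∂harmonicMeasure θ, ‖(bdryPt θ x : ℂ) - b‖ < δ → ‖u x - c‖ ≤ ε)
    {w : ℂ} (hw : ‖w‖ < 1) (hwb : ‖w - b‖ ≤ δ / 2) :
    ‖pairing θ hu (discPoisson w) - c‖ ≤ ε + M * ((1 - ‖w‖ ^ 2) * (4 / δ ^ 2)) := by
  have hint := integrable_bdryPt θ (discPoisson w)
  have e : pairing θ hu (discPoisson w) - c =
      ∫ x, discPoisson w (bdryPt θ x) • (u x - c) ∂harmonicMeasure θ := by
    simp only [smul_sub]
    rw [integral_sub (integrable_smul_bdry hu _) (hint.smul_const c), integral_smul_const,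
      integral_discPoisson θ hw, one_smul, pairing_apply]
  rw [e]
  have h1 : 0 ≤ 1 - ‖w‖ ^ 2 := by nlinarith [norm_nonneg w]
  have h2 : ε + M * ((1 - ‖w‖ ^ 2) * (4 / δ ^ 2)) =
      ∫ x, (‖discPoisson w (bdryPt θ x)‖ * ε + M * ((1 - ‖w‖ ^ 2) * (4 / δ ^ 2)))
        ∂harmonicMeasure θ := by
    rw [integral_add (hint.norm.mul_const _) (integrable_const _), integral_mul_const,
      integral_norm_discPoisson θ hw]
    simp
  rw [h2]
  refine norm_integral_le_of_norm_le ((hint.norm.mul_const _).add (integrable_const _)) ?_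
  filter_upwards [hM, hε] with x hx hx'
  rw [norm_smul]
  by_cases hb : ‖(bdryPt θ x : ℂ) - b‖ < δ
  · refine (mul_le_mul_of_nonneg_left (hx' hb) (norm_nonneg _)).trans ?_
    have : 0 ≤ M * ((1 - ‖w‖ ^ 2) * (4 / δ ^ 2)) := by positivity
    linarith
  -- Outside the arc of radius δ about b the point stays δ/2 away from w, so the kernel is at most
  -- (1 - |w|²)(2/δ)².
  · have h3 : δ / 2 ≤ ‖(bdryPt θ x : ℂ) - w‖ := by
      have := norm_sub_le_norm_sub_add_norm_sub (bdryPt θ x : ℂ) w b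
      linarith
    have h4 : ‖discPoisson w (bdryPt θ x)‖ ≤ (1 - ‖w‖ ^ 2) * (4 / δ ^ 2) := by
      rw [norm_discPoisson_apply hw, normSq_eq_norm_sq, normSq_eq_norm_sq, div_eq_mul_inv]
      refine mul_le_mul_of_nonneg_left ?_ h1
      rw [show 4 / δ ^ 2 = ((δ / 2) ^ 2)⁻¹ by field_simp; norm_num]
      gcongr
    have h5 := mul_le_mul h4 hx (norm_nonneg _) (by positivity)
    have : 0 ≤ ‖discPoisson w (bdryPt θ x)‖ * ε := by positivity
    linarith

end Strip

/-! ### The norm at θ is bounded by the harmonic mean of the boundary norms. -/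

namespace Strip

open Complex Filter Topology ComplexConjugate

/-- A function on the boundary of the strip that vanishes at infinity has continuous majorants
on the circle with almost the same integral. -/
lemma exists_majorant (θ : Ioo (0 : ℝ) 1) {n : ℝ ⊕ ℝ → ℝ} (hn : Continuous n)
    (hn0 : ∀ x, 0 ≤ n x) {C : ℝ} (hC : ∀ x, n x ≤ C)
    (h₀ : Tendsto (fun t => n (Sum.inl t)) (cocompact ℝ) (𝓝 0))
    (h₁ : Tendsto (fun t => n (Sum.inr t)) (cocompact ℝ) (𝓝 0)) {ε : ℝ} (hε : 0 < ε) :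
    ∃ Γ : C(Circle, ℝ), (∀ b, 0 ≤ Γ b) ∧ (∀ x, n x ≤ Γ (bdryPt θ x)) ∧
      ∫ x, Γ (bdryPt θ x) ∂harmonicMeasure θ ≤ ∫ x, n x ∂harmonicMeasure θ + ε := by
  -- The lines omit the two points of the circle that correspond to infinity, so only compact pieces
  -- embed as closed sets; Tietze's theorem extends from these.
  set K : ℕ → Set (ℝ ⊕ ℝ) := fun N =>
    Sum.inl '' Icc (-(N : ℝ)) N ∪ Sum.inr '' Icc (-(N : ℝ)) N with hK
  have hKc : ∀ N, IsCompact (K N) := fun N =>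
    (isCompact_Icc.image continuous_inl).union (isCompact_Icc.image continuous_inr)
  have hC0 : 0 ≤ C := (hn0 (Sum.inl 0)).trans (hC _)
  -- The floor ε/2 makes the extension dominate n off K N once n is small there, and raises the mean
  -- by at most ε/2.
  have hm : Continuous fun x => max (n x) (ε / 2) := hn.max continuous_const
  have hex : ∀ N, ∃ Γ : C(Circle, ℝ), (∀ b, Γ b ∈ Icc (ε / 2) (C + ε)) ∧
      ∀ x ∈ K N, Γ (bdryPt θ x) = max (n x) (ε / 2) := fun N => by
    have : CompactSpace (K N) := isCompact_iff_compactSpace.1 (hKc N)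
    have hemb : IsClosedEmbedding fun x : K N => bdryPt θ x :=
      ((continuous_bdryPt θ).comp continuous_subtype_val).isClosedEmbedding
        ((injective_bdryPt θ).comp Subtype.val_injective)
    obtain ⟨Γ, hΓ, hΓ'⟩ := ContinuousMap.exists_extension_forall_mem_of_isClosedEmbedding
      (⟨fun x : K N => max (n x) (ε / 2), hm.comp continuous_subtype_val⟩ : C(K N, ℝ))
      (t := Icc (ε / 2) (C + ε))
      (fun x => ⟨le_max_right _ _, max_le (by linarith [hC x]) (by linarith)⟩)
      ⟨ε / 2, le_rfl, by linarith⟩ hemb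
    exact ⟨Γ, hΓ, fun x hx => congrFun hΓ' ⟨x, hx⟩⟩
  choose Γ hΓ hΓ' using hex
  have hmem : ∀ x, ∀ᶠ N in atTop, x ∈ K N := fun x => by
    rcases x with t | t
    · filter_upwards [tendsto_natCast_atTop_atTop.eventually_ge_atTop |t|] with N hN
      exact Or.inl ⟨t, abs_le.1 hN, rfl⟩
    · filter_upwards [tendsto_natCast_atTop_atTop.eventually_ge_atTop |t|] with N hN
      exact Or.inr ⟨t, abs_le.1 hN, rfl⟩
  have hlim : Tendsto (fun N => ∫ x, Γ N (bdryPt θ x) ∂harmonicMeasure θ) atTop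
      (𝓝 (∫ x, max (n x) (ε / 2) ∂harmonicMeasure θ)) := by
    refine tendsto_integral_of_dominated_convergence (fun _ => C + ε)
      (fun N => (integrable_bdryPt θ (Γ N)).aestronglyMeasurable) (integrable_const _)
      (fun N => Eventually.of_forall fun x => ?_) (Eventually.of_forall fun x => ?_)
    · rw [Real.norm_of_nonneg (by linarith [(hΓ N (bdryPt θ x)).1])]
      exact (hΓ N _).2
    · refine tendsto_const_nhds.congr' ?_
      filter_upwards [hmem x] with N hN
      rw [hΓ' N x hN]
  have hnint : Integrable n (harmonicMeasure θ) :=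
    Integrable.of_bound (measurable_sum_of_continuous hn).aestronglyMeasurable C
      (Eventually.of_forall fun x => by rw [Real.norm_of_nonneg (hn0 x)]; exact hC x)
  have hle : ∫ x, max (n x) (ε / 2) ∂harmonicMeasure θ < ∫ x, n x ∂harmonicMeasure θ + ε := by
    have : ∫ x, max (n x) (ε / 2) ∂harmonicMeasure θ ≤
        ∫ x, (n x + ε / 2) ∂harmonicMeasure θ := by
      refine integral_mono_of_nonneg (Eventually.of_forall fun x => ?_)
        (hnint.add (integrable_const _)) (Eventually.of_forall fun x => ?_)
      · exact le_max_of_le_left (hn0 x)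
      · exact max_le (by linarith) (by linarith [hn0 x])
    rw [integral_add hnint (integrable_const _)] at this
    simp only [integral_const, probReal_univ, one_smul] at this
    linarith
  have hdecay : ∀ᶠ N in atTop, ∀ x, x ∉ K N → n x ≤ ε / 2 := by
    have h₀' := h₀.eventually (ge_mem_nhds (half_pos hε))
    have h₁' := h₁.eventually (ge_mem_nhds (half_pos hε))
    obtain ⟨S, hS, hS'⟩ := mem_cocompact.1 (h₀'.and h₁')
    obtain ⟨R, hR⟩ := hS.isBounded.exists_norm_le
    filter_upwards [tendsto_natCast_atTop_atTop.eventually_ge_atTop R] with N hN x hx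
    rcases x with t | t
    · exact (hS' (fun ht => hx (Or.inl ⟨t, abs_le.1 ((hR t ht).trans hN), rfl⟩))).1
    · exact (hS' (fun ht => hx (Or.inr ⟨t, abs_le.1 ((hR t ht).trans hN), rfl⟩))).2
  obtain ⟨N, hN, hN'⟩ := ((hlim.eventually (gt_mem_nhds hle)).and hdecay).exists
  refine ⟨Γ N, fun b => by linarith [(hΓ N b).1], fun x => ?_, hN.le⟩
  by_cases hx : x ∈ K N
  · rw [hΓ' N x hx]; exact le_max_left _ _
  · exact (hN' x hx).trans (hΓ N _).1

/-- A nonnegative function on the circle is almost dominated by the real part of an analytic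
function on a larger disc, with the same mean. -/
lemma exists_herglotz (θ : Ioo (0 : ℝ) 1) (Γ : C(Circle, ℝ)) (hΓ : ∀ b, 0 ≤ Γ b) {ε : ℝ}
    (hε : 0 < ε) : ∃ (R : ℝ) (H : ℂ → ℂ), 1 < R ∧ DifferentiableOn ℂ H (Metric.ball 0 R) ∧
      (∀ ζ ∈ Metric.closedBall (0 : ℂ) 1, 0 ≤ (H ζ).re) ∧
      (∀ b : Circle, Γ b - ε ≤ (H b).re) ∧
      H 0 = (∫ x, Γ (bdryPt θ x) ∂harmonicMeasure θ : ℝ) := by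
  have hint := integrable_bdryPt θ Γ
  have hu : Integrable (fun x => (Γ (bdryPt θ x) : ℂ)) (harmonicMeasure θ) := hint.ofReal
  set L := pairing θ hu with hL
  -- The Poisson kernel is the real part of the Schwarz kernel 2(1 - ζb̄)⁻¹ - 1, and Γ is real.
  have hpoi : ∀ {ζ : ℂ}, ‖ζ‖ < 1 → L (discPoisson ζ) =
      ((L ((2 : ℂ) • Ring.inverse (1 - ζ • star chi) - 1)).re : ℝ) := fun {ζ} hζ => by
    have e : ∀ m : C(Circle, ℂ), (L m).re =
        ∫ x, (m (bdryPt θ x)).re * Γ (bdryPt θ x) ∂harmonicMeasure θ := fun m => by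
      have := reCLM.integral_comp_comm (integrable_smul_bdry hu m)
      simp only [reCLM_apply] at this
      rw [hL, pairing_apply, ← this]
      simp
    rw [e, hL, pairing_apply, ← integral_complex_ofReal]
    congr with x
    have hζ' : ‖conj ζ‖ < 1 := by simpa using hζ
    have e2 : discPoisson ζ (bdryPt θ x) =
        ((((2 : ℂ) • Ring.inverse (1 - ζ • star chi) - 1 : C(Circle, ℂ)) (bdryPt θ x)).re : ℝ) := by
      simp only [discPoisson, ContinuousMap.sub_apply, ContinuousMap.add_apply,
        ContinuousMap.smul_apply, inverse_apply (isUnit_one_sub norm_chi.le hζ'),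
        inverse_apply (isUnit_one_sub (a := star chi) (by rw [norm_star, norm_chi]) hζ),
        ContinuousMap.one_apply, ContinuousMap.star_apply, chi_apply, smul_eq_mul, star_def]
      have e3 : (1 - conj ζ * (bdryPt θ x : ℂ))⁻¹ = conj ((1 - ζ * conj (bdryPt θ x : ℂ))⁻¹) := by
        simp
      rw [e3, add_conj]
      simp
    rw [e2]
    simp
  obtain ⟨δ, hδ, hδ'⟩ := Metric.uniformContinuous_iff.1
    (CompactSpace.uniformContinuous_of_continuous Γ.continuous) (ε / 2) (half_pos hε)
  have hr : ∃ r : ℝ, 0 < r ∧ r < 1 ∧ 1 - r ≤ δ / 2 ∧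
      2 * ‖Γ‖ * ((1 - r ^ 2) * (4 / δ ^ 2)) ≤ ε / 2 := by
    have h1 : ∀ᶠ r : ℝ in 𝓝[<] 1, 0 < r := nhdsWithin_le_nhds (lt_mem_nhds one_pos)
    have h2 : ∀ᶠ r : ℝ in 𝓝[<] 1, r < 1 := self_mem_nhdsWithin
    have h3 : ∀ᶠ r : ℝ in 𝓝[<] 1, 1 - r ≤ δ / 2 := by
      refine nhdsWithin_le_nhds ?_
      have : Tendsto (fun r : ℝ => 1 - r) (𝓝 1) (𝓝 (1 - 1)) :=
        (continuous_const.sub continuous_id).tendsto _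
      rw [sub_self] at this
      exact this.eventually (ge_mem_nhds (half_pos hδ))
    have h4 : ∀ᶠ r : ℝ in 𝓝[<] 1, 2 * ‖Γ‖ * ((1 - r ^ 2) * (4 / δ ^ 2)) ≤ ε / 2 := by
      refine nhdsWithin_le_nhds ?_
      have : Continuous fun r : ℝ => 2 * ‖Γ‖ * ((1 - r ^ 2) * (4 / δ ^ 2)) := by fun_prop
      have := this.tendsto 1
      simp only [one_pow, sub_self, zero_mul, mul_zero] at this
      exact this.eventually (ge_mem_nhds (half_pos hε))
    obtain ⟨r, h⟩ := (h1.and (h2.and (h3.and h4))).exists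
    exact ⟨r, h.1, h.2.1, h.2.2.1, h.2.2.2⟩
  obtain ⟨r, hr0, hr1, hr2, hr3⟩ := hr
  have hmaps : ∀ ζ ∈ Metric.ball (0 : ℂ) r⁻¹, (r : ℂ) * ζ ∈ Metric.ball (0 : ℂ) 1 := fun ζ hζ => by
    simp only [Metric.mem_ball, dist_zero_right, norm_mul, norm_real] at hζ ⊢
    rw [Real.norm_of_nonneg hr0.le]
    calc r * ‖ζ‖ < r * r⁻¹ := mul_lt_mul_of_pos_left hζ hr0
      _ = 1 := mul_inv_cancel₀ hr0.ne'
  have h1r : 1 < r⁻¹ := (one_lt_inv₀ hr0).2 hr1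
  -- The witness is the Schwarz integral of Γ dilated by r: it is analytic on the disc of radius
  -- 1/r, and r is so close to 1 that its real part on the circle is uniformly within ε of Γ.
  refine ⟨r⁻¹, fun ζ => L ((2 : ℂ) • Ring.inverse (1 - (r * ζ) • star chi) - 1), h1r, ?_, ?_, ?_,
    ?_⟩
  · have h := (((differentiableOn_inverse L (a := star chi) (by rw [norm_star, norm_chi])).comp
      (f := fun ζ : ℂ => (r : ℂ) * ζ) (by fun_prop) hmaps).const_smul (2 : ℂ)).sub_const (L 1)
    refine h.congr fun ζ _ => ?_
    simp
  · intro ζ hζ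
    have h := hpoi (ζ := r * ζ) (by simpa using hmaps ζ (by
      simp only [Metric.mem_ball, Metric.mem_closedBall, dist_zero_right] at hζ ⊢
      linarith))
    have h2 : 0 ≤ (L (discPoisson (r * ζ))).re := by
      have hζ1 : ‖r * ζ‖ < 1 := by simpa using hmaps ζ (by
        simp only [Metric.mem_ball, Metric.mem_closedBall, dist_zero_right] at hζ ⊢
        linarith)
      rw [hL, pairing_apply]
      have := reCLM.integral_comp_comm (integrable_smul_bdry hu (discPoisson (r * ζ)))
      simp only [reCLM_apply] at this
      rw [← this]
      refine integral_nonneg fun x => ?_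
      rw [discPoisson_apply hζ1]
      simp only [smul_eq_mul, ← ofReal_mul, ofReal_re]
      exact mul_nonneg (discPoisson_apply_nonneg hζ1 _) (hΓ _)
    rw [h] at h2
    simpa using h2
  · intro b
    have hb : ‖(r : ℂ) * b‖ < 1 := by
      rw [norm_mul, Circle.norm_coe, mul_one, norm_real, Real.norm_of_nonneg hr0.le]; exact hr1
    have hb' : ‖(r : ℂ) * b‖ = r := by
      rw [norm_mul, Circle.norm_coe, mul_one, norm_real, Real.norm_of_nonneg hr0.le]
    have key := norm_pairing_discPoisson_sub_le hu (b := b) (c := (Γ b : ℂ)) (M := 2 * ‖Γ‖)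
      (ε := ε / 2) hδ (by positivity) (by positivity) (Eventually.of_forall fun x => ?_)
      (Eventually.of_forall fun x hx => ?_) hb ?_
    · rw [hb'] at key
      have h := abs_le.1 ((abs_re_le_norm _).trans key)
      rw [← hL, hpoi hb] at h
      simp only [sub_re, ofReal_re] at h
      change Γ b - ε ≤ (L ((2 : ℂ) • Ring.inverse (1 - (r * (b : ℂ)) • star chi) - 1)).re
      linarith [h.1]
    · refine (norm_sub_le _ _).trans ?_
      rw [norm_real, norm_real, two_mul]
      exact add_le_add (Γ.norm_coe_le_norm _) (Γ.norm_coe_le_norm _)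
    · rw [← ofReal_sub, norm_real]
      have : dist (bdryPt θ x) b < δ := by
        rwa [← dist_eq_norm] at hx
      exact (hδ' this).le
    · have : (r : ℂ) * b - b = ((r - 1 : ℝ) : ℂ) * b := by push_cast; ring
      rw [this, norm_mul, Circle.norm_coe, mul_one, norm_real, Real.norm_eq_abs, abs_sub_comm,
        abs_of_pos (by linarith)]
      exact hr2
  · have : (2 : ℂ) • Ring.inverse (1 - ((r : ℂ) * 0) • star chi) - 1 = 1 := by
      simp [two_smul]
    change L ((2 : ℂ) • Ring.inverse (1 - ((r : ℂ) * 0) • star chi) - 1) = _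
    rw [this, hL, pairing_apply, ← integral_complex_ofReal]
    simp

end Strip

namespace InterpolationPair

open Complex Filter Topology ComplexConjugate Strip

variable {E : Type u} [NormedAddCommGroup E] [NormedSpace ℂ E] {P : InterpolationPair E}

/-- The pointwise norms of the boundary values. -/
def CalderonFun.normAt (G : P.CalderonFun) : ℝ ⊕ ℝ → ℝ :=
  Sum.elim (fun t => ‖G.bd₀ t‖) (fun t => ‖G.bd₁ t‖)

/-- The norm of the interpolation space is bounded by the mean of the boundary norms. -/
lemma interpNorm_le_integral (θ : Ioo (0 : ℝ) 1) (G : P.CalderonFun)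
    (h₀ : Tendsto (fun t => ‖G.bd₀ t‖) (cocompact ℝ) (𝓝 0))
    (h₁ : Tendsto (fun t => ‖G.bd₁ t‖) (cocompact ℝ) (𝓝 0)) :
    P.interpNorm θ (G.toFun (θ : ℝ)) ≤
      ENNReal.ofReal (∫ x, G.normAt x ∂harmonicMeasure θ) := by
  refine ENNReal.le_of_forall_pos_le_add fun ε hε _ => ?_
  have hε' : (0 : ℝ) < ε := hε
  obtain ⟨Γ, hΓ0, hΓ1, hΓ2⟩ := exists_majorant θ (n := G.normAt)
    (Continuous.sumElim (by fun_prop) (by fun_prop))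
    (by rintro (t | t) <;> exact norm_nonneg _) (C := G.norm)
    (by rintro (t | t); exacts [G.norm_bd₀_le t, G.norm_bd₁_le t]) h₀ h₁ (half_pos hε')
  obtain ⟨R, H, hR, hHd, hH0, hH1, hH2⟩ := exists_herglotz θ Γ hΓ0
    (show (0 : ℝ) < ε / 4 by positivity)
  -- Re h dominates the boundary norms of G, so G/h has norm at most 1 while h(θ) is nearly their
  -- mean. The shift ε/2 absorbs the loss ε/4 in H and keeps h away from 0.
  set h : ℂ → ℂ := fun z => H (toDisc θ z) + (ε / 2 : ℝ) with hh
  have hmaps : MapsTo (toDisc θ) closedStrip (Metric.closedBall 0 1) := by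
    rw [← closure_openStrip]
    refine MapsTo.closure_of_continuousOn (fun z hz => ?_) ?_ |>.mono_right
      (closure_minimal (Subset.refl _) Metric.isClosed_closedBall)
    · simpa using (norm_toDisc_lt_one θ hz).le
    · rw [closure_openStrip]; exact continuousOn_toDisc θ
  have hball : Metric.closedBall (0 : ℂ) 1 ⊆ Metric.ball 0 R := Metric.closedBall_subset_ball hR
  have hre : ∀ z ∈ closedStrip, (ε / 2 : ℝ) ≤ (h z).re := fun z hz => by
    simp only [hh, add_re, ofReal_re]
    linarith [hH0 _ (hmaps hz)]
  have hne : ∀ z ∈ closedStrip, h z ≠ 0 := fun z hz h0 => by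
    have := hre z hz
    rw [h0, zero_re] at this
    linarith
  have hc : ContinuousOn h closedStrip :=
    ((hHd.continuousOn.mono hball).comp (continuousOn_toDisc θ) hmaps).add continuousOn_const
  have hd : DifferentiableOn ℂ h openStrip :=
    (hHd.comp (fun z hz => (differentiableAt_toDisc θ
      (openStrip_subset hz)).differentiableWithinAt)
      fun z hz => hball (hmaps (openStrip_subset hz))).add_const _
  have hbound : ∀ z ∈ closedStrip, ‖(h z)⁻¹‖ ≤ (ε / 2 : ℝ)⁻¹ := fun z hz => by
    rw [norm_inv]
    refine inv_anti₀ (by positivity) ((hre z hz).trans ((le_abs_self _).trans (abs_re_le_norm _)))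
  set F := G.mulScalar (fun z => (h z)⁻¹) (hc.inv₀ hne)
    (hd.inv fun z hz => hne z (openStrip_subset hz)) ⟨_, hbound⟩ with hF
  have hbd : ∀ x, G.normAt x ≤ ‖h (bdry x)‖ := fun x => by
    refine le_trans ?_ ((le_abs_self _).trans (abs_re_le_norm _))
    have e1 := hΓ1 x
    have e2 := hH1 (bdryPt θ x)
    simp only [hh, toDisc_bdry, add_re, ofReal_re]
    linarith
  have hinv : ∀ (x : ℝ ⊕ ℝ), ‖(h (bdry x))⁻¹‖ * G.normAt x ≤ 1 := fun x => by
    rw [norm_inv, inv_mul_le_iff₀ (norm_pos_iff.2 (hne _ (bdry_mem_closedStrip x))), mul_one]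
    exact hbd x
  have hFn : F.norm ≤ 1 := by
    refine CalderonFun.norm_le zero_le_one (fun t => ?_) fun t => ?_
    · rw [hF, CalderonFun.mulScalar_bd₀, norm_smul]
      exact hinv (Sum.inl t)
    · rw [hF, CalderonFun.mulScalar_bd₁, norm_smul]
      exact hinv (Sum.inr t)
  have hθ := hne _ (openStrip_subset (mem_openStrip θ))
  have e : G.toFun (θ : ℝ) = h (θ : ℝ) • F.toFun (θ : ℝ) := by
    rw [hF, CalderonFun.mulScalar_toFun, smul_smul, mul_inv_cancel₀ hθ, one_smul]
  have hval : h (θ : ℝ) = ((∫ x, Γ (bdryPt θ x) ∂harmonicMeasure θ) + ε / 2 : ℝ) := by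
    simp only [hh, toDisc_self, hH2]; push_cast; ring
  have hpos : 0 ≤ (∫ x, Γ (bdryPt θ x) ∂harmonicMeasure θ) + ε / 2 := by
    have : 0 ≤ ∫ x, Γ (bdryPt θ x) ∂harmonicMeasure θ := integral_nonneg fun x => hΓ0 _
    positivity
  rw [e]
  refine (P.interpNorm_smul_le _ _ _).trans ?_
  rw [hval, norm_real, Real.norm_of_nonneg hpos]
  refine (mul_le_mul_right (P.interpNorm_le F (θ : ℝ)) _).trans ?_
  rw [← ENNReal.ofReal_mul hpos]
  have hint0 : 0 ≤ ∫ x, G.normAt x ∂harmonicMeasure θ :=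
    integral_nonneg (by rintro (t | t) <;> exact norm_nonneg _)
  rw [show (ε : ℝ≥0∞) = ENNReal.ofReal ε by simp, ← ENNReal.ofReal_add hint0 hε'.le]
  refine ENNReal.ofReal_le_ofReal ((mul_le_of_le_one_right hpos hFn).trans ?_)
  linarith

end InterpolationPair

/-! ### Functions in 𝓕^∞ with continuous boundary values belong to the Calderón space. -/

namespace Strip

open Complex Filter Topology ComplexConjugate

/-- The boundary map is an embedding: inverting the Möbius map recovers `lineCoord`, whose sign
tells the line and whose logarithm gives the parameter. The approximate identity measures closeness
on the circle, and this converts it to closeness on the lines. -/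
lemma tendsto_comap_bdryPt (θ : Ioo (0 : ℝ) 1) (x₀ : ℝ ⊕ ℝ) :
    comap (fun x => (bdryPt θ x : ℂ)) (𝓝 (bdryPt θ x₀ : ℂ)) ≤ 𝓝 x₀ := by
  set w := halfPlane (θ : ℝ) with hw
  have hw2 : w - conj w ≠ 0 := sub_conj_ne_zero (center_im_pos θ).le (center_im_pos θ)
  have h1 : ∀ x, 1 - (bdryPt θ x : ℂ) = (w - conj w) / (lineCoord x - conj w) := fun x => by
    rw [coe_bdryPt, ← hw]
    have : (lineCoord x : ℂ) - conj w ≠ 0 := bdry_sub_ne_zero θ x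
    field_simp
    ring
  have h1' : ∀ x, 1 - (bdryPt θ x : ℂ) ≠ 0 := fun x => by
    rw [h1]; exact div_ne_zero hw2 (bdry_sub_ne_zero θ x)
  have h2 : ∀ x, (lineCoord x : ℝ) = ((w - conj w * (bdryPt θ x : ℂ)) /
      (1 - (bdryPt θ x : ℂ))).re := fun x => by
    have : (w - conj w * (bdryPt θ x : ℂ)) / (1 - (bdryPt θ x : ℂ)) = (lineCoord x : ℂ) := by
      rw [div_eq_iff (h1' x), h1, coe_bdryPt, ← hw]
      have : (lineCoord x : ℂ) - conj w ≠ 0 := bdry_sub_ne_zero θ x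
      field_simp
      ring
    rw [this, ofReal_re]
  have h3 : Tendsto lineCoord (comap (fun x => (bdryPt θ x : ℂ)) (𝓝 (bdryPt θ x₀ : ℂ)))
      (𝓝 (lineCoord x₀)) := by
    have hc : ContinuousAt (fun b : ℂ => ((w - conj w * b) / (1 - b)).re) (bdryPt θ x₀ : ℂ) :=
      continuous_re.continuousAt.comp (ContinuousAt.div (by fun_prop) (by fun_prop) (h1' x₀))
    have := hc.tendsto.comp (tendsto_comap (f := fun x => (bdryPt θ x : ℂ)))
    rw [h2]
    refine this.congr fun x => ?_
    simp only [Function.comp_apply]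
    rw [← h2]
  rcases x₀ with t | t
  · have h4 : Tendsto (fun x => (Sum.inl (-Real.log (lineCoord x) / Real.pi) : ℝ ⊕ ℝ))
        (comap (fun x => (bdryPt θ x : ℂ)) (𝓝 (bdryPt θ (Sum.inl t) : ℂ)))
        (𝓝 (Sum.inl (-Real.log (lineCoord (Sum.inl t)) / Real.pi))) :=
      (continuous_inl.tendsto _).comp
        ((h3.log (lineCoord_ne_zero _)).neg.div_const _)
    have e : ∀ s, -Real.log (lineCoord (Sum.inl s)) / Real.pi = s := fun s => by
      simp [lineCoord, Real.pi_ne_zero]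
    rw [e] at h4
    refine le_trans ?_ (tendsto_id'.1 (h4.congr' (f₂ := id) ?_))
    · exact le_rfl
    · have hpos : (0 : ℝ) < lineCoord (Sum.inl t) := Real.exp_pos _
      filter_upwards [h3.eventually (lt_mem_nhds hpos)] with x hx
      rcases x with s | s
      · rw [e]; rfl
      · exact absurd hx (not_lt.2 (neg_nonpos.2 (Real.exp_pos _).le))
  · have h4 : Tendsto (fun x => (Sum.inr (-Real.log (lineCoord x) / Real.pi) : ℝ ⊕ ℝ))
        (comap (fun x => (bdryPt θ x : ℂ)) (𝓝 (bdryPt θ (Sum.inr t) : ℂ)))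
        (𝓝 (Sum.inr (-Real.log (lineCoord (Sum.inr t)) / Real.pi))) :=
      (continuous_inr.tendsto _).comp
        ((h3.log (lineCoord_ne_zero _)).neg.div_const _)
    have e : ∀ s, -Real.log (lineCoord (Sum.inr s)) / Real.pi = s := fun s => by
      simp [lineCoord, Real.pi_ne_zero]
    rw [e] at h4
    refine le_trans ?_ (tendsto_id'.1 (h4.congr' (f₂ := id) ?_))
    · exact le_rfl
    · have hneg : lineCoord (Sum.inr t) < 0 := neg_lt_zero.2 (Real.exp_pos _)
      filter_upwards [h3.eventually (gt_mem_nhds hneg)] with x hx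
      rcases x with s | s
      · exact absurd hx (not_lt.2 (Real.exp_pos _).le)
      · rw [e]; rfl

end Strip

namespace InterpolationPair

open Complex Filter Topology ComplexConjugate Strip

variable {E : Type u} [NormedAddCommGroup E] [NormedSpace ℂ E] {P : InterpolationPair E}

lemma norm_le_of_interpNorm_le (t : Ioo (0 : ℝ) 1) {x : E} {c : ℝ}
    (h : P.interpNorm t x ≤ ENNReal.ofReal c) : ‖x‖ ≤ P.embNorm * max c 0 := by
  have h1 : ∀ ε > 0, ‖x‖ ≤ P.embNorm * (max c 0 + ε) := fun ε hε => by
    have h2 : P.interpNorm t x < ENNReal.ofReal (max c 0 + ε) :=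
      h.trans_lt (ENNReal.ofReal_lt_ofReal_iff'.2
        ⟨by linarith [le_max_left c 0], by linarith [le_max_right c 0]⟩)
    obtain ⟨F, hF, hF'⟩ := P.exists_calderonFun_of_lt h2
    rw [← hF]
    refine (F.norm_toFun_le (openStrip_subset (mem_openStrip t))).trans
      (mul_le_mul_of_nonneg_left ?_ P.embNorm_nonneg)
    exact ((ENNReal.ofReal_lt_ofReal_iff (by linarith [le_max_right c 0])).1 hF').le
  have h3 : Tendsto (fun ε => P.embNorm * (max c 0 + ε)) (𝓝[>] 0)
      (𝓝 (P.embNorm * (max c 0 + 0))) :=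
    ((continuous_const.mul (continuous_const.add continuous_id)).tendsto 0).mono_left
      nhdsWithin_le_nhds
  rw [add_zero] at h3
  exact ge_of_tendsto h3 (eventually_mem_nhdsWithin.mono fun ε hε => h1 ε hε)

/-- An element that is the limit of a sequence with summable increments. -/
lemma interpNorm_le_of_tendsto [CompleteSpace E] (t : Ioo (0 : ℝ) 1) {x : E} {y : ℕ → E}
    {a : ℝ} {b : ℕ → ℝ} (hy : Tendsto y atTop (𝓝 x)) (ha : 0 ≤ a)
    (h0 : P.interpNorm t (y 0) ≤ ENNReal.ofReal a)
    (hb0 : ∀ i, 0 ≤ b i) (hb : Summable b)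
    (h : ∀ i, P.interpNorm t (y (i + 1) - y i) ≤ ENNReal.ofReal (b i)) :
    P.interpNorm t x ≤ ENNReal.ofReal (a + ∑' i, b i) := by
  have hs : Summable fun i => y (i + 1) - y i :=
    Summable.of_norm_bounded (hb.mul_left P.embNorm) fun i => by
      simpa [max_eq_left (hb0 i)] using P.norm_le_of_interpNorm_le t (h i)
  have hx : HasSum (fun i => y (i + 1) - y i) (x - y 0) := by
    have h1 := hs.hasSum.tendsto_sum_nat
    simp only [Finset.sum_range_sub] at h1
    rw [← tendsto_nhds_unique h1 (hy.sub_const (y 0))]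
    exact hs.hasSum
  have h2 := P.interpNorm_tsum_le (t := t) hx
  rw [ENNReal.ofReal_add ha (tsum_nonneg hb0), ENNReal.ofReal_tsum_of_nonneg hb0 hb]
  calc P.interpNorm t x = P.interpNorm t (y 0 + (x - y 0)) := by rw [add_sub_cancel]
    _ ≤ _ := P.interpNorm_add_le _ _ _
    _ ≤ _ := add_le_add h0 (h2.trans (ENNReal.tsum_le_tsum h))

/-- `interpNorm_le_integral` without decay of the boundary values. -/
lemma interpNorm_le_integral' (θ : Ioo (0 : ℝ) 1) (G : P.CalderonFun) :
    P.interpNorm θ (G.toFun (θ : ℝ)) ≤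
      ENNReal.ofReal (Real.exp 1 * ∫ x, G.normAt x ∂harmonicMeasure θ) := by
  -- This factor equals 1 at θ, has modulus at most e on the strip and decays like e^{-y²}: it
  -- provides the missing decay at the price of the constant e.
  set h : ℂ → ℂ := fun z => exp ((z - (θ : ℝ)) ^ 2) with hh
  have hθ0 := θ.2.1
  have hθ1 := θ.2.2
  have hnorm : ∀ z, ‖h z‖ = Real.exp ((z.re - θ) ^ 2 - z.im ^ 2) := fun z => by
    rw [hh, norm_exp]
    simp [pow_two]
  have hle : ∀ z ∈ closedStrip, ‖h z‖ ≤ Real.exp 1 * Real.exp (-z.im ^ 2) := fun z hz => by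
    rw [hnorm, ← Real.exp_add]
    refine Real.exp_le_exp.2 ?_
    nlinarith [hz.1, hz.2]
  have hle' : ∀ z ∈ closedStrip, ‖h z‖ ≤ Real.exp 1 := fun z hz => by
    refine (hle z hz).trans (mul_le_of_le_one_right (Real.exp_pos _).le ?_)
    rw [Real.exp_le_one_iff]
    nlinarith [sq_nonneg z.im]
  have hcont : Continuous h := by simp only [hh]; fun_prop
  have hdiff : Differentiable ℂ h := by simp only [hh]; fun_prop
  set F := G.mulScalar h hcont.continuousOn hdiff.differentiableOn ⟨_, hle'⟩ with hF
  have hlim : Tendsto (fun t : ℝ => Real.exp 1 * Real.exp (-t ^ 2) * G.norm) (cocompact ℝ)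
      (𝓝 0) := by
    have h1 : Tendsto (fun t : ℝ => -t ^ 2) (cocompact ℝ) atBot := by
      rw [← Metric.cobounded_eq_cocompact]
      refine tendsto_neg_atTop_atBot.comp ?_
      have := (tendsto_pow_atTop (two_ne_zero)).comp (tendsto_norm_cobounded_atTop (E := ℝ))
      refine this.congr fun t => ?_
      simp
    have := ((Real.tendsto_exp_atBot.comp h1).const_mul (Real.exp 1)).mul_const G.norm
    simpa using this
  have e : F.toFun (θ : ℝ) = G.toFun (θ : ℝ) := by simp [hF, hh]
  rw [← e]
  refine (P.interpNorm_le_integral θ F (squeeze_zero (fun _ => norm_nonneg _) (fun t => ?_) hlim)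
    (squeeze_zero (fun _ => norm_nonneg _) (fun t => ?_) hlim)).trans
    (ENNReal.ofReal_le_ofReal ?_)
  · rw [hF, CalderonFun.mulScalar_bd₀, norm_smul]
    refine mul_le_mul ?_ (G.norm_bd₀_le t) (norm_nonneg _) (by positivity)
    simpa using hle _ (mul_I_mem_closedStrip t)
  · rw [hF, CalderonFun.mulScalar_bd₁, norm_smul]
    refine mul_le_mul ?_ (G.norm_bd₁_le t) (norm_nonneg _) (by positivity)
    simpa using hle _ (one_add_mul_I_mem_closedStrip t)
  · rw [← integral_const_mul]
    have hm : Measurable G.normAt :=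
      measurable_sum_of_continuous (Continuous.sumElim (by fun_prop) (by fun_prop))
    refine integral_mono_of_nonneg (Eventually.of_forall ?_) ?_ (Eventually.of_forall ?_)
    · rintro (t | t) <;> exact norm_nonneg _
    · refine Integrable.const_mul (Integrable.of_bound hm.aestronglyMeasurable G.norm
        (Eventually.of_forall ?_)) _
      rintro (t | t)
      · simpa [CalderonFun.normAt] using G.norm_bd₀_le t
      · simpa [CalderonFun.normAt] using G.norm_bd₁_le t
    · rintro (t | t)
      · simp only [CalderonFun.normAt, Sum.elim_inl, hF, CalderonFun.mulScalar_bd₀, norm_smul]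
        exact mul_le_mul_of_nonneg_right (hle' _ (mul_I_mem_closedStrip t)) (norm_nonneg _)
      · simp only [CalderonFun.normAt, Sum.elim_inr, hF, CalderonFun.mulScalar_bd₁, norm_smul]
        exact mul_le_mul_of_nonneg_right (hle' _ (one_add_mul_I_mem_closedStrip t)) (norm_nonneg _)

lemma mem_closedStrip_cases {z : ℂ} (hz : z ∈ closedStrip) :
    z ∈ openStrip ∨ ∃ x, z = bdry x := by
  rcases hz.1.eq_or_lt with h | h
  · exact Or.inr ⟨Sum.inl z.im, by apply Complex.ext <;> simp [bdry, ← h]⟩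
  · rcases hz.2.eq_or_lt with h' | h'
    · exact Or.inr ⟨Sum.inr z.im, by apply Complex.ext <;> simp [bdry, h']⟩
    · exact Or.inl ⟨h, h'⟩

lemma norm_discPoisson_pair_le (θ : Ioo (0 : ℝ) 1) (f : P.BdryFun) {w : ℂ} (hw : ‖w‖ < 1) :
    ‖pair θ f (discPoisson w)‖ ≤ P.embNorm * ‖f‖ := by
  have := norm_pair_le θ f (discPoisson w)
  rwa [integral_norm_discPoisson θ hw, mul_one] at this

lemma norm_toFun_le_norm (F : P.HInftyFun) {z : ℂ} (hz : z ∈ openStrip) :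
    ‖F.toFun z‖ ≤ P.embNorm * F.norm := by
  let θ : Ioo (0 : ℝ) 1 := ⟨1 / 2, by norm_num, by norm_num⟩
  rw [F.toFun_eq θ hz]
  exact norm_discPoisson_pair_le θ _ (norm_toDisc_lt_one θ hz)

section extend

variable (F : P.HInftyFun) (g₀ : ℝ →ᵇ P.X₀) (g₁ : ℝ →ᵇ P.X₁)

/-- The extension of a function in `𝓕^∞` to the closed strip by given boundary values. -/
def extend (z : ℂ) : E :=
  if z.re = 0 then P.emb₀ (g₀ z.im) else if z.re = 1 then P.emb₁ (g₁ z.im) else F.toFun z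

lemma extend_of_mem {z : ℂ} (hz : z ∈ openStrip) : extend F g₀ g₁ z = F.toFun z := by
  rw [extend, if_neg hz.1.ne', if_neg hz.2.ne]

/-- The values in `E` of continuous boundary functions. -/
def bdryVal : ℝ ⊕ ℝ → E := Sum.elim (fun t => P.emb₀ (g₀ t)) (fun t => P.emb₁ (g₁ t))

lemma extend_bdry (x : ℝ ⊕ ℝ) : extend F g₀ g₁ (bdry x) = bdryVal g₀ g₁ x := by
  rcases x with t | t <;> simp [extend, bdry, bdryVal]

lemma norm_bdryVal_le (x : ℝ ⊕ ℝ) :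
    ‖bdryVal g₀ g₁ x‖ ≤ P.embNorm * max ‖g₀‖ ‖g₁‖ := by
  rcases x with t | t
  · exact (norm_emb₀_le _).trans (mul_le_mul_of_nonneg_left
      ((g₀.norm_coe_le_norm t).trans (le_max_left _ _)) P.embNorm_nonneg)
  · exact (norm_emb₁_le _).trans (mul_le_mul_of_nonneg_left
      ((g₁.norm_coe_le_norm t).trans (le_max_right _ _)) P.embNorm_nonneg)

variable {F g₀ g₁}

lemma continuousOn_extend [CompleteSpace E] (h₀ : F.bd₀ =ᵐ[volume] g₀)
    (h₁ : F.bd₁ =ᵐ[volume] g₁) : ContinuousOn (extend F g₀ g₁) closedStrip := by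
  intro z hz
  rcases mem_closedStrip_cases hz with hz' | ⟨x, rfl⟩
  · refine ContinuousAt.continuousWithinAt ?_
    refine (F.analytic.continuousOn.continuousAt (isOpen_openStrip.mem_nhds hz')).congr ?_
    filter_upwards [isOpen_openStrip.mem_nhds hz'] with w hw
    exact (extend_of_mem F g₀ g₁ hw).symm
  let θ : Ioo (0 : ℝ) 1 := ⟨1 / 2, by norm_num, by norm_num⟩
  set M : ℝ := 2 * (P.embNorm * max ‖g₀‖ ‖g₁‖) with hM
  have hM0 : 0 ≤ M := by have := P.embNorm_nonneg; positivity
  have hUc : Continuous (bdryVal g₀ g₁) := Continuous.sumElim (by fun_prop) (by fun_prop)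
  have hU : eval F.data =ᵐ[harmonicMeasure θ] bdryVal g₀ g₁ := by
    refine (harmonicMeasure_absolutelyContinuous θ).ae_le (ae_lines.2 ⟨?_, ?_⟩)
    · filter_upwards [h₀] with t ht
      simp [eval, bdryVal, HInftyFun.data, ht]
    · filter_upwards [h₁] with t ht
      simp [eval, bdryVal, HInftyFun.data, ht]
  rw [ContinuousWithinAt, extend_bdry, Metric.tendsto_nhds]
  intro η hη
  have hev : ∀ᶠ y in comap (fun y => (bdryPt θ y : ℂ)) (𝓝 (bdryPt θ x : ℂ)),
      ‖bdryVal g₀ g₁ y - bdryVal g₀ g₁ x‖ ≤ η / 4 := by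
    have h1 : Tendsto (fun y => ‖bdryVal g₀ g₁ y - bdryVal g₀ g₁ x‖) (𝓝 x) (𝓝 0) := by
      have := ((hUc.sub continuous_const).norm).tendsto x (f := fun y =>
        ‖bdryVal g₀ g₁ y - bdryVal g₀ g₁ x‖)
      simpa using this
    exact tendsto_comap_bdryPt θ x (h1.eventually (ge_mem_nhds (by positivity)))
  obtain ⟨δ, hδ, hδ'⟩ := (Metric.nhds_basis_ball.comap _).eventually_iff.1 hev
  have hδ'' : ∀ y, ‖(bdryPt θ y : ℂ) - bdryPt θ x‖ < δ →
      ‖bdryVal g₀ g₁ y - bdryVal g₀ g₁ x‖ ≤ η / 4 := fun y hy => hδ' (by simpa [dist_eq_norm] using hy)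
  have hψ : Tendsto (toDisc θ) (𝓝[closedStrip] bdry x) (𝓝 (bdryPt θ x : ℂ)) := by
    rw [← toDisc_bdry]
    exact continuousOn_toDisc θ _ (bdry_mem_closedStrip x)
  have hev1 : ∀ᶠ z in 𝓝[closedStrip] bdry x, ‖toDisc θ z - bdryPt θ x‖ < δ / 2 := by
    have := (Metric.tendsto_nhds.1 hψ) (δ / 2) (half_pos hδ)
    simpa [dist_eq_norm] using this
  have hev2 : ∀ᶠ z in 𝓝[closedStrip] bdry x,
      M * ((1 - ‖toDisc θ z‖ ^ 2) * (4 / δ ^ 2)) < η / 4 := by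
    have h2 : Tendsto (fun z => M * ((1 - ‖toDisc θ z‖ ^ 2) * (4 / δ ^ 2)))
        (𝓝[closedStrip] bdry x) (𝓝 (M * ((1 - ‖(bdryPt θ x : ℂ)‖ ^ 2) * (4 / δ ^ 2)))) :=
      (((hψ.norm.pow 2).const_sub 1).mul_const _).const_mul _
    rw [Circle.norm_coe] at h2
    norm_num at h2
    exact h2.eventually (gt_mem_nhds (by positivity))
  filter_upwards [hev1, hev2, self_mem_nhdsWithin] with z h1 h2 hz
  rw [dist_eq_norm]
  rcases mem_closedStrip_cases hz with hz' | ⟨y, rfl⟩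
  · rw [extend_of_mem F g₀ g₁ hz', F.toFun_eq θ hz']
    refine (norm_pairing_discPoisson_sub_le (integrable_eval θ F.data) (b := bdryPt θ x) hδ hM0
      (show 0 ≤ η / 4 by positivity) ?_ ?_ (norm_toDisc_lt_one θ hz') h1.le).trans_lt
      (by linarith)
    · filter_upwards [hU] with y hy
      rw [hy]
      refine (norm_sub_le _ _).trans ?_
      rw [hM, two_mul]
      exact add_le_add (norm_bdryVal_le _ _ _) (norm_bdryVal_le _ _ _)
    · filter_upwards [hU] with y hy hy'
      rw [hy]
      exact hδ'' y hy'
  · rw [extend_bdry]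
    rw [toDisc_bdry] at h1
    exact (hδ'' y (by linarith)).trans_lt (by linarith)

/-- A function in `𝓕^∞` with continuous boundary values is in the Calderón space. -/
def HInftyFun.toCalderonFun [CompleteSpace E] (h₀ : F.bd₀ =ᵐ[volume] g₀)
    (h₁ : F.bd₁ =ᵐ[volume] g₁) : P.CalderonFun where
  toFun := extend F g₀ g₁
  continuousOn := continuousOn_extend h₀ h₁
  bounded := by
    refine ⟨max (P.embNorm * F.norm) (P.embNorm * max ‖g₀‖ ‖g₁‖), fun z hz => ?_⟩
    rcases mem_closedStrip_cases hz with hz' | ⟨y, rfl⟩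
    · rw [extend_of_mem F g₀ g₁ hz']
      exact (norm_toFun_le_norm F hz').trans (le_max_left _ _)
    · rw [extend_bdry]
      exact (norm_bdryVal_le _ _ _).trans (le_max_right _ _)
  analytic := F.analytic.congr fun z hz => extend_of_mem F g₀ g₁ hz
  bd₀ := g₀
  bd₁ := g₁
  eq_bd₀ t := extend_bdry F g₀ g₁ (Sum.inl t)
  eq_bd₁ t := extend_bdry F g₀ g₁ (Sum.inr t)

end extend

end InterpolationPair

/-! ### Moving averages of bounded functions on the line. -/

section average

open Filter Topology

variable {X : Type*} [NormedAddCommGroup X]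

lemma locallyIntegrable_Lp_top (f : Lp X ∞ (volume : Measure ℝ)) : LocallyIntegrable f volume :=
  (Lp.memLp f).locallyIntegrable le_top

lemma ae_norm_comp_add_le (f : Lp X ∞ (volume : Measure ℝ)) (t : ℝ) :
    ∀ᵐ s, ‖f (t + s)‖ ≤ ‖f‖ :=
  (measurePreserving_add_left volume t).quasiMeasurePreserving.ae
    (InterpolationPair.ae_norm_le_Lp f)

variable [NormedSpace ℝ X]

/-- The mean of `f` on `[t - ε, t + ε]`. -/
def boxMean (ε : ℝ) (f : ℝ → X) (t : ℝ) : X := (2 * ε)⁻¹ • ∫ s in Ioc (-ε) ε, f (t + s)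

lemma boxMean_eq {ε : ℝ} (hε : 0 < ε) (f : ℝ → X) (t : ℝ) :
    boxMean ε f t = (2 * ε)⁻¹ • ∫ s in (t - ε)..(t + ε), f s := by
  rw [boxMean, ← intervalIntegral.integral_of_le (by linarith),
    intervalIntegral.integral_comp_add_left]
  rfl

lemma boxMean_eq_average {ε : ℝ} (hε : 0 < ε) (f : ℝ → X) (t : ℝ) :
    boxMean ε f t = ⨍ s in Metric.closedBall t ε, f s := by
  rw [boxMean_eq hε, Real.closedBall_eq_Icc, setAverage_eq, integral_Icc_eq_integral_Ioc,
    intervalIntegral.integral_of_le (by linarith), Measure.real, Real.volume_Icc,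
    ENNReal.toReal_ofReal (by linarith)]
  congr 2
  ring

variable (f : Lp X ∞ (volume : Measure ℝ))

lemma continuous_boxMean [CompleteSpace X] {ε : ℝ} (hε : 0 < ε) : Continuous (boxMean ε f) := by
  have hi : ∀ a b, IntervalIntegrable f volume a b := fun a b =>
    ((locallyIntegrable_Lp_top f).integrableOn_isCompact isCompact_uIcc).intervalIntegrable
  have h := intervalIntegral.continuous_primitive hi 0
  have e : boxMean ε f = fun t => (2 * ε)⁻¹ •
      ((∫ s in (0 : ℝ)..(t + ε), f s) - ∫ s in (0 : ℝ)..(t - ε), f s) := by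
    funext t
    rw [boxMean_eq hε, intervalIntegral.integral_interval_sub_left (hi _ _) (hi _ _)]
  rw [e]
  exact ((h.comp (continuous_id.add continuous_const)).sub
    (h.comp (continuous_id.sub continuous_const))).const_smul _

lemma norm_boxMean_le {ε : ℝ} (hε : 0 < ε) (t : ℝ) : ‖boxMean ε f t‖ ≤ ‖f‖ := by
  rw [boxMean, norm_smul, norm_inv, Real.norm_of_nonneg (by positivity),
    inv_mul_le_iff₀ (by positivity)]
  have := norm_setIntegral_le_of_norm_le_const_ae (μ := volume) (s := Ioc (-ε) ε) (C := ‖f‖)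
    (f := fun s => f (t + s)) (by simp) 
      (ae_restrict_of_ae (ae_norm_comp_add_le f t))
  refine this.trans (le_of_eq ?_)
  rw [Measure.real, Real.volume_Ioc, ENNReal.toReal_ofReal (by linarith)]
  ring

lemma tendsto_boxMean [CompleteSpace X] : ∀ᵐ t, Tendsto (fun ε => boxMean ε f t) (𝓝[>] 0) (𝓝 (f t)) := by
  filter_upwards [IsUnifLocDoublingMeasure.ae_tendsto_average volume
    (locallyIntegrable_Lp_top f) 1] with t ht
  have := ht (fun _ : ℝ => t) (fun ε => ε) (l := 𝓝[>] 0) tendsto_id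
    (eventually_mem_nhdsWithin.mono fun ε hε => by
      simpa using (show (0 : ℝ) ≤ ε from (le_of_lt hε)))
  refine this.congr' (eventually_mem_nhdsWithin.mono fun ε hε => ?_)
  exact (boxMean_eq_average hε _ _).symm

/-- The mean as a bounded continuous function. -/
def boxMeanBCF [CompleteSpace X] {ε : ℝ} (hε : 0 < ε) : ℝ →ᵇ X :=
  BoundedContinuousFunction.ofNormedAddCommGroup (boxMean ε f) (continuous_boxMean f hε) ‖f‖
    (norm_boxMean_le f hε)

lemma memLp_boxMean [CompleteSpace X] {ε : ℝ} (hε : 0 < ε) : MemLp (boxMean ε f) ∞ volume :=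
  memLp_top_of_bound (continuous_boxMean f hε).aestronglyMeasurable ‖f‖
    (Eventually.of_forall (norm_boxMean_le f hε))

end average

/-! ### Values of functions in 𝓕^∞ lie in the interpolation spaces. -/

namespace InterpolationPair

open Complex Filter Topology ComplexConjugate Strip

variable {E : Type u} [NormedAddCommGroup E] [NormedSpace ℂ E] {P : InterpolationPair E}

/-- The means of boundary functions. -/
def boxMeanBdry {ε : ℝ} (hε : 0 < ε) (f : P.BdryFun) : P.BdryFun :=
  BdryFun.mk' (memLp_boxMean f.1 hε) (memLp_boxMean f.2 hε)

lemma measurable_shift : Measurable fun p : (ℝ ⊕ ℝ) × ℝ => shift p.2 p.1 := by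
  have h1 : Measurable (Sum.map (fun q : ℝ × ℝ => q.1 + q.2) (fun q : ℝ × ℝ => q.1 + q.2)) :=
    Measurable.sumMap (measurable_fst.add measurable_snd) (measurable_fst.add measurable_snd)
  have h2 := h1.comp (MeasurableEquiv.sumProdDistrib ℝ ℝ ℝ).measurable
  convert h2 using 1
  funext ⟨x, s⟩
  rcases x with t | t <;> rfl

lemma stronglyMeasurable_sumElim {α β F : Type*} [MeasurableSpace α] [MeasurableSpace β]
    [TopologicalSpace F] [TopologicalSpace.PseudoMetrizableSpace F] {f : α → F} {g : β → F}
    (hf : StronglyMeasurable f) (hg : StronglyMeasurable g) :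
    StronglyMeasurable (Sum.elim f g) := by
  borelize F
  refine stronglyMeasurable_iff_measurable_separable.2
    ⟨measurable_fun_sum hf.measurable hg.measurable, ?_⟩
  rw [Sum.elim_range]
  exact hf.isSeparable_range.union hg.isSeparable_range

lemma stronglyMeasurable_eval (f : P.BdryFun) : StronglyMeasurable (eval f) :=
  stronglyMeasurable_sumElim
    (P.emb₀.continuous.comp_stronglyMeasurable (Lp.stronglyMeasurable f.1))
    (P.emb₁.continuous.comp_stronglyMeasurable (Lp.stronglyMeasurable f.2))

lemma ae_norm_eval_shift_le (f : P.BdryFun) (x : ℝ ⊕ ℝ) :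
    ∀ᵐ s, ‖eval f (shift s x)‖ ≤ P.embNorm * ‖f‖ := by
  rcases x with t | t
  · filter_upwards [ae_norm_comp_add_le f.1 t] with s hs
    exact (norm_emb₀_le _).trans (mul_le_mul_of_nonneg_left (hs.trans (norm_fst_le f))
      P.embNorm_nonneg)
  · filter_upwards [ae_norm_comp_add_le f.2 t] with s hs
    exact (norm_emb₁_le _).trans (mul_le_mul_of_nonneg_left (hs.trans (norm_snd_le f))
      P.embNorm_nonneg)

/-- Fubini for the pairing of the means of a boundary function. -/
lemma pair_boxMeanBdry [CompleteSpace E] (θ : Ioo (0 : ℝ) 1) {ε : ℝ} (hε : 0 < ε)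
    (f : P.BdryFun) (m : C(Circle, ℂ)) : pair θ (boxMeanBdry hε f) m =
      (2 * ε)⁻¹ • ∫ s in Ioc (-ε) ε, pair θ (translate s f) m := by
  have hsm : StronglyMeasurable fun p : (ℝ ⊕ ℝ) × ℝ => eval f (shift p.2 p.1) :=
    (stronglyMeasurable_eval f).comp_measurable measurable_shift
  have hmβ : Measurable fun x => m (bdryPt θ x) :=
    measurable_sum_of_continuous (m.continuous.comp (continuous_bdryPt θ))
  have h1 : pair θ (boxMeanBdry hε f) m = ∫ x, ((2 * ε)⁻¹ •
      ∫ s in Ioc (-ε) ε, m (bdryPt θ x) • eval f (shift s x)) ∂harmonicMeasure θ := by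
    refine pair_congr ?_
    filter_upwards [eval_mk' (memLp_boxMean f.1 hε) (memLp_boxMean f.2 hε)] with x hx
    rw [boxMeanBdry, hx, integral_smul, smul_comm]
    congr 1
    rcases x with t | t
    · have hi : Integrable (fun s => f.1 (t + s)) (volume.restrict (Ioc (-ε) ε)) :=
        Integrable.of_bound (((Lp.stronglyMeasurable f.1).comp_measurable
          (measurable_const_add t)).aestronglyMeasurable) _
          (ae_restrict_of_ae (ae_norm_comp_add_le f.1 t))
      simp only [Sum.elim_inl, boxMean]
      rw [ContinuousLinearMap.map_smul_of_tower, ← ContinuousLinearMap.integral_comp_comm _ hi]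
      rfl
    · have hi : Integrable (fun s => f.2 (t + s)) (volume.restrict (Ioc (-ε) ε)) :=
        Integrable.of_bound (((Lp.stronglyMeasurable f.2).comp_measurable
          (measurable_const_add t)).aestronglyMeasurable) _
          (ae_restrict_of_ae (ae_norm_comp_add_le f.2 t))
      simp only [Sum.elim_inr, boxMean]
      rw [ContinuousLinearMap.map_smul_of_tower, ← ContinuousLinearMap.integral_comp_comm _ hi]
      rfl
  have h2 : ∀ s, pair θ (translate s f) m =
      ∫ x, m (bdryPt θ x) • eval f (shift s x) ∂harmonicMeasure θ := fun s => by
    refine pair_congr ?_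
    filter_upwards [eval_translate s f] with x hx
    rw [hx]
  rw [h1, integral_smul]
  simp only [h2]
  rw [integral_integral_swap]
  refine Integrable.of_bound (C := ‖m‖ * (P.embNorm * ‖f‖)) ?_ ?_
  · exact ((hmβ.comp measurable_fst).stronglyMeasurable.smul hsm).aestronglyMeasurable
  · have hms : MeasurableSet {p : (ℝ ⊕ ℝ) × ℝ | ‖eval f (shift p.2 p.1)‖ ≤ P.embNorm * ‖f‖} :=
      measurableSet_le hsm.norm.measurable measurable_const
    have h3 := (Measure.ae_prod_iff_ae_ae (μ := harmonicMeasure θ)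
      (ν := volume.restrict (Ioc (-ε) ε)) hms).2
      (Eventually.of_forall fun x => ae_restrict_of_ae (ae_norm_eval_shift_le f x))
    filter_upwards [h3] with p hp
    simp only [Function.uncurry, norm_smul]
    exact mul_le_mul (m.norm_coe_le_norm _) hp (norm_nonneg _) (norm_nonneg _)

lemma IsAnalyticData.translate {f : P.BdryFun} (hf : IsAnalyticData f) (s : ℝ) :
    IsAnalyticData (translate s f) := by
  obtain ⟨F, rfl⟩ := hf
  exact ⟨F.shift s, rfl⟩

lemma IsAnalyticData.boxMeanBdry [CompleteSpace E] {f : P.BdryFun} (hf : IsAnalyticData f)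
    {ε : ℝ} (hε : 0 < ε) : IsAnalyticData (boxMeanBdry hε f) := by
  let θ : Ioo (0 : ℝ) 1 := ⟨1 / 2, by norm_num, by norm_num⟩
  rw [isAnalyticData_iff θ]
  intro k hk
  -- The moving average is a mean of vertical translates, each with vanishing positive moments.
  rw [pair_boxMeanBdry]
  simp [(isAnalyticData_iff θ).1 (hf.translate _) k hk]

/-- Lebesgue differentiation gives convergence almost everywhere, and 2‖f‖ dominates. Uniform
convergence may fail, which is why the interpolation norm has to be estimated by a mean. -/
lemma tendsto_integral_normAt_boxMean (θ : Ioo (0 : ℝ) 1) (f : P.BdryFun) :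
    Tendsto (fun n : ℕ => ∫ x, normAt (boxMeanBdry (Nat.one_div_pos_of_nat (α := ℝ) (n := n)) f - f) x
      ∂harmonicMeasure θ) atTop (𝓝 0) := by
  have hlim : Tendsto (fun n : ℕ => 1 / ((n : ℝ) + 1)) atTop (𝓝[>] 0) :=
    tendsto_nhdsWithin_iff.2 ⟨tendsto_one_div_add_atTop_nhds_zero_nat,
      Eventually.of_forall fun n => Set.mem_Ioi.2 Nat.one_div_pos_of_nat⟩
  have h0 : ∫ _ : ℝ ⊕ ℝ, (0 : ℝ) ∂harmonicMeasure θ = 0 := by simp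
  rw [← h0]
  have hb : ∀ n : ℕ, ‖boxMeanBdry (Nat.one_div_pos_of_nat (α := ℝ) (n := n)) f - f‖ ≤ 2 * ‖f‖ :=
    fun n => by
      refine (norm_sub_le _ _).trans ?_
      have : ‖boxMeanBdry (Nat.one_div_pos_of_nat (α := ℝ) (n := n)) f‖ ≤ ‖f‖ := by
        refine norm_bdryFun_le (norm_nonneg _) ?_
        filter_upwards [normAt_mk' (memLp_boxMean f.1 (Nat.one_div_pos_of_nat (α := ℝ) (n := n)))
          (memLp_boxMean f.2 (Nat.one_div_pos_of_nat (α := ℝ) (n := n)))] with x hx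
        rw [boxMeanBdry, hx]
        rcases x with t | t
        · exact (norm_boxMean_le f.1 Nat.one_div_pos_of_nat t).trans (norm_fst_le f)
        · exact (norm_boxMean_le f.2 Nat.one_div_pos_of_nat t).trans (norm_snd_le f)
      linarith
  refine tendsto_integral_of_dominated_convergence (fun _ => 2 * ‖f‖)
    (fun n => (aestronglyMeasurable_normAt _).mono_ac (harmonicMeasure_absolutelyContinuous θ))
    (integrable_const _) (fun n => ?_) ?_
  · refine (harmonicMeasure_absolutelyContinuous θ).ae_le ?_
    filter_upwards [ae_normAt_le (boxMeanBdry (Nat.one_div_pos_of_nat (α := ℝ) (n := n)) f - f)]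
      with x hx
    rw [Real.norm_of_nonneg (normAt_nonneg _ _)]
    exact hx.trans (hb n)
  · refine (harmonicMeasure_absolutelyContinuous θ).ae_le (ae_lines.2 ⟨?_, ?_⟩)
    · have h1 : ∀ᵐ t, ∀ n : ℕ, (boxMeanBdry (Nat.one_div_pos_of_nat (α := ℝ) (n := n)) f - f).1 t =
          boxMean (1 / ((n : ℝ) + 1)) f.1 t - f.1 t := by
        rw [ae_all_iff]
        intro n
        filter_upwards [Lp.coeFn_sub (boxMeanBdry (Nat.one_div_pos_of_nat (α := ℝ) (n := n)) f).1 f.1,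
          (memLp_boxMean f.1 (Nat.one_div_pos_of_nat (α := ℝ) (n := n))).coeFn_toLp] with t ht ht'
        refine ht.trans ?_
        rw [Pi.sub_apply, ← ht']
        rfl
      filter_upwards [h1, tendsto_boxMean f.1] with t ht ht'
      have := ((ht'.comp hlim).sub_const (f.1 t)).norm
      rw [sub_self, norm_zero] at this
      refine this.congr fun n => ?_
      exact congrArg norm (ht n).symm
    · have h1 : ∀ᵐ t, ∀ n : ℕ, (boxMeanBdry (Nat.one_div_pos_of_nat (α := ℝ) (n := n)) f - f).2 t =
          boxMean (1 / ((n : ℝ) + 1)) f.2 t - f.2 t := by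
        rw [ae_all_iff]
        intro n
        filter_upwards [Lp.coeFn_sub (boxMeanBdry (Nat.one_div_pos_of_nat (α := ℝ) (n := n)) f).2 f.2,
          (memLp_boxMean f.2 (Nat.one_div_pos_of_nat (α := ℝ) (n := n))).coeFn_toLp] with t ht ht'
        refine ht.trans ?_
        rw [Pi.sub_apply, ← ht']
        rfl
      filter_upwards [h1, tendsto_boxMean f.2] with t ht ht'
      have := ((ht'.comp hlim).sub_const (f.2 t)).norm
      rw [sub_self, norm_zero] at this
      refine this.congr fun n => ?_
      exact congrArg norm (ht n).symm

lemma norm_pair_one_le (θ : Ioo (0 : ℝ) 1) (f : P.BdryFun) :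
    ‖pair θ f 1‖ ≤ P.embNorm * ∫ x, normAt f x ∂harmonicMeasure θ := by
  rw [pair, pairing_apply, ← integral_const_mul]
  refine norm_integral_le_of_norm_le ?_ (Eventually.of_forall fun x => ?_)
  · refine Integrable.const_mul (Integrable.of_bound ((aestronglyMeasurable_normAt _).mono_ac
      (harmonicMeasure_absolutelyContinuous θ)) ‖f‖ ?_) _
    refine (harmonicMeasure_absolutelyContinuous θ).ae_le ?_
    filter_upwards [ae_normAt_le f] with x hx
    rwa [Real.norm_of_nonneg (normAt_nonneg _ _)]
  · simpa using norm_eval_le f x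

lemma integrable_normAt (θ : Ioo (0 : ℝ) 1) (f : P.BdryFun) :
    Integrable (normAt f) (harmonicMeasure θ) := by
  refine Integrable.of_bound ((aestronglyMeasurable_normAt _).mono_ac
      (harmonicMeasure_absolutelyContinuous θ)) ‖f‖ ?_
  refine (harmonicMeasure_absolutelyContinuous θ).ae_le ?_
  filter_upwards [ae_normAt_le f] with x hx
  rwa [Real.norm_of_nonneg (normAt_nonneg _ _)]

/-- The Calderón function with the means of an analytic boundary function as boundary values. -/
lemma exists_calderonFun_boxMean [CompleteSpace E] {f : P.BdryFun} (hf : IsAnalyticData f)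
    {ε : ℝ} (hε : 0 < ε) : ∃ G : P.CalderonFun, G.norm ≤ ‖f‖ ∧
      G.bd₀ = boxMeanBCF f.1 hε ∧ G.bd₁ = boxMeanBCF f.2 hε ∧
      (∀ θ : Ioo (0 : ℝ) 1, G.toFun (θ : ℝ) = pair θ (boxMeanBdry hε f) 1) ∧
      ∃ F : P.HInftyFun, F.bd₀ =ᵐ[volume] G.bd₀ ∧ F.bd₁ =ᵐ[volume] G.bd₁ ∧
        EqOn G.toFun F.toFun openStrip := by
  obtain ⟨F, hF⟩ := hf.boxMeanBdry hε
  have h0 : F.bd₀ =ᵐ[volume] boxMeanBCF f.1 hε := by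
    have : F.bd₀ = (boxMeanBdry hε f).1 := congrArg Prod.fst hF
    rw [this]
    exact (memLp_boxMean f.1 hε).coeFn_toLp
  have h1 : F.bd₁ =ᵐ[volume] boxMeanBCF f.2 hε := by
    have : F.bd₁ = (boxMeanBdry hε f).2 := congrArg Prod.snd hF
    rw [this]
    exact (memLp_boxMean f.2 hε).coeFn_toLp
  refine ⟨HInftyFun.toCalderonFun h0 h1, ?_, rfl, rfl, fun θ => ?_, F, h0, h1,
    fun z hz => extend_of_mem _ _ _ hz⟩
  · refine CalderonFun.norm_le (norm_nonneg _) (fun t => ?_) fun t => ?_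
    · exact (norm_boxMean_le f.1 hε t).trans (norm_fst_le f)
    · exact (norm_boxMean_le f.2 hε t).trans (norm_snd_le f)
  · change extend F _ _ _ = _
    rw [extend_of_mem _ _ _ (mem_openStrip θ), F.toFun_center, hF]

/-- The values of functions in `𝓕^∞` are approximated by those of Calderón functions. -/
lemma exists_calderonFun_close [CompleteSpace E] (θ : Ioo (0 : ℝ) 1) (F : P.HInftyFun) {η : ℝ}
    (hη' : 0 < η) : ∃ G : P.CalderonFun, G.norm ≤ F.norm ∧
      P.interpNorm θ (F.toFun (θ : ℝ) - G.toFun (θ : ℝ)) ≤ ENNReal.ofReal η ∧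
      ∃ F' : P.HInftyFun, F'.bd₀ =ᵐ[volume] G.bd₀ ∧ F'.bd₁ =ᵐ[volume] G.bd₁ ∧
        EqOn G.toFun F'.toFun openStrip := by
  set f := F.data with hf
  have hfa : IsAnalyticData f := ⟨F, rfl⟩
  have hpos : ∀ n : ℕ, (0 : ℝ) < 1 / ((n : ℝ) + 1) := fun n => Nat.one_div_pos_of_nat
  set d : ℕ → ℝ := fun n => ∫ x, normAt (boxMeanBdry (hpos n) f - f) x ∂harmonicMeasure θ with hd
  have hd0 : ∀ n, 0 ≤ d n := fun n => integral_nonneg (normAt_nonneg _)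
  have hdlim : Tendsto d atTop (𝓝 0) := tendsto_integral_normAt_boxMean θ f
  choose G hGn hG0 hG1 hGθ hGF using fun n => exists_calderonFun_boxMean hfa (hpos n)
  -- The L¹ estimate for differences makes the values at θ Cauchy in X_θ, although the functions
  -- need not converge in the Calderón norm.
  have hdiff : ∀ i j, P.interpNorm θ ((G i).toFun (θ : ℝ) - (G j).toFun (θ : ℝ)) ≤
      ENNReal.ofReal (Real.exp 1 * (d i + d j)) := fun i j => by
    refine (P.interpNorm_le_integral' θ ((G i).sub (G j))).trans (ENNReal.ofReal_le_ofReal ?_)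
    refine mul_le_mul_of_nonneg_left ?_ (Real.exp_pos _).le
    rw [hd, ← integral_add (integrable_normAt θ _) (integrable_normAt θ _)]
    refine integral_mono_of_nonneg (Eventually.of_forall ?_)
      ((integrable_normAt θ _).add (integrable_normAt θ _)) ?_
    · rintro (t | t) <;> exact norm_nonneg _
    refine (harmonicMeasure_absolutelyContinuous θ).ae_le (ae_lines.2 ⟨?_, ?_⟩)
    · filter_upwards [Lp.coeFn_sub (boxMeanBdry (hpos i) f).1 f.1,
        Lp.coeFn_sub (boxMeanBdry (hpos j) f).1 f.1, (memLp_boxMean f.1 (hpos i)).coeFn_toLp,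
        (memLp_boxMean f.1 (hpos j)).coeFn_toLp] with t hi hj hi' hj'
      have e1 : normAt (boxMeanBdry (hpos i) f - f) (Sum.inl t) = ‖(G i).bd₀ t - f.1 t‖ := by
        refine congrArg norm (hi.trans ?_)
        rw [hG0, Pi.sub_apply]
        exact congrArg (· - f.1 t) hi'
      have e2 : normAt (boxMeanBdry (hpos j) f - f) (Sum.inl t) = ‖(G j).bd₀ t - f.1 t‖ := by
        refine congrArg norm (hj.trans ?_)
        rw [hG0, Pi.sub_apply]
        exact congrArg (· - f.1 t) hj'
      rw [e1, e2, norm_sub_rev _ (f.1 t), add_comm, norm_sub_rev _ (f.1 t), add_comm,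
        norm_sub_rev (f.1 t)]
      exact norm_sub_le_norm_sub_add_norm_sub _ _ _
    · filter_upwards [Lp.coeFn_sub (boxMeanBdry (hpos i) f).2 f.2,
        Lp.coeFn_sub (boxMeanBdry (hpos j) f).2 f.2, (memLp_boxMean f.2 (hpos i)).coeFn_toLp,
        (memLp_boxMean f.2 (hpos j)).coeFn_toLp] with t hi hj hi' hj'
      have e1 : normAt (boxMeanBdry (hpos i) f - f) (Sum.inr t) = ‖(G i).bd₁ t - f.2 t‖ := by
        refine congrArg norm (hi.trans ?_)
        rw [hG1, Pi.sub_apply]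
        exact congrArg (· - f.2 t) hi'
      have e2 : normAt (boxMeanBdry (hpos j) f - f) (Sum.inr t) = ‖(G j).bd₁ t - f.2 t‖ := by
        refine congrArg norm (hj.trans ?_)
        rw [hG1, Pi.sub_apply]
        exact congrArg (· - f.2 t) hj'
      rw [e1, e2, norm_sub_rev _ (f.2 t), add_comm, norm_sub_rev _ (f.2 t), add_comm,
        norm_sub_rev (f.2 t)]
      exact norm_sub_le_norm_sub_add_norm_sub _ _ _
  have hlim : Tendsto (fun n => (G n).toFun (θ : ℝ)) atTop (𝓝 (F.toFun (θ : ℝ))) := by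
    rw [tendsto_iff_norm_sub_tendsto_zero]
    refine squeeze_zero (fun _ => norm_nonneg _) (fun n => ?_)
      (by simpa using hdlim.const_mul P.embNorm)
    rw [hGθ, F.toFun_center, ← pair_sub]
    exact norm_pair_one_le θ _
  -- Chosen so that the increments along the subsequence are at most e(c i + c i) = (η/2) 2^{-i},
  -- with sum η.
  set c : ℕ → ℝ := fun i => η / (4 * Real.exp 1) * (1 / 2) ^ i with hc
  have hc0 : ∀ i, 0 < c i := fun i => by positivity
  have hex : ∀ i, ∃ n, i ≤ n ∧ d n ≤ c i := fun i =>
    ((eventually_ge_atTop i).and (hdlim.eventually (ge_mem_nhds (hc0 i)))).exists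
  choose φ hφ hφ' using hex
  have hcs : ∀ i, c (i + 1) ≤ c i := fun i => by
    simp only [hc]
    refine mul_le_mul_of_nonneg_left ?_ (by positivity)
    rw [pow_succ]
    have : (0 : ℝ) < (1 / 2) ^ i := by positivity
    linarith
  have hb : ∀ i, Real.exp 1 * (d (φ (i + 1)) + d (φ i)) ≤ η / 2 * (1 / 2) ^ i := fun i => by
    have e : Real.exp 1 * (c i + c i) = η / 2 * (1 / 2) ^ i := by
      simp only [hc]
      have := (Real.exp_pos 1).ne'
      field_simp
      norm_num
    rw [← e]
    exact mul_le_mul_of_nonneg_left (add_le_add ((hφ' _).trans (hcs i)) (hφ' i)) (Real.exp_pos _).le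
  have hgeom : Summable fun i : ℕ => η / 2 * (1 / 2) ^ i := summable_geometric_two.mul_left _
  have h0 := P.interpNorm_le_of_tendsto θ
    (y := fun i => (G (φ i)).toFun (θ : ℝ) - (G (φ 0)).toFun (θ : ℝ))
    ((hlim.comp (tendsto_atTop_mono hφ tendsto_id)).sub_const _) le_rfl
    (by simp [interpNorm_zero]) (fun i => by positivity) hgeom
    fun i => by
      rw [sub_sub_sub_cancel_right]
      exact (hdiff _ _).trans (ENNReal.ofReal_le_ofReal (hb i))
  refine ⟨G (φ 0), hGn _, h0.trans (le_of_eq ?_), hGF _⟩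
  rw [tsum_mul_left, tsum_geometric_two, div_mul_cancel₀ _ two_ne_zero, zero_add]

/-- The values of functions in `𝓕^∞` are in the interpolation spaces. -/
theorem interpNorm_toFun_le [CompleteSpace E] (θ : Ioo (0 : ℝ) 1) (F : P.HInftyFun) :
    P.interpNorm θ (F.toFun (θ : ℝ)) ≤ ENNReal.ofReal F.norm := by
  refine ENNReal.le_of_forall_pos_le_add fun η hη _ => ?_
  obtain ⟨G, hG, hG', -⟩ := exists_calderonFun_close θ F (η := η) hη
  have := P.interpNorm_add_le θ (G.toFun (θ : ℝ)) (F.toFun (θ : ℝ) - G.toFun (θ : ℝ))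
  rw [add_sub_cancel] at this
  refine this.trans (add_le_add ((P.interpNorm_le G _).trans (ENNReal.ofReal_le_ofReal hG)) ?_)
  simpa using hG'

end InterpolationPair

/-! ### Gaussian means and the density of the intersection in the interpolation spaces. -/

namespace InterpolationPair

open Complex Filter Topology ComplexConjugate Strip ProbabilityTheory

/-- Vertical line integrals of an analytic function with uniform decay agree. -/
lemma integral_vertical_eq {F : Type*} [NormedAddCommGroup F] [NormedSpace ℂ F] [CompleteSpace F]
    {h : ℂ → F} (hc : ContinuousOn h closedStrip) (hd : DifferentiableOn ℂ h openStrip)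
    {φ : ℝ → ℝ} (hφ : ∀ z ∈ closedStrip, ‖h z‖ ≤ φ z.im)
    (hφi : Integrable φ) (hφt : Tendsto φ atTop (𝓝 0)) (hφb : Tendsto φ atBot (𝓝 0))
    {x₁ x₂ : ℝ} (h₁ : 0 ≤ x₁) (h₁₂ : x₁ ≤ x₂) (h₂ : x₂ ≤ 1) :
    ∫ y : ℝ, h (x₁ + y * I) = ∫ y : ℝ, h (x₂ + y * I) := by
  have hmem : ∀ x ∈ Icc x₁ x₂, ∀ y : ℝ, (x + y * I : ℂ) ∈ closedStrip := fun x hx y => by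
    simp only [closedStrip, mem_ofPred_eq, add_re, ofReal_re, mul_re, I_re, mul_zero, ofReal_im,
      I_im, mul_one, sub_self, add_zero]
    exact ⟨h₁.trans hx.1, hx.2.trans h₂⟩
  have hint : ∀ x ∈ Icc x₁ x₂, Integrable fun y : ℝ => h (x + y * I) := fun x hx => by
    refine hφi.mono' ?_ (Eventually.of_forall fun y => ?_)
    · exact (hc.comp_continuous (by fun_prop) (hmem x hx)).aestronglyMeasurable
    · simpa using hφ _ (hmem x hx y)
  have hrect : ∀ T : ℝ, 0 ≤ T → (∫ x : ℝ in x₁..x₂, h (x + (-T : ℝ) * I)) -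
      (∫ x : ℝ in x₁..x₂, h (x + T * I)) + I • (∫ y : ℝ in (-T)..T, h (x₂ + y * I)) -
      I • (∫ y : ℝ in (-T)..T, h (x₁ + y * I)) = 0 := fun T hT => by
    have := integral_boundary_rect_eq_zero_of_continuousOn_of_differentiableOn h
      (x₁ + (-T : ℝ) * I) (x₂ + T * I) ?_ ?_
    · simpa using this
    · refine hc.mono fun z hz => ?_
      rw [mem_reProdIm] at hz
      have h1 := hz.1
      simp only [add_re, ofReal_re, mul_re, I_re, mul_zero, ofReal_im, I_im, mul_one, sub_self,
        add_zero, uIcc_of_le h₁₂] at h1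
      exact ⟨h₁.trans h1.1, h1.2.trans h₂⟩
    · refine hd.mono fun z hz => ?_
      rw [mem_reProdIm] at hz
      have h1 := hz.1
      simp only [add_re, ofReal_re, mul_re, I_re, mul_zero, ofReal_im, I_im, mul_one, sub_self,
        add_zero, min_eq_left h₁₂, max_eq_right h₁₂] at h1
      exact ⟨h₁.trans_lt h1.1, h1.2.trans_le h₂⟩
  have hhor : ∀ {T : ℕ → ℝ}, Tendsto (fun n => φ (T n)) atTop (𝓝 0) →
      Tendsto (fun n => ∫ x : ℝ in x₁..x₂, h (x + T n * I)) atTop (𝓝 0) := fun {T} hT => by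
    rw [tendsto_zero_iff_norm_tendsto_zero]
    refine squeeze_zero (fun _ => norm_nonneg _) (fun n => ?_)
      (by simpa using hT.mul_const |x₂ - x₁|)
    refine intervalIntegral.norm_integral_le_of_norm_le_const fun x hx => ?_
    rw [uIoc_of_le h₁₂] at hx
    simpa using hφ _ (hmem x ⟨hx.1.le, hx.2⟩ (T n))
  have hT : Tendsto (fun n : ℕ => (n : ℝ)) atTop atTop := tendsto_natCast_atTop_atTop
  have hT' : Tendsto (fun n : ℕ => -(n : ℝ)) atTop atBot := tendsto_neg_atTop_atBot.comp hT
  have hver : ∀ x ∈ Icc x₁ x₂, Tendsto (fun n : ℕ => ∫ y : ℝ in (-(n : ℝ))..n, h (x + y * I))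
      atTop (𝓝 (∫ y : ℝ, h (x + y * I))) := fun x hx =>
    intervalIntegral_tendsto_integral (hint x hx) hT' hT
  have hlim := (((hhor (hφb.comp hT')).sub (hhor (hφt.comp hT))).add
    ((hver x₂ ⟨h₁₂, le_rfl⟩).const_smul I)).sub ((hver x₁ ⟨le_rfl, h₁₂⟩).const_smul I)
  have hz := tendsto_nhds_unique (hlim.congr fun n : ℕ => hrect (n : ℝ) n.cast_nonneg) tendsto_const_nhds
  rw [sub_self, zero_add, ← smul_sub] at hz
  exact (sub_eq_zero.1 ((smul_eq_zero.1 hz).resolve_left I_ne_zero)).symm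

section gaussMean

variable {X : Type*} [NormedAddCommGroup X] [NormedSpace ℝ X]

/-- The standard Gaussian measure. -/

lemma gaussMean_aux (c : ℝ) (g : ℝ →ᵇ X) :
    Continuous fun t => ∫ s, g (t + c * s) ∂gaussianReal 0 1 := by
  refine continuous_of_dominated (bound := fun _ => ‖g‖) (fun t => ?_)
    (fun t => Eventually.of_forall fun s => g.norm_coe_le_norm _) (integrable_const _)
    (Eventually.of_forall fun s => by fun_prop)
  exact Continuous.aestronglyMeasurable (by fun_prop)

/-- Gaussian mean of a bounded continuous function. -/
def gaussMean (c : ℝ) (g : ℝ →ᵇ X) : ℝ →ᵇ X :=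
  BoundedContinuousFunction.ofNormedAddCommGroup (fun t => ∫ s, g (t + c * s) ∂gaussianReal 0 1)
    (gaussMean_aux c g) ‖g‖ fun t => by
      have := norm_integral_le_of_norm_le_const (μ := gaussianReal 0 1) (f := fun s => g (t + c * s))
        (Eventually.of_forall fun s => g.norm_coe_le_norm _)
      simpa using this

lemma gaussMean_apply (c : ℝ) (g : ℝ →ᵇ X) (t : ℝ) :
    gaussMean c g t = ∫ s, g (t + c * s) ∂gaussianReal 0 1 := rfl

lemma norm_gaussMean_apply_le (c : ℝ) (g : ℝ →ᵇ X) (t : ℝ) : ‖gaussMean c g t‖ ≤ ‖g‖ := by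
  have := norm_integral_le_of_norm_le_const (μ := gaussianReal 0 1) (f := fun s => g (t + c * s))
    (Eventually.of_forall fun s => g.norm_coe_le_norm _)
  simpa [gaussMean_apply] using this

lemma tendsto_gaussMean [CompleteSpace X] (g : ℝ →ᵇ X) (t : ℝ) {c : ℕ → ℝ}
    (hc : Tendsto c atTop (𝓝 0)) : Tendsto (fun n => gaussMean (c n) g t) atTop (𝓝 (g t)) := by
  have e : g t = ∫ _ : ℝ, g t ∂gaussianReal 0 1 := by simp
  rw [e]
  refine tendsto_integral_of_dominated_convergence (fun _ => ‖g‖) (fun n => ?_)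
    (integrable_const _) (fun n => Eventually.of_forall fun s => g.norm_coe_le_norm _)
    (Eventually.of_forall fun s => ?_)
  · exact Continuous.aestronglyMeasurable (by fun_prop)
  · have : Tendsto (fun n => t + c n * s) atTop (𝓝 (t + 0 * s)) := (hc.mul_const s).const_add t
    rw [zero_mul, add_zero] at this
    exact (g.continuous.tendsto t).comp this

end gaussMean

variable {E : Type u} [NormedAddCommGroup E] [NormedSpace ℂ E] {P : InterpolationPair E}

lemma memLp_bcf {X : Type*} [NormedAddCommGroup X] (g : ℝ →ᵇ X) : MemLp g ∞ volume :=
  memLp_top_of_bound g.continuous.aestronglyMeasurable ‖g‖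
    (Eventually.of_forall g.norm_coe_le_norm)

/-- Bounded continuous boundary functions. -/
def bcfBdry (g₀ : ℝ →ᵇ P.X₀) (g₁ : ℝ →ᵇ P.X₁) : P.BdryFun :=
  BdryFun.mk' (memLp_bcf g₀) (memLp_bcf g₁)

lemma eval_bcfBdry (g₀ : ℝ →ᵇ P.X₀) (g₁ : ℝ →ᵇ P.X₁) :
    eval (bcfBdry g₀ g₁) =ᵐ[lines] bdryVal g₀ g₁ := eval_mk' _ _

lemma ae_shift {p : ℝ ⊕ ℝ → Prop} (h : ∀ᵐ x ∂lines, p x) (s : ℝ) :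
    ∀ᵐ x ∂lines, p (shift s x) := by
  rw [ae_lines] at h ⊢
  exact ⟨(measurePreserving_add_right volume s).quasiMeasurePreserving.ae h.1,
    (measurePreserving_add_right volume s).quasiMeasurePreserving.ae h.2⟩

/-- Fubini for the pairing of the Gaussian mean of a boundary function. -/
lemma pair_gaussMean [CompleteSpace E] (θ : Ioo (0 : ℝ) 1) (c : ℝ)
    (g₀ : ℝ →ᵇ P.X₀) (g₁ : ℝ →ᵇ P.X₁) (m : C(Circle, ℂ)) :
    pair θ (bcfBdry (gaussMean c g₀) (gaussMean c g₁)) m =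
      ∫ s, pair θ (translate (c * s) (bcfBdry g₀ g₁)) m ∂gaussianReal 0 1 := by
  have hmβ : Measurable fun x => m (bdryPt θ x) :=
    measurable_sum_of_continuous (m.continuous.comp (continuous_bdryPt θ))
  have h1 : pair θ (bcfBdry (gaussMean c g₀) (gaussMean c g₁)) m = ∫ x, (
      ∫ s, m (bdryPt θ x) • bdryVal g₀ g₁ (shift (c * s) x) ∂gaussianReal 0 1) ∂harmonicMeasure θ := by
    refine pair_congr ?_
    filter_upwards [eval_bcfBdry (gaussMean c g₀) (gaussMean c g₁)] with x hx
    rw [hx, integral_smul]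
    congr 1
    rcases x with t | t
    · have hi : Integrable (fun s => g₀ (t + c * s)) (gaussianReal 0 1) :=
        Integrable.of_bound (Continuous.aestronglyMeasurable (by fun_prop)) ‖g₀‖
          (Eventually.of_forall fun s => g₀.norm_coe_le_norm _)
      simp only [bdryVal, Sum.elim_inl, gaussMean_apply]
      rw [← ContinuousLinearMap.integral_comp_comm _ hi]
      rfl
    · have hi : Integrable (fun s => g₁ (t + c * s)) (gaussianReal 0 1) :=
        Integrable.of_bound (Continuous.aestronglyMeasurable (by fun_prop)) ‖g₁‖
          (Eventually.of_forall fun s => g₁.norm_coe_le_norm _)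
      simp only [bdryVal, Sum.elim_inr, gaussMean_apply]
      rw [← ContinuousLinearMap.integral_comp_comm _ hi]
      rfl
  have h2 : ∀ s, pair θ (translate (c * s) (bcfBdry g₀ g₁)) m =
      ∫ x, m (bdryPt θ x) • bdryVal g₀ g₁ (shift (c * s) x) ∂harmonicMeasure θ := fun s => by
    refine pair_congr ?_
    filter_upwards [eval_translate (c * s) (bcfBdry g₀ g₁),
      ae_shift (eval_bcfBdry g₀ g₁) (c * s)] with x hx hx'
    rw [hx, hx']
  rw [h1]
  simp only [h2]
  rw [integral_integral_swap]
  refine Integrable.of_bound (C := ‖m‖ * (P.embNorm * max ‖g₀‖ ‖g₁‖)) ?_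
    (Eventually.of_forall fun p => ?_)
  · have h3 : StronglyMeasurable (bdryVal g₀ g₁) :=
      stronglyMeasurable_sumElim (Continuous.stronglyMeasurable (by fun_prop))
        (Continuous.stronglyMeasurable (by fun_prop))
    exact ((hmβ.comp measurable_fst).stronglyMeasurable.smul (h3.comp_measurable
      (measurable_shift.comp (measurable_fst.prodMk
        (measurable_snd.const_mul c))))).aestronglyMeasurable
  · simp only [Function.uncurry, norm_smul]
    exact mul_le_mul (m.norm_coe_le_norm _) (norm_bdryVal_le _ _ _) (norm_nonneg _) (norm_nonneg _)

lemma bcfBdry_eq {f : P.BdryFun} {g₀ : ℝ →ᵇ P.X₀} {g₁ : ℝ →ᵇ P.X₁}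
    (h₀ : f.1 =ᵐ[volume] g₀) (h₁ : f.2 =ᵐ[volume] g₁) : bcfBdry g₀ g₁ = f := by
  refine Prod.ext (Lp.ext ?_) (Lp.ext ?_)
  · exact (memLp_bcf g₀).coeFn_toLp.trans h₀.symm
  · exact (memLp_bcf g₁).coeFn_toLp.trans h₁.symm

lemma tendsto_exp_neg_mul_sq {b : ℝ} (hb : 0 < b) :
    Tendsto (fun y : ℝ => Real.exp (-b * y ^ 2)) atTop (𝓝 0) := by
  refine Real.tendsto_exp_atBot.comp ?_
  have h : Tendsto (fun y : ℝ => b * y ^ 2) atTop atTop :=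
    (tendsto_pow_atTop two_ne_zero).const_mul_atTop hb
  refine (tendsto_neg_atTop_atBot.comp h).congr fun y => ?_
  simp

/-- Gaussian means on a vertical line of a Calderón function are in the intersection. -/
lemma gaussian_vertical_mem [CompleteSpace E] (θ : Ioo (0 : ℝ) 1) (G : P.CalderonFun) {c : ℝ}
    (hc : 0 < c) : ∃ (a : P.X₀) (b : P.X₁), P.emb₀ a = P.emb₁ b ∧
      P.emb₀ a = ∫ s, G.toFun ((θ : ℝ) + (c * s : ℝ) * I) ∂gaussianReal 0 1 := by
  set B : ℝ := (2 * c ^ 2)⁻¹ with hB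
  have hB0 : 0 < B := by positivity
  set A : ℝ := (√(2 * Real.pi))⁻¹ with hA
  have hA0 : 0 ≤ A := by positivity
  -- Up to scaling, an entire extension of the Gaussian density on the vertical line through θ. The
  -- mean thus becomes a contour integral that can be moved to either boundary line, where it
  -- converges in X₀, respectively X₁.
  set k : ℂ → ℂ := fun z => A * exp (B * (z - (θ : ℝ)) ^ 2) with hk
  have hkn : ∀ z, ‖k z‖ = A * Real.exp (B * ((z.re - θ) ^ 2 - z.im ^ 2)) := fun z => by
    rw [hk, norm_mul, norm_real, Real.norm_of_nonneg hA0, norm_exp]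
    simp [pow_two]
  have hkle : ∀ z ∈ closedStrip, ‖k z‖ ≤ A * Real.exp B * Real.exp (-B * z.im ^ 2) := fun z hz => by
    rw [hkn, mul_assoc, ← Real.exp_add]
    refine mul_le_mul_of_nonneg_left (Real.exp_le_exp.2 ?_) hA0
    have h1 : (z.re - θ) ^ 2 ≤ 1 := by nlinarith [hz.1, hz.2, θ.2.1, θ.2.2]
    nlinarith [mul_le_mul_of_nonneg_left h1 hB0.le]
  have hkc : Continuous k := by simp only [hk]; fun_prop
  have hkd : Differentiable ℂ k := by simp only [hk]; fun_prop
  set D : ℝ := A * Real.exp B * max (P.embNorm * G.norm) G.norm with hD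
  set φ : ℝ → ℝ := fun y => D * Real.exp (-B * y ^ 2) with hφ
  have hφi : Integrable φ := (integrable_exp_neg_mul_sq hB0).const_mul D
  have hφt : Tendsto φ atTop (𝓝 0) := by
    have h := (tendsto_exp_neg_mul_sq hB0).const_mul D
    rw [mul_zero] at h
    exact h
  have hφb : Tendsto φ atBot (𝓝 0) := by
    refine (hφt.comp tendsto_neg_atBot_atTop).congr fun y => ?_
    simp [hφ]
  have hbound : ∀ z ∈ closedStrip, ∀ r : ℝ, 0 ≤ r → r ≤ max (P.embNorm * G.norm) G.norm →
      ‖k z‖ * r ≤ φ z.im := fun z hz r hr hr' => by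
    refine (mul_le_mul (hkle z hz) hr' hr (by positivity)).trans (le_of_eq ?_)
    simp only [hφ, hD]; ring
  have hh : ∀ z ∈ closedStrip, ‖k z • G.toFun z‖ ≤ φ z.im := fun z hz => by
    rw [norm_smul]
    exact hbound z hz _ (norm_nonneg _) ((G.norm_toFun_le hz).trans (le_max_left _ _))
  have hi₀ : Integrable fun y : ℝ => k (y * I) • G.bd₀ y := by
    refine hφi.mono' (Continuous.aestronglyMeasurable (by fun_prop))
      (Eventually.of_forall fun y => ?_)
    rw [norm_smul]
    simpa using hbound _ (mul_I_mem_closedStrip y) _ (norm_nonneg _)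
      ((G.norm_bd₀_le y).trans (le_max_right _ _))
  have hi₁ : Integrable fun y : ℝ => k (1 + y * I) • G.bd₁ y := by
    refine hφi.mono' (Continuous.aestronglyMeasurable (by fun_prop))
      (Eventually.of_forall fun y => ?_)
    rw [norm_smul]
    simpa using hbound _ (one_add_mul_I_mem_closedStrip y) _ (norm_nonneg _)
      ((G.norm_bd₁_le y).trans (le_max_right _ _))
  have hcont : ContinuousOn (fun z => k z • G.toFun z) closedStrip :=
    hkc.continuousOn.smul G.continuousOn
  have hdiff : DifferentiableOn ℂ (fun z => k z • G.toFun z) openStrip :=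
    hkd.differentiableOn.smul G.analytic
  have e₀ := integral_vertical_eq hcont hdiff hh hφi hφt hφb le_rfl θ.2.1.le θ.2.2.le
  have e₁ := integral_vertical_eq hcont hdiff hh hφi hφt hφb θ.2.1.le θ.2.2.le le_rfl
  simp only [ofReal_zero, zero_add, ofReal_one, G.eq_bd₀, G.eq_bd₁] at e₀ e₁
  have f₀ := P.emb₀.integral_comp_comm hi₀
  have f₁ := P.emb₁.integral_comp_comm hi₁
  simp only [map_smul] at f₀ f₁
  have emain : ∫ s, G.toFun ((θ : ℝ) + (c * s : ℝ) * I) ∂gaussianReal 0 1 =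
      (c⁻¹ : ℝ) • ∫ y : ℝ, k ((θ : ℝ) + y * I) • G.toFun ((θ : ℝ) + y * I) := by
    rw [integral_gaussianReal_eq_integral_smul one_ne_zero]
    have := Measure.integral_comp_mul_left
      (fun y : ℝ => k ((θ : ℝ) + y * I) • G.toFun ((θ : ℝ) + y * I)) c
    rw [abs_of_pos (inv_pos.2 hc)] at this
    rw [← this]
    congr with s
    rw [← coe_smul]
    congr 1
    simp only [hk, gaussianPDFReal, hA, hB]
    push_cast
    congr 1
    · simp
    · congr 1
      have : (c : ℂ) ≠ 0 := by exact_mod_cast hc.ne'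
      field_simp
      simp [mul_pow, I_sq]
  refine ⟨(c⁻¹ : ℝ) • ∫ y : ℝ, k (y * I) • G.bd₀ y, (c⁻¹ : ℝ) • ∫ y : ℝ, k (1 + y * I) • G.bd₁ y,
    ?_, ?_⟩
  · rw [ContinuousLinearMap.map_smul_of_tower, ContinuousLinearMap.map_smul_of_tower, ← f₀, ← f₁,
      e₀, e₁]
  · rw [ContinuousLinearMap.map_smul_of_tower, ← f₀, e₀, emain]

/-- The intersection is dense in the interpolation spaces. -/
lemma exists_inter_close [CompleteSpace E] (θ : Ioo (0 : ℝ) 1) (F : P.HInftyFun) {η : ℝ}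
    (hη : 0 < η) : ∃ (a : P.X₀) (b : P.X₁), P.emb₀ a = P.emb₁ b ∧
      P.interpNorm θ (F.toFun (θ : ℝ) - P.emb₀ a) ≤ ENNReal.ofReal η := by
  obtain ⟨G, -, hG, F', h₀, h₁, hF'⟩ := exists_calderonFun_close θ F (half_pos hη)
  have hdata : bcfBdry G.bd₀ G.bd₁ = F'.data := bcfBdry_eq h₀ h₁
  set c : ℕ → ℝ := fun n => 1 / ((n : ℝ) + 1) with hc
  have hc0 : ∀ n, 0 < c n := fun n => Nat.one_div_pos_of_nat
  have hclim : Tendsto c atTop (𝓝 0) := tendsto_one_div_add_atTop_nhds_zero_nat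
  have hpair : ∀ n m, pair θ (bcfBdry (gaussMean (c n) G.bd₀) (gaussMean (c n) G.bd₁)) m =
      ∫ s, pair θ (F'.shift (c n * s)).data m ∂gaussianReal 0 1 := fun n m => by
    rw [pair_gaussMean, hdata]
    rfl
  have han : ∀ n, ∃ H : P.HInftyFun,
      H.data = bcfBdry (gaussMean (c n) G.bd₀) (gaussMean (c n) G.bd₁) := fun n => by
    refine (isAnalyticData_iff θ).2 fun k hk => ?_
    rw [hpair]
    simp [HInftyFun.moments _ θ k hk]
  choose H hH using han
  have hH₀ : ∀ n, (H n).bd₀ =ᵐ[volume] gaussMean (c n) G.bd₀ := fun n => by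
    have : (H n).bd₀ = (bcfBdry (gaussMean (c n) G.bd₀) (gaussMean (c n) G.bd₁)).1 :=
      congrArg Prod.fst (hH n)
    rw [this]
    exact (memLp_bcf _).coeFn_toLp
  have hH₁ : ∀ n, (H n).bd₁ =ᵐ[volume] gaussMean (c n) G.bd₁ := fun n => by
    have : (H n).bd₁ = (bcfBdry (gaussMean (c n) G.bd₀) (gaussMean (c n) G.bd₁)).2 :=
      congrArg Prod.snd (hH n)
    rw [this]
    exact (memLp_bcf _).coeFn_toLp
  set K : ℕ → P.CalderonFun := fun n => HInftyFun.toCalderonFun (hH₀ n) (hH₁ n) with hK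
  -- By Fubini, averaging the boundary values averages the function along the vertical line, so the
  -- value at θ lies in the intersection.
  have hKθ : ∀ n, (K n).toFun (θ : ℝ) = ∫ s, G.toFun ((θ : ℝ) + (c n * s : ℝ) * I) ∂gaussianReal 0 1 := fun n => by
    change extend (H n) _ _ _ = _
    rw [extend_of_mem _ _ _ (mem_openStrip θ), HInftyFun.toFun_center, hH, hpair]
    congr with s
    rw [← HInftyFun.toFun_center, hF' (add_mul_I_mem (mem_openStrip θ) _)]
    rfl
  -- Continuous boundary values are the pointwise limits of their Gaussian means, so dominated
  -- convergence applies in the L¹ estimate.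
  have hlim : Tendsto (fun n => Real.exp 1 * ∫ x, (G.sub (K n)).normAt x ∂harmonicMeasure θ) atTop
      (𝓝 (Real.exp 1 * 0)) := by
    refine Tendsto.const_mul _ ?_
    have e0 : ∫ _ : ℝ ⊕ ℝ, (0 : ℝ) ∂harmonicMeasure θ = 0 := by simp
    rw [← e0]
    refine tendsto_integral_of_dominated_convergence (fun _ => 2 * G.norm) (fun n => ?_)
      (integrable_const _) (fun n => Eventually.of_forall ?_) (Eventually.of_forall ?_)
    · exact (measurable_sum_of_continuous
        (Continuous.sumElim (by fun_prop) (by fun_prop))).aestronglyMeasurable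
    · rintro (t | t)
      · simp only [CalderonFun.normAt, Sum.elim_inl, norm_norm]
        refine (norm_sub_le _ _).trans ?_
        rw [two_mul]
        exact add_le_add (G.norm_bd₀_le t) ((norm_gaussMean_apply_le _ _ _).trans (le_max_left _ _))
      · simp only [CalderonFun.normAt, Sum.elim_inr, norm_norm]
        refine (norm_sub_le _ _).trans ?_
        rw [two_mul]
        exact add_le_add (G.norm_bd₁_le t) ((norm_gaussMean_apply_le _ _ _).trans (le_max_right _ _))
    · rintro (t | t)
      · have := ((tendsto_gaussMean G.bd₀ t hclim).const_sub (G.bd₀ t)).norm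
        simpa using! this
      · have := ((tendsto_gaussMean G.bd₁ t hclim).const_sub (G.bd₁ t)).norm
        simpa using! this
  rw [mul_zero] at hlim
  obtain ⟨n, hn⟩ := (hlim.eventually (ge_mem_nhds (half_pos hη))).exists
  obtain ⟨a, b, hab, ha⟩ := gaussian_vertical_mem θ G (hc0 n)
  refine ⟨a, b, hab, ?_⟩
  rw [ha, ← hKθ]
  have e : F.toFun (θ : ℝ) - (K n).toFun (θ : ℝ) =
      (F.toFun (θ : ℝ) - G.toFun (θ : ℝ)) + (G.sub (K n)).toFun (θ : ℝ) := by
    simp [CalderonFun.sub]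
  rw [e]
  refine (P.interpNorm_add_le _ _ _).trans ((add_le_add hG
    ((P.interpNorm_le_integral' θ (G.sub (K n))).trans (ENNReal.ofReal_le_ofReal hn))).trans ?_)
  rw [← ENNReal.ofReal_add (half_pos hη).le (half_pos hη).le, add_halves]

/-- Dense subspaces of the intersection are dense in the interpolation spaces. -/
lemma IsDenseInInter.exists_close [CompleteSpace E] {D : Submodule ℂ E} (hD : P.IsDenseInInter D)
    (θ : Ioo (0 : ℝ) 1) (F : P.HInftyFun) {η : ℝ} (hη : 0 < η) :
    ∃ y ∈ D, P.interpNorm θ (F.toFun (θ : ℝ) - y) ≤ ENNReal.ofReal η := by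
  obtain ⟨a, b, hab, h⟩ := exists_inter_close θ F (half_pos hη)
  obtain ⟨a', b', hab', ha', h1, h2⟩ := hD.2 a b hab (η / 2) (half_pos hη)
  refine ⟨P.emb₀ a', ha', ?_⟩
  have e : F.toFun (θ : ℝ) - P.emb₀ a' =
      (F.toFun (θ : ℝ) - P.emb₀ a) + P.emb₀ (a - a') := by simp
  have h3 := P.interpNorm_const_le (θ : ℝ) (a - a') (b - b') (by simp [hab, hab'])
  rw [e]
  refine (P.interpNorm_add_le _ _ _).trans ((add_le_add h (h3.trans
    (ENNReal.ofReal_le_ofReal (max_le h1.le h2.le)))).trans ?_)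
  rw [← ENNReal.ofReal_add (half_pos hη).le (half_pos hη).le, add_halves]

lemma IsDenseInInter.subset {D : Submodule ℂ E} (hD : P.IsDenseInInter D) (t : ℝ) :
    (D : Set E) ⊆ P.interpSpace t := fun x hx => by
  obtain ⟨⟨a, rfl⟩, ⟨b, hb⟩⟩ := hD.1 x hx
  exact (P.interpNorm_const_le t a b hb.symm).trans_lt ENNReal.ofReal_lt_top

end InterpolationPair

/-! ### A Liouville theorem for bounded mean-value arrays. -/

/-- Bounded solutions of `U k l = (U (k + 1) l + U k (l + 1)) / 2` are constant on
antidiagonals; here, the inequality between neighbours. -/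
lemma succ_le_of_bounded_mean {U : ℕ → ℕ → ℝ} {M : ℝ} (hM : ∀ k l, |U k l| ≤ M)
    (hU : ∀ k l, U k l = (U (k + 1) l + U k (l + 1)) / 2) : U 1 0 ≤ U 0 1 := by
  by_contra! hlt
  -- The difference of neighbours satisfies the same recursion; suppose its supremum S is positive.
  set W : ℕ × ℕ → ℝ := fun p => U (p.1 + 1) p.2 - U p.1 (p.2 + 1) with hW
  have hb : BddAbove (range W) := ⟨2 * M, by
    rintro _ ⟨p, rfl⟩
    have h1 := (abs_le.1 (hM (p.1 + 1) p.2)).2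
    have h2 := (abs_le.1 (hM p.1 (p.2 + 1))).1
    simp only [hW]; linarith⟩
  set S := ⨆ p, W p with hS
  have hle : ∀ p, W p ≤ S := fun p => le_ciSup hb p
  have hS0 : 0 < S := lt_of_lt_of_le (by simpa [hW] using hlt) (hle (0, 0))
  have hmean : ∀ k l, W (k, l) = (W (k + 1, l) + W (k, l + 1)) / 2 := fun k l => by
    have h1 := hU (k + 1) l
    have h2 := hU k (l + 1)
    simp only [hW]; linarith
  have key : ∀ n : ℕ, (n + 1 : ℝ) * (S / 2) ≤ 2 * M := fun n => by
    -- Start within S/2^{n+1} of the supremum. An entry is the mean of two entries not exceeding S,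
    -- so the deficit at most doubles per step, and after n steps all n + 1 entries reached are at
    -- least S/2.
    obtain ⟨⟨k, l⟩, hkl⟩ := exists_lt_of_lt_ciSup
      (show S - S / 2 ^ (n + 1) < ⨆ p, W p from sub_lt_self _ (by positivity))
    have hdef : ∀ i j : ℕ, S - 2 ^ (i + j) * (S / 2 ^ (n + 1)) ≤ W (k + i, l + j) := by
      intro i
      induction i with
      | zero =>
        intro j
        induction j with
        | zero => simpa using hkl.le
        | succ j ih =>
          have h1 := hmean (k + 0) (l + j)
          have h2 := hle (k + 0 + 1, l + j)
          have h3 : (2 : ℝ) ^ (0 + (j + 1)) = 2 * 2 ^ (0 + j) := by ring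
          rw [← add_assoc l j 1, h3]
          linarith
      | succ i ih =>
        intro j
        have h1 := hmean (k + i) (l + j)
        have h2 := hle (k + i, l + j + 1)
        have h3 : (2 : ℝ) ^ (i + 1 + j) = 2 * 2 ^ (i + j) := by ring
        rw [← add_assoc k i 1, h3]
        linarith [ih j]
    -- Along an antidiagonal W telescopes to a difference of two values of U, hence stays below 2M,
    -- while the sum of the lower bounds grows with n.
    have hsum : ∑ i ∈ Finset.range (n + 1), W (k + i, l + (n - i)) =
        U (k + (n + 1)) l - U k (l + (n + 1)) := by
      have := Finset.sum_range_sub (fun i => U (k + i) (l + (n + 1 - i))) (n + 1)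
      simp only [add_zero, Nat.sub_zero, Nat.sub_self] at this
      rw [← this]
      refine Finset.sum_congr rfl fun i hi => ?_
      have hi' : i ≤ n := Nat.lt_succ_iff.1 (Finset.mem_range.1 hi)
      simp only [hW]
      rw [show l + (n - i) + 1 = l + (n + 1 - i) by omega,
        show l + (n - i) = l + (n + 1 - (i + 1)) by omega, add_assoc]
    have hlow : ∑ _i ∈ Finset.range (n + 1), S / 2 ≤
        ∑ i ∈ Finset.range (n + 1), W (k + i, l + (n - i)) := by
      refine Finset.sum_le_sum fun i hi => ?_
      have hi' : i ≤ n := Nat.lt_succ_iff.1 (Finset.mem_range.1 hi)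
      refine le_trans (le_of_eq ?_) (hdef i (n - i))
      rw [show i + (n - i) = n by omega, pow_succ]
      field_simp
      ring
    rw [hsum, Finset.sum_const, Finset.card_range, nsmul_eq_mul] at hlow
    have h1 := (abs_le.1 (hM (k + (n + 1)) l)).2
    have h2 := (abs_le.1 (hM k (l + (n + 1)))).1
    push_cast at hlow
    linarith
  obtain ⟨n, hn⟩ := exists_nat_gt (2 * M / (S / 2))
  rw [div_lt_iff₀ (by positivity)] at hn
  linarith [key n]

lemma eq_of_bounded_mean {U : ℕ → ℕ → ℝ} {M : ℝ} (hM : ∀ k l, |U k l| ≤ M)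
    (hU : ∀ k l, U k l = (U (k + 1) l + U k (l + 1)) / 2) : U 1 0 = U 0 1 := by
  refine le_antisymm (succ_le_of_bounded_mean hM hU) ?_
  have := succ_le_of_bounded_mean (U := fun k l => -U k l) (M := M)
    (fun k l => by simpa using hM k l) (fun k l => by rw [hU k l]; ring)
  simpa using this

/-! ### Minimal functions, the differential, and gluing. -/

namespace InterpolationPair

open Complex Filter Topology ComplexConjugate Strip

variable {E : Type u} [NormedAddCommGroup E] [NormedSpace ℂ E] {P : InterpolationPair E}
  {θ : Ioo (0 : ℝ) 1}

lemma HInftyFun.norm_nonneg (F : P.HInftyFun) : 0 ≤ F.norm :=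
  (_root_.norm_nonneg F.bd₀).trans (le_max_left _ _)

/-- The functional of the boundary values whose multiple is the derivative at `θ`. -/
abbrev HInftyFun.slope (θ : Ioo (0 : ℝ) 1) (F : P.HInftyFun) : E := pair θ F.data (star chi)

lemma HInftyFun.deriv_center [CompleteSpace E] (F : P.HInftyFun) :
    deriv F.toFun (θ : ℝ) = deriv (toDisc θ) (θ : ℝ) • F.slope θ := (F.hasDerivAt_center θ).deriv

lemma HInftyFun.slope_congr [CompleteSpace E] {F F' : P.HInftyFun}
    (h : EqOn F.toFun F'.toFun openStrip) : F.slope θ = F'.slope θ := by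
  have h1 : deriv F.toFun (θ : ℝ) = deriv F'.toFun (θ : ℝ) :=
    (h.eventuallyEq_of_mem (isOpen_openStrip.mem_nhds (mem_openStrip θ))).deriv_eq
  rw [F.deriv_center, F'.deriv_center] at h1
  exact smul_right_injective E (deriv_toDisc_ne_zero θ) h1

lemma differential_eq [CompleteSpace E] (hP : P.HasUniqueMinimal θ) {x : E}
    (hx : x ∈ P.interpSpace θ) {F : P.HInftyFun} (hF : P.IsMinimal θ x F) :
    P.differential θ x = deriv (toDisc θ) (θ : ℝ) • F.slope θ := by
  have h : ∃ F : P.HInftyFun, P.IsMinimal θ x F := ⟨F, hF⟩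
  rw [differential, dif_pos h, HInftyFun.deriv_center,
    HInftyFun.slope_congr ((hP x hx).2 _ _ h.choose_spec hF)]

/-- The reverse inequality is automatic from `interpNorm_toFun_le`, so minimality only asks for an
upper bound on the norm. -/
lemma isMinimal_of_norm_le [CompleteSpace E] {x : E} {F : P.HInftyFun}
    (hx : F.toFun (θ : ℝ) = x) (h : ENNReal.ofReal F.norm ≤ P.interpNorm θ x) :
    P.IsMinimal θ x F := ⟨hx, le_antisymm h (hx ▸ interpNorm_toFun_le θ F)⟩

variable (P θ) in
/-- The differential, normalized to be `F.slope θ` at the minimal function `F`. -/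
def normDifferential (x : E) : E := (deriv (toDisc θ) (θ : ℝ))⁻¹ • P.differential θ x

lemma normDifferential_eq [CompleteSpace E] (hP : P.HasUniqueMinimal θ) {x : E}
    (hx : x ∈ P.interpSpace θ) {F : P.HInftyFun} (hF : P.IsMinimal θ x F) :
    P.normDifferential θ x = F.slope θ := by
  rw [normDifferential, differential_eq hP hx hF, inv_smul_smul₀ (deriv_toDisc_ne_zero θ)]

lemma exists_minimal [CompleteSpace E] (hP : P.HasUniqueMinimal θ) {x : E}
    (hx : x ∈ P.interpSpace θ) : ∃ F : P.HInftyFun, F.toFun (θ : ℝ) = x ∧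
      F.norm = (P.interpNorm θ x).toReal ∧ F.slope θ = P.normDifferential θ x := by
  obtain ⟨F, hF⟩ := (hP x hx).1
  exact ⟨F, hF.1, by rw [← hF.2, ENNReal.toReal_ofReal F.norm_nonneg],
    (normDifferential_eq hP hx hF).symm⟩

lemma norm_slope_le (F : P.HInftyFun) : ‖F.slope θ‖ ≤ P.embNorm * F.norm := by
  refine (norm_pair_le' θ F.data (star chi)).trans (le_of_eq ?_)
  rw [norm_star_chi, mul_one, HInftyFun.norm_data]

/-- A priori control of the nonlinear differential: it tends to 0 in `E` as the X_θ norm of its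
argument tends to 0. -/
lemma norm_normDifferential_le [CompleteSpace E] (hP : P.HasUniqueMinimal θ) {x : E}
    (hx : x ∈ P.interpSpace θ) :
    ‖P.normDifferential θ x‖ ≤ P.embNorm * (P.interpNorm θ x).toReal := by
  obtain ⟨F, -, h1, h2⟩ := exists_minimal hP hx
  rw [← h1, ← h2]
  exact norm_slope_le F

/-- A sum of two functions in `𝓕^∞`, weighted by constants. -/
lemma HInftyFun.exists_combination [CompleteSpace E] (F F' : P.HInftyFun) (c c' : ℂ) :
    ∃ K : P.HInftyFun, K.norm ≤ ‖c‖ * F.norm + ‖c'‖ * F'.norm ∧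
      K.toFun (θ : ℝ) = c • F.toFun (θ : ℝ) + c' • F'.toFun (θ : ℝ) ∧
      K.slope θ = c • F.slope θ + c' • F'.slope θ := by
  have hp : ∀ m, pair θ (c • F.data + c' • F'.data) m =
      c • pair θ F.data m + c' • pair θ F'.data m := fun m => by
    rw [← pairL_apply, map_add, map_smul, map_smul]; rfl
  refine ⟨HInftyFun.ofData θ (c • F.data + c' • F'.data) fun k hk => ?_, ?_, ?_, ?_⟩
  · rw [hp, F.moments θ k hk, F'.moments θ k hk, smul_zero, smul_zero, add_zero]
  · rw [← HInftyFun.norm_data, HInftyFun.data_ofData, ← F.norm_data, ← F'.norm_data,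
      ← norm_smul, ← norm_smul]
    exact norm_add_le _ _
  · rw [HInftyFun.toFun_center, HInftyFun.data_ofData, hp, F.toFun_center, F'.toFun_center]
  · exact hp _

/-- Two functions with the same value at `θ` can be glued with the weights `(1 ± Re b) / 2`. -/
lemma interpNorm_add_slope_sub_le [CompleteSpace E] {F F' : P.HInftyFun} {x : E} {M : ℝ}
    (hM : 0 ≤ M)
    (hF : F.toFun (θ : ℝ) = x) (hF' : F'.toFun (θ : ℝ) = x) (hn : F.norm ≤ M)
    (hn' : F'.norm ≤ M) :
    P.interpNorm θ (x + (1 / 4 : ℂ) • (F.slope θ - F'.slope θ)) ≤ ENNReal.ofReal M := by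
  -- This is (1 + Re b)/2 expanded with Re b = (χ + χ̄)/2, so m and m' are nonnegative with sum 1
  -- and the norm bound M survives.
  set m : C(Circle, ℂ) := (1 / 2 : ℂ) • 1 + (1 / 4 : ℂ) • chi + (1 / 4 : ℂ) • star chi with hm
  set m' : C(Circle, ℂ) := 1 - m with hm'
  set f := mulBdry θ m F.data + mulBdry θ m' F'.data with hf
  have hp : ∀ n, pair θ f n = pair θ F.data (m * n) + pair θ F'.data (m' * n) := fun n => by
    rw [hf, pair_add, _root_.add_apply, pair_mulBdry, pair_mulBdry]
  have e1 : ∀ n, m * n = (1 / 2 : ℂ) • n + (1 / 4 : ℂ) • (chi * n) +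
      (1 / 4 : ℂ) • (star chi * n) := fun n => by
    rw [hm, add_mul, add_mul, smul_mul_assoc, smul_mul_assoc, smul_mul_assoc, one_mul]
  have e2 : ∀ n, m' * n = n - m * n := fun n => by rw [hm', sub_mul, one_mul]
  have hx : pair θ F.data 1 = x := by rw [← F.toFun_center, hF]
  have hx' : pair θ F'.data 1 = x := by rw [← F'.toFun_center, hF']
  -- Only χ̄ lowers the degree of a moment. It turns the first moment into the value at θ, where F
  -- and F' agree, so their contributions cancel.
  have hmom : ∀ k : ℕ, k ≠ 0 → pair θ f (chi ^ k) = 0 := fun k hk => by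
    obtain ⟨j, rfl⟩ := Nat.exists_eq_succ_of_ne_zero hk
    have e3 : star chi * chi ^ (j + 1) = chi ^ j := by
      rw [pow_succ', ← mul_assoc, mul_comm (star chi), chi_mul_star, one_mul]
    have e4 : pair θ F.data (chi ^ j) = pair θ F'.data (chi ^ j) := by
      rcases eq_or_ne j 0 with rfl | hj
      · rw [pow_zero, hx, hx']
      · rw [F.moments θ j hj, F'.moments θ j hj]
    rw [hp, e2, e1, e3, ← pow_succ']
    simp only [map_add, map_sub, map_smul, F.moments θ _ (Nat.succ_ne_zero _),
      F'.moments θ _ (Nat.succ_ne_zero _), e4]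
    simp
  have hval : pair θ f 1 = x + (1 / 4 : ℂ) • (F.slope θ - F'.slope θ) := by
    rw [hp, e2, e1, mul_one, mul_one]
    have h1 := F.moments θ 1 one_ne_zero
    have h2 := F'.moments θ 1 one_ne_zero
    rw [pow_one] at h1 h2
    simp only [map_add, map_sub, map_smul, h1, h2, hx, hx', HInftyFun.slope]
    module
  have hnorm : ‖f‖ ≤ M := by
    refine norm_bdryFun_le hM ?_
    filter_upwards [normAt_add_le (mulBdry θ m F.data) (mulBdry θ m' F'.data),
      normAt_mulBdry θ m F.data, normAt_mulBdry θ m' F'.data, ae_normAt_le F.data,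
      ae_normAt_le F'.data] with y h1 h2 h3 h4 h5
    set b := bdryPt θ y
    have hre : |(b : ℂ).re| ≤ 1 := (abs_re_le_norm _).trans (Circle.norm_coe b).le
    have hmb : m b = ((1 + (b : ℂ).re) / 2 : ℝ) := by
      simp only [hm, ContinuousMap.add_apply, ContinuousMap.smul_apply, ContinuousMap.star_apply,
        ContinuousMap.one_apply, smul_eq_mul, chi_apply]
      apply Complex.ext <;> (simp; try ring)
    have hmb' : m' b = ((1 - (b : ℂ).re) / 2 : ℝ) := by
      rw [hm', ContinuousMap.sub_apply, hmb, ContinuousMap.one_apply]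
      push_cast; ring
    rw [abs_le] at hre
    rw [h2, h3, hmb, hmb', norm_real, norm_real, Real.norm_of_nonneg (by linarith),
      Real.norm_of_nonneg (by linarith)] at h1
    refine h1.trans ?_
    have h6 := mul_le_mul_of_nonneg_left (h4.trans (F.norm_data.trans_le hn))
      (show 0 ≤ (1 + (b : ℂ).re) / 2 by linarith)
    have h7 := mul_le_mul_of_nonneg_left (h5.trans (F'.norm_data.trans_le hn'))
      (show 0 ≤ (1 - (b : ℂ).re) / 2 by linarith)
    linarith
  have h := interpNorm_toFun_le θ (HInftyFun.ofData θ f hmom)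
  rw [HInftyFun.toFun_center, HInftyFun.data_ofData, hval] at h
  exact h.trans (ENNReal.ofReal_le_ofReal hnorm)

end InterpolationPair

/-! ### Equivariance extends from a dense subspace. -/

namespace InterpolationPair

open Complex Filter Topology ComplexConjugate Strip

variable {E : Type u} [NormedAddCommGroup E] [NormedSpace ℂ E] {P : InterpolationPair E}
  {θ : Ioo (0 : ℝ) 1}

lemma interpNorm_sub_le [CompleteSpace E] (t : ℝ) (x y : E) :
    P.interpNorm t (x - y) ≤ P.interpNorm t x + P.interpNorm t y := by
  rw [sub_eq_add_neg, ← interpNorm_neg t y]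
  exact interpNorm_add_le t x (-y)

lemma interpNorm_half_add_le [CompleteSpace E] {t : ℝ} {x y : E} {M : ℝ≥0∞}
    (hx : P.interpNorm t x ≤ M) (hy : P.interpNorm t y ≤ M) :
    P.interpNorm t ((1 / 2 : ℂ) • (x + y)) ≤ M := by
  have h : ENNReal.ofReal ‖(1 / 2 : ℂ)‖ = 2⁻¹ := by
    rw [show ‖(1 / 2 : ℂ)‖ = 2⁻¹ by norm_num, ENNReal.ofReal_inv_of_pos two_pos]
    norm_num
  refine (interpNorm_smul_le _ _ _).trans ?_
  rw [h]
  calc (2 : ℝ≥0∞)⁻¹ * P.interpNorm t (x + y) ≤ 2⁻¹ * (M + M) := by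
        gcongr; exact (interpNorm_add_le _ _ _).trans (add_le_add hx hy)
    _ = M := by rw [← two_mul, ← mul_assoc, ENNReal.inv_mul_cancel] <;> norm_num

/-- The normalized differential is almost additive with respect to small perturbations. -/
lemma interpNorm_add_defect_le [CompleteSpace E] (hP : P.HasUniqueMinimal θ) {x y : E}
    (hy : y ∈ P.interpSpace θ) (he : x - y ∈ P.interpSpace θ) :
    P.interpNorm θ (x + (1 / 4 : ℂ) • (P.normDifferential θ x -
      (P.normDifferential θ y + P.normDifferential θ (x - y)))) ≤
        P.interpNorm θ x + 2 * P.interpNorm θ (x - y) ∧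
    P.interpNorm θ (x + (1 / 4 : ℂ) • ((P.normDifferential θ y +
      P.normDifferential θ (x - y)) - P.normDifferential θ x)) ≤
        P.interpNorm θ x + 2 * P.interpNorm θ (x - y) := by
  have hx : x ∈ P.interpSpace θ := by
    have h := interpNorm_add_le (P := P) θ y (x - y)
    rw [add_sub_cancel] at h
    exact h.trans_lt (ENNReal.add_lt_top.2 ⟨hy, he⟩)
  obtain ⟨F, hF1, hF2, hF3⟩ := exists_minimal hP hx
  obtain ⟨G, hG1, hG2, hG3⟩ := exists_minimal hP hy
  obtain ⟨H, hH1, hH2, hH3⟩ := exists_minimal hP he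
  -- The sum of the minimal functions for y and x - y is a competitor for x. Its norm is at most ‖x‖
  -- + 2‖x - y‖ because ‖y‖ ≤ ‖x‖ + ‖x - y‖.
  obtain ⟨K, hK1, hK2, hK3⟩ := G.exists_combination (θ := θ) H 1 1
  have hyx : (P.interpNorm θ y).toReal ≤
      (P.interpNorm θ x).toReal + (P.interpNorm θ (x - y)).toReal := by
    rw [← ENNReal.toReal_add hx.ne he.ne]
    refine ENNReal.toReal_mono (ENNReal.add_ne_top.2 ⟨hx.ne, he.ne⟩) ?_
    simpa using interpNorm_sub_le (P := P) θ x (x - y)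
  set M := (P.interpNorm θ x).toReal + 2 * (P.interpNorm θ (x - y)).toReal with hM
  have h0 : 0 ≤ (P.interpNorm θ (x - y)).toReal := ENNReal.toReal_nonneg
  have h0' : 0 ≤ (P.interpNorm θ x).toReal := ENNReal.toReal_nonneg
  have hM0 : 0 ≤ M := by positivity
  have hMM : ENNReal.ofReal M = P.interpNorm θ x + 2 * P.interpNorm θ (x - y) := by
    rw [hM, ENNReal.ofReal_add h0' (by positivity), ENNReal.ofReal_mul two_pos.le,
      ENNReal.ofReal_toReal hx.ne, ENNReal.ofReal_toReal he.ne, ENNReal.ofReal_ofNat]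
  have hFM : F.norm ≤ M := by rw [hF2]; linarith
  have hKM : K.norm ≤ M := by
    refine hK1.trans ?_
    rw [norm_one, one_mul, one_mul, hG2, hH2]
    linarith
  have hKx : K.toFun (θ : ℝ) = x := by
    rw [hK2, one_smul, one_smul, hG1, hH1, add_sub_cancel]
  rw [one_smul, one_smul, hG3, hH3] at hK3
  rw [← hMM, ← hF3, ← hK3]
  exact ⟨interpNorm_add_slope_sub_le hM0 hF1 hKx hFM hKM,
    interpNorm_add_slope_sub_le hM0 hKx hF1 hKM hFM⟩

/-- The remainders of better and better approximations of x from D. Consecutive remainders differ by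
elements of D, so a hypothesis about subtracting elements of D applies at every step; taking 0 as
the first approximation makes the sequence start at x. -/
lemma exists_dense_seq {D : Submodule ℂ E} {N : E → ℝ≥0∞}
    (hD : ∀ x, N x < ∞ → ∀ η > (0 : ℝ), ∃ y ∈ D, N (x - y) ≤ ENNReal.ofReal η) {x : E} {r : ℝ}
    (hr : 0 < r) (hx : N x ≤ ENNReal.ofReal r) : ∃ e : ℕ → E, e 0 = x ∧
      (∀ i, N (e i) ≤ ENNReal.ofReal (r * (1 / 2) ^ i)) ∧ ∀ i, e i - e (i + 1) ∈ D := by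
  have h : ∀ i : ℕ, ∃ y ∈ D, N (x - y) ≤ ENNReal.ofReal (r * (1 / 2) ^ i) ∧ (i = 0 → y = 0) := by
    intro i
    rcases eq_or_ne i 0 with rfl | hi
    · exact ⟨0, D.zero_mem, by simpa using hx, fun _ => rfl⟩
    · obtain ⟨y, hy, hy'⟩ := hD x (hx.trans_lt ENNReal.ofReal_lt_top) (r * (1 / 2) ^ i)
        (by positivity)
      exact ⟨y, hy, hy', fun h => absurd h hi⟩
  choose y hy hy' hy0 using h
  refine ⟨fun i => x - y i, by simp [hy0 0 rfl], hy', fun i => ?_⟩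
  simpa using D.sub_mem (hy (i + 1)) (hy i)

/-- Telescoping along remainders e i → 0 of size r 2^{-i}: each increment of Δ has norm at most 8 ·
3r 2^{-i}, with sum 48r. The bound hC makes Δ(e i) → 0 in `E`, which identifies the limit as Δ x and
so places it in X_θ. -/
lemma interpNorm_defect_le [CompleteSpace E]
    {D : Submodule ℂ E} {Δ : E → E} {C : ℝ}
    (hD : ∀ x, P.interpNorm θ x < ∞ → ∀ η > (0 : ℝ), ∃ y ∈ D,
      P.interpNorm θ (x - y) ≤ ENNReal.ofReal η)
    (hC : ∀ x, P.interpNorm θ x < ∞ → ‖Δ x‖ ≤ C * (P.interpNorm θ x).toReal)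
    (hΔ : ∀ x, P.interpNorm θ x < ∞ → ∀ y ∈ D, P.interpNorm θ (x - y) < ∞ →
      P.interpNorm θ (x + (1 / 8 : ℂ) • (Δ x - Δ (x - y))) ≤
        P.interpNorm θ x + 2 * P.interpNorm θ (x - y))
    {x : E} {r : ℝ} (hr : 0 < r)
    (hx : P.interpNorm θ x ≤ ENNReal.ofReal r) :
    P.interpNorm θ (Δ x) ≤ ENNReal.ofReal (48 * r) := by
  obtain ⟨e, he0, he, heD⟩ := exists_dense_seq hD hr hx
  have hfin : ∀ i, P.interpNorm θ (e i) < ∞ := fun i => (he i).trans_lt ENNReal.ofReal_lt_top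
  have hgeo : Tendsto (fun i : ℕ => r * (1 / 2 : ℝ) ^ i) atTop (𝓝 0) := by
    simpa using (tendsto_pow_atTop_nhds_zero_of_lt_one (r := (1 / 2 : ℝ)) (by norm_num)
      (by norm_num)).const_mul r
  have hlim : Tendsto (fun i => Δ (e i)) atTop (𝓝 0) := by
    refine squeeze_zero_norm (a := fun i => |C| * (r * (1 / 2 : ℝ) ^ i)) (fun i => ?_)
      (by simpa using hgeo.const_mul |C|)
    refine (hC _ (hfin i)).trans ((mul_le_mul_of_nonneg_right (le_abs_self C)
      ENNReal.toReal_nonneg).trans (mul_le_mul_of_nonneg_left ?_ (abs_nonneg C)))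
    exact ENNReal.toReal_le_of_le_ofReal (by positivity) (he i)
  have hstep : ∀ i, P.interpNorm θ ((Δ x - Δ (e (i + 1))) - (Δ x - Δ (e i))) ≤
      ENNReal.ofReal (24 * r * (1 / 2) ^ i) := fun i => by
    have h1 := hΔ (e i) (hfin i) _ (heD i) (by simpa using hfin (i + 1))
    rw [sub_sub_cancel] at h1
    have h2 : (Δ x - Δ (e (i + 1))) - (Δ x - Δ (e i)) =
        (8 : ℂ) • ((e i + (1 / 8 : ℂ) • (Δ (e i) - Δ (e (i + 1)))) - e i) := by module
    rw [h2]
    refine (interpNorm_smul_le _ _ _).trans ?_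
    have hp : 0 ≤ r * (1 / 2) ^ i := by positivity
    have h3 : P.interpNorm θ ((e i + (1 / 8 : ℂ) • (Δ (e i) - Δ (e (i + 1)))) - e i) ≤
        ENNReal.ofReal (3 * (r * (1 / 2) ^ i)) := by
      refine (interpNorm_sub_le _ _ _).trans ((add_le_add h1 le_rfl).trans ?_)
      calc _ ≤ (ENNReal.ofReal (r * (1 / 2) ^ i) + 2 * ENNReal.ofReal (r * (1 / 2) ^ (i + 1))) +
            ENNReal.ofReal (r * (1 / 2) ^ i) := by
            gcongr
            exacts [he i, he (i + 1), he i]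
        _ = ENNReal.ofReal (3 * (r * (1 / 2) ^ i)) := by
            rw [← ENNReal.ofReal_ofNat 2, ← ENNReal.ofReal_mul (by norm_num),
              ← ENNReal.ofReal_add hp (by positivity), ← ENNReal.ofReal_add (by positivity) hp]
            congr 1; ring
    refine (mul_le_mul_right h3 _).trans (le_of_eq ?_)
    rw [← ENNReal.ofReal_mul (norm_nonneg _)]
    congr 1; norm_num; ring
  have hs := summable_geometric_two.mul_left (24 * r)
  have h := interpNorm_le_of_tendsto θ (x := Δ x) (y := fun i => Δ x - Δ (e i)) (a := 0)
    (b := fun i => 24 * r * (1 / 2) ^ i) (by simpa using tendsto_const_nhds.sub hlim) le_rfl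
    (by simp [he0, interpNorm_zero]) (fun i => by positivity) hs hstep
  refine h.trans (le_of_eq ?_)
  rw [tsum_mul_left, tsum_geometric_two]
  congr 1; ring

/-- With y ∈ D close to x, the correction Δ(x - y) is small in X_θ by `interpNorm_defect_le` and can
be dropped in the limit. -/
lemma interpNorm_add_smul_defect_le [CompleteSpace E]
    {D : Submodule ℂ E} {Δ : E → E} {C : ℝ}
    (hD : ∀ x, P.interpNorm θ x < ∞ → ∀ η > (0 : ℝ), ∃ y ∈ D,
      P.interpNorm θ (x - y) ≤ ENNReal.ofReal η)
    (hC : ∀ x, P.interpNorm θ x < ∞ → ‖Δ x‖ ≤ C * (P.interpNorm θ x).toReal)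
    (hΔ : ∀ x, P.interpNorm θ x < ∞ → ∀ y ∈ D, P.interpNorm θ (x - y) < ∞ →
      P.interpNorm θ (x + (1 / 8 : ℂ) • (Δ x - Δ (x - y))) ≤
        P.interpNorm θ x + 2 * P.interpNorm θ (x - y))
    {x : E} (hx : P.interpNorm θ x < ∞) :
    P.interpNorm θ (x + (1 / 8 : ℂ) • Δ x) ≤ P.interpNorm θ x := by
  refine ENNReal.le_of_forall_pos_le_add fun ε hε _ => ?_
  -- The total error is 2η + 48η/8 = 8η, which is below ε.
  set η : ℝ := ε / 50 with hη
  have hη0 : 0 < η := by positivity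
  obtain ⟨y, hy, hxy⟩ := hD x hx η hη0
  have h1 := hΔ x hx y hy (hxy.trans_lt ENNReal.ofReal_lt_top)
  have h2 := interpNorm_defect_le hD hC hΔ hη0 hxy
  have h3 : x + (1 / 8 : ℂ) • Δ x =
      (x + (1 / 8 : ℂ) • (Δ x - Δ (x - y))) + (1 / 8 : ℂ) • Δ (x - y) := by module
  rw [h3]
  calc _ ≤ (P.interpNorm θ x + 2 * ENNReal.ofReal η) +
        ENNReal.ofReal ‖(1 / 8 : ℂ)‖ * ENNReal.ofReal (48 * η) := by
        refine (interpNorm_add_le _ _ _).trans (add_le_add (h1.trans ?_)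
          ((interpNorm_smul_le _ _ _).trans ?_)) <;> gcongr
    _ ≤ P.interpNorm θ x + ε := by
        rw [add_assoc]
        gcongr
        rw [← ENNReal.ofReal_ofNat 2, ← ENNReal.ofReal_mul (by norm_num),
          ← ENNReal.ofReal_mul (norm_nonneg _), ← ENNReal.ofReal_add (by positivity)
          (by positivity), ← ENNReal.ofReal_coe_nnreal]
        refine ENNReal.ofReal_le_ofReal ?_
        rw [show ‖(1 / 8 : ℂ)‖ = 1 / 8 by norm_num, hη]
        have : (0 : ℝ) < ε := hε
        linarith

/-- A bounded defect that is affine on midpoints vanishes. -/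
lemma defect_eq_zero {N : E → ℝ≥0∞} {Δ : E → E} {C : ℝ}
    (hC : ∀ x, N x < ∞ → ‖x‖ ≤ C * (N x).toReal)
    (h₁ : ∀ x, N x < ∞ → N (x + (1 / 8 : ℂ) • Δ x) ≤ N x)
    (h₂ : ∀ x, N x < ∞ → N (x - (1 / 8 : ℂ) • Δ x) ≤ N x)
    (hmid : ∀ x u v, N x < ∞ → N u ≤ N x → N v ≤ N x → x = (1 / 2 : ℂ) • (u + v) →
      Δ x = (1 / 2 : ℂ) • (Δ u + Δ v)) {x : E} (hx : N x < ∞) : Δ x = 0 := by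
  set A : E → E := fun x => x + (1 / 8 : ℂ) • Δ x with hA
  set B : E → E := fun x => x - (1 / 8 : ℂ) • Δ x with hB
  -- z is the midpoint of A z and B z, which have no larger norm; hence Δ(A z) + Δ(B z) = 2Δ z,
  -- which is exactly the commutation of A and B at z.
  have hAB : ∀ z, N z < ∞ → A (B z) = B (A z) := fun z hz => by
    have h := hmid z (A z) (B z) hz (h₁ z hz) (h₂ z hz) (by simp only [hA, hB]; module)
    have h' : Δ (A z) = (2 : ℂ) • Δ z - Δ (B z) := by rw [h]; module
    change B z + (1 / 8 : ℂ) • Δ (B z) = A z - (1 / 8 : ℂ) • Δ (A z)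
    rw [h']
    simp only [hA, hB]; module
  have hAk : ∀ k z, N z < ∞ → N (A^[k] z) ≤ N z := fun k z hz => by
    induction k with
    | zero => exact le_rfl
    | succ k ih =>
      rw [Function.iterate_succ_apply']
      exact (h₁ _ (ih.trans_lt hz)).trans ih
  have hBk : ∀ k z, N z < ∞ → N (B^[k] z) ≤ N z := fun k z hz => by
    induction k with
    | zero => exact le_rfl
    | succ k ih =>
      rw [Function.iterate_succ_apply']
      exact (h₂ _ (ih.trans_lt hz)).trans ih
  have hcomm : ∀ k z, N z < ∞ → A^[k] (B z) = B (A^[k] z) := fun k z hz => by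
    induction k with
    | zero => rfl
    | succ k ih =>
      rw [Function.iterate_succ_apply', Function.iterate_succ_apply', ih,
        hAB _ ((hAk k z hz).trans_lt hz)]
  -- Each entry is the midpoint of its images under A and B, and the entries stay bounded. A norming
  -- functional of u 1 0 - u 0 1 reduces the claim to the real Liouville statement.
  set u : ℕ → ℕ → E := fun k l => A^[k] (B^[l] x) with hu
  have hub : ∀ k l, ‖u k l‖ ≤ |C| * (N x).toReal := fun k l => by
    have h3 := hBk l x hx
    have h4 := (hAk k _ (h3.trans_lt hx)).trans h3
    refine (hC _ (h4.trans_lt hx)).trans (mul_le_mul (le_abs_self C)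
      (ENNReal.toReal_mono hx.ne h4) ENNReal.toReal_nonneg (abs_nonneg C))
  have hmean : ∀ k l, u k l = (1 / 2 : ℂ) • (u (k + 1) l + u k (l + 1)) := fun k l => by
    have h3 : u (k + 1) l = A (u k l) := Function.iterate_succ_apply' A k _
    have h4 : u k (l + 1) = B (u k l) := by
      rw [← hcomm k _ ((hBk l x hx).trans_lt hx), ← Function.iterate_succ_apply' B]
    rw [h3, h4]
    simp only [hA, hB]; module
  have hd : u 1 0 - u 0 1 = (1 / 4 : ℂ) • Δ x := by
    simp only [hu, Function.iterate_one, Function.iterate_zero, id, hA, hB]; module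
  by_contra hne
  obtain ⟨f, hf1, hf2⟩ := exists_dual_vector ℂ (u 1 0 - u 0 1) (by
    rw [hd]; exact norm_ne_zero_iff.2 (smul_ne_zero (by norm_num) hne))
  have h := eq_of_bounded_mean (U := fun k l => (f (u k l)).re) (M := |C| * (N x).toReal)
    (fun k l => (abs_re_le_norm _).trans ((f.le_opNorm _).trans (by
      rw [hf1, one_mul]; exact hub k l)))
    (fun k l => by
      conv_lhs => rw [hmean k l]
      rw [map_smul, map_add]
      simp
      ring)
  have h5 := congrArg re hf2
  rw [map_sub, sub_re, h, sub_self] at h5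
  have h6 : (0 : ℝ) = ‖u 1 0 - u 0 1‖ := by simpa using h5
  rw [hd, eq_comm, norm_eq_zero] at h6
  exact hne ((smul_eq_zero.1 h6).resolve_left (by norm_num))

/-- The average of minimal functions for u and v has norm at most ‖x‖_θ and value x, so it is the
minimal function for x; slopes are linear in the function. -/
lemma normDifferential_mid [CompleteSpace E] (hP : P.HasUniqueMinimal θ) {x u v : E}
    (hx : P.interpNorm θ x < ∞) (hu : P.interpNorm θ u ≤ P.interpNorm θ x)
    (hv : P.interpNorm θ v ≤ P.interpNorm θ x) (h : x = (1 / 2 : ℂ) • (u + v)) :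
    P.normDifferential θ x =
      (1 / 2 : ℂ) • (P.normDifferential θ u + P.normDifferential θ v) := by
  obtain ⟨F, hF1, hF2, hF3⟩ := exists_minimal hP (hu.trans_lt hx)
  obtain ⟨G, hG1, hG2, hG3⟩ := exists_minimal hP (hv.trans_lt hx)
  obtain ⟨K, hK1, hK2, hK3⟩ := F.exists_combination (θ := θ) G (1 / 2) (1 / 2)
  have hK : P.IsMinimal θ x K := by
    refine isMinimal_of_norm_le (by rw [hK2, hF1, hG1, h, smul_add]) ?_
    refine ENNReal.ofReal_le_of_le_toReal (hK1.trans ?_)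
    have h1 := ENNReal.toReal_mono hx.ne hu
    have h2 := ENNReal.toReal_mono hx.ne hv
    rw [hF2, hG2, show ‖(1 / 2 : ℂ)‖ = 1 / 2 by norm_num]
    linarith
  rw [normDifferential_eq hP hx hK, hK3, hF3, hG3, smul_add]

variable {G : Type*} [Group G] {ρ : G →* (E ≃L[ℂ] E)}

lemma isEquivariantOn_iff {D : Set E} : P.IsEquivariantOn ρ θ D ↔
    ∀ g, ∀ x ∈ D, ρ g (P.normDifferential θ x) = P.normDifferential θ (ρ g x) := by
  refine forall₃_congr fun g x _ => ?_
  rw [normDifferential, normDifferential, map_smul]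
  exact (smul_right_injective E (inv_ne_zero (deriv_toDisc_ne_zero θ))).eq_iff.symm

lemma map_map_inv (g : G) (x : E) : ρ g (ρ g⁻¹ x) = x := by
  rw [show ∀ (A B : E ≃L[ℂ] E) (v : E), A (B v) = (A * B) v from fun _ _ _ => rfl,
    ← map_mul, mul_inv_cancel, map_one]; rfl

lemma map_inv_map (g : G) (x : E) : ρ g⁻¹ (ρ g x) = x := by
  rw [show ∀ (A B : E ≃L[ℂ] E) (v : E), A (B v) = (A * B) v from fun _ _ _ => rfl,
    ← map_mul, inv_mul_cancel, map_one]; rfl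

/-- Equivariance of the differential extends from a dense invariant subspace. -/
theorem IsEquivariantOn.of_dense [CompleteSpace E] (hP : P.HasUniqueMinimal θ)
    (hρ : P.ActsIsometricallyOn ρ θ) {D : Submodule ℂ E} (hD : P.IsDenseInInter D)
    (hG : ∀ g : G, ∀ x ∈ D, ρ g x ∈ D) (h : P.IsEquivariantOn ρ θ (D : Set E)) :
    P.IsEquivariantOn ρ θ (P.interpSpace θ) := by
  rw [isEquivariantOn_iff] at h ⊢
  intro g
  set a := P.normDifferential θ with ha
  -- The failure of equivariance. It vanishes on D because D is invariant under the inverse of g.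
  set Δ : E → E := fun x => a x - ρ g (a (ρ g⁻¹ x)) with hΔ
  have hD' : ∀ x, P.interpNorm θ x < ∞ → ∀ η > (0 : ℝ), ∃ y ∈ D,
      P.interpNorm θ (x - y) ≤ ENNReal.ofReal η := fun x hx η hη => by
    obtain ⟨F, hF, -⟩ := exists_minimal hP hx
    rw [← hF]
    exact hD.exists_close θ F hη
  have hinv : ∀ x, P.interpNorm θ (ρ g⁻¹ x) = P.interpNorm θ x := hρ g⁻¹
  set C : ℝ := P.embNorm + ‖(ρ g : E →L[ℂ] E)‖ * P.embNorm with hCdef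
  have hC : ∀ x, P.interpNorm θ x < ∞ → ‖Δ x‖ ≤ C * (P.interpNorm θ x).toReal := fun x hx => by
    refine (norm_sub_le _ _).trans ?_
    rw [hCdef, add_mul, mul_assoc]
    refine add_le_add (norm_normDifferential_le hP hx)
      (((ρ g : E →L[ℂ] E).le_opNorm _).trans (mul_le_mul_of_nonneg_left ?_ (norm_nonneg _)))
    rw [← hinv x]
    exact norm_normDifferential_le hP (by rw [interpSpace, mem_ofPred_eq, hinv]; exact hx)
  have hΔD : ∀ y ∈ D, Δ y = 0 := fun y hy => by
    rw [hΔ]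
    simp only
    rw [h g _ (hG g⁻¹ y hy), map_map_inv, sub_self]
  have hDfin : ∀ y ∈ D, P.interpNorm θ y < ∞ := fun y hy => hD.subset θ hy
  have hboth : ∀ x, P.interpNorm θ x < ∞ → ∀ y ∈ D, P.interpNorm θ (x - y) < ∞ →
      P.interpNorm θ (x + (1 / 8 : ℂ) • (Δ x - Δ (x - y))) ≤
        P.interpNorm θ x + 2 * P.interpNorm θ (x - y) ∧
      P.interpNorm θ (x + (1 / 8 : ℂ) • (-Δ x - -Δ (x - y))) ≤
        P.interpNorm θ x + 2 * P.interpNorm θ (x - y) := by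
    intro x hx y hy hxy
    obtain ⟨h1, h2⟩ := interpNorm_add_defect_le hP (hDfin y hy) hxy
    have hsub : ρ g⁻¹ (x - y) = ρ g⁻¹ x - ρ g⁻¹ y := map_sub _ _ _
    obtain ⟨h3, h4⟩ := interpNorm_add_defect_le hP (x := ρ g⁻¹ x) (y := ρ g⁻¹ y)
      (hDfin _ (hG _ _ hy)) (by rw [← hsub, interpSpace, mem_ofPred_eq, hinv]; exact hxy)
    rw [← hsub, hinv, hinv, ← hρ g] at h3 h4
    have hy0 := hΔD y hy
    simp only [hΔ, sub_eq_zero] at hy0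
    simp only [map_add, map_smul, map_sub, map_map_inv] at h3 h4
    simp only [← ha] at h1 h2 h3 h4
    rw [← hy0] at h3 h4
    -- The estimate at x is averaged with the one of opposite sign at g⁻¹x, transported back by the
    -- isometry g. The coefficient 1/4 becomes 1/8, and the terms at y cancel since Δ y = 0.
    constructor
    · convert interpNorm_half_add_le h1 h4 using 2
      simp only [hΔ, map_sub]
      module
    · convert interpNorm_half_add_le h2 h3 using 2
      simp only [hΔ, map_sub]
      module
  have hzero : ∀ x, P.interpNorm θ x < ∞ → Δ x = 0 := fun x hx => by
    refine defect_eq_zero (N := P.interpNorm θ) (Δ := Δ) (C := P.embNorm) (fun z hz => ?_)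
      (fun z hz => ?_) (fun z hz => ?_) (fun z u v hz hu hv hzuv => ?_) hx
    · have := norm_le_of_interpNorm_le θ (ENNReal.ofReal_toReal hz.ne).ge
      rwa [max_eq_left ENNReal.toReal_nonneg] at this
    · exact interpNorm_add_smul_defect_le hD' hC
        (fun x hx y hy hxy => (hboth x hx y hy hxy).1) hz
    · have := interpNorm_add_smul_defect_le (Δ := fun x => -Δ x) hD'
        (fun x hx => by rw [norm_neg]; exact hC x hx)
        (fun x hx y hy hxy => (hboth x hx y hy hxy).2) hz
      rwa [smul_neg, ← sub_eq_add_neg] at this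
    · have e1 := normDifferential_mid hP hz hu hv hzuv
      have e2 := normDifferential_mid hP (x := ρ g⁻¹ z) (u := ρ g⁻¹ u) (v := ρ g⁻¹ v)
        (by rwa [hinv]) (by rwa [hinv, hinv]) (by rwa [hinv, hinv])
        (by rw [hzuv, map_smul, map_add])
      simp only [hΔ, ha]
      rw [e1, e2, map_smul, map_add]
      module
  intro x hx
  have h1 := hzero (ρ g x) (by rw [hρ g]; exact hx)
  simp only [hΔ, map_inv_map, sub_eq_zero] at h1
  exact h1.symm

end InterpolationPair

/-! ### Transport of a pair by an automorphism; equivariance implies isometry. -/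

namespace InterpolationPair

open Complex Filter Topology ComplexConjugate Strip

variable {E : Type u} [NormedAddCommGroup E] [NormedSpace ℂ E] {P : InterpolationPair E}

variable (P) in
/-- The image of an interpolation pair under an automorphism of the ambient space. -/
@[reducible] def map (e : E ≃L[ℂ] E) : InterpolationPair E where
  X₀ := P.X₀
  X₁ := P.X₁
  emb₀ := (e : E →L[ℂ] E).comp P.emb₀
  emb₁ := (e : E →L[ℂ] E).comp P.emb₁
  emb₀_injective := e.injective.comp P.emb₀_injective
  emb₁_injective := e.injective.comp P.emb₁_injective

lemma bounded_comp (e : E ≃L[ℂ] E) {f : ℂ → E} (h : ∃ C : ℝ, ∀ z ∈ closedStrip, ‖f z‖ ≤ C) :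
    ∃ C : ℝ, ∀ z ∈ closedStrip, ‖e (f z)‖ ≤ C := by
  obtain ⟨C, hC⟩ := h
  exact ⟨‖(e : E →L[ℂ] E)‖ * C, fun z hz => ((e : E →L[ℂ] E).le_opNorm _).trans
    (mul_le_mul_of_nonneg_left (hC z hz) (norm_nonneg _))⟩

/-- Transport of a function in the Calderón space to the image pair. -/
def CalderonFun.map (e : E ≃L[ℂ] E) (F : P.CalderonFun) : (P.map e).CalderonFun where
  toFun z := e (F.toFun z)
  continuousOn := e.continuous.comp_continuousOn F.continuousOn
  bounded := bounded_comp e F.bounded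
  analytic := (e : E →L[ℂ] E).differentiable.comp_differentiableOn F.analytic
  bd₀ := F.bd₀
  bd₁ := F.bd₁
  eq_bd₀ t := congrArg e (F.eq_bd₀ t)
  eq_bd₁ t := congrArg e (F.eq_bd₁ t)

/-- Transport of a function in the Calderón space of the image pair to the original pair. -/
def CalderonFun.comap (e : E ≃L[ℂ] E) (F : (P.map e).CalderonFun) : P.CalderonFun where
  toFun z := e.symm (F.toFun z)
  continuousOn := e.symm.continuous.comp_continuousOn F.continuousOn
  bounded := bounded_comp e.symm F.bounded
  analytic := (e.symm : E →L[ℂ] E).differentiable.comp_differentiableOn F.analytic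
  bd₀ := F.bd₀
  bd₁ := F.bd₁
  eq_bd₀ t := by rw [F.eq_bd₀ t]; exact e.symm_apply_apply _
  eq_bd₁ t := by rw [F.eq_bd₁ t]; exact e.symm_apply_apply _

lemma interpNorm_map (e : E ≃L[ℂ] E) (t : ℝ) (x : E) :
    (P.map e).interpNorm t x = P.interpNorm t (e.symm x) := by
  apply le_antisymm
  · refine le_iInf₂ fun F hF => ?_
    exact (interpNorm_le (F.map e) t).trans_eq' (by
      rw [show (F.map e).toFun t = e (F.toFun t) from rfl, hF, e.apply_symm_apply])
  · refine le_iInf₂ fun F hF => ?_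
    exact (interpNorm_le (F.comap e) t).trans_eq' (by
      rw [show (F.comap e).toFun t = e.symm (F.toFun t) from rfl, hF])

/-- Transport of a function in `𝓕^∞` to the image pair. -/
def HInftyFun.map (e : E ≃L[ℂ] E) (F : P.HInftyFun) : (P.map e).HInftyFun where
  toFun z := e (F.toFun z)
  analytic := (e : E →L[ℂ] E).differentiable.comp_differentiableOn F.analytic
  bd₀ := F.bd₀
  bd₁ := F.bd₁
  eq_poisson z hz := by
    rw [F.eq_poisson z hz, map_add, ← e.integral_comp_comm, ← e.integral_comp_comm]
    simp only [map_smul]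
    rfl

/-- Transport of a function in `𝓕^∞` for the image pair to the original pair. -/
def HInftyFun.comap (e : E ≃L[ℂ] E) (F : (P.map e).HInftyFun) : P.HInftyFun where
  toFun z := e.symm (F.toFun z)
  analytic := (e.symm : E →L[ℂ] E).differentiable.comp_differentiableOn F.analytic
  bd₀ := F.bd₀
  bd₁ := F.bd₁
  eq_poisson z hz := by
    rw [F.eq_poisson z hz, map_add, ← e.symm.integral_comp_comm, ← e.symm.integral_comp_comm]
    simp only [map_smul, ContinuousLinearMap.comp_apply]
    congr 3 <;> ext t <;> congr 1 <;> exact e.symm_apply_apply _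

lemma IsMinimal.map (e : E ≃L[ℂ] E) {t : ℝ} {x : E} {F : P.HInftyFun}
    (h : P.IsMinimal t x F) : (P.map e).IsMinimal t (e x) (F.map e) :=
  ⟨congrArg e h.1, by rw [interpNorm_map, e.symm_apply_apply]; exact h.2⟩

lemma IsMinimal.comap (e : E ≃L[ℂ] E) {t : ℝ} {x : E} {F : (P.map e).HInftyFun}
    (h : (P.map e).IsMinimal t x F) : P.IsMinimal t (e.symm x) (F.comap e) :=
  ⟨congrArg e.symm h.1, by rw [← interpNorm_map]; exact h.2⟩

lemma HasUniqueMinimal.map (e : E ≃L[ℂ] E) {t : ℝ} (h : P.HasUniqueMinimal t) :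
    (P.map e).HasUniqueMinimal t := fun x hx => by
  have hx' : e.symm x ∈ P.interpSpace t := by
    rw [interpSpace, mem_ofPred_eq, ← interpNorm_map]; exact hx
  obtain ⟨⟨F, hF⟩, huniq⟩ := h _ hx'
  refine ⟨⟨F.map e, by simpa using hF.map e⟩, fun F F' hF hF' z hz => ?_⟩
  exact e.symm.injective (huniq _ _ (hF.comap e) (hF'.comap e) hz)

lemma IsRegular.map (e : E ≃L[ℂ] E) (h : P.IsRegular) : (P.map e).IsRegular := by
  refine ⟨h.1.mono ?_, h.2.mono ?_⟩
  · rintro a ⟨b, hb⟩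
    exact ⟨b, congrArg e hb⟩
  · rintro b ⟨a, ha⟩
    exact ⟨a, congrArg e ha⟩

/-- The automorphism carries the minimal function for x to one for e x and commutes with
differentiation. -/
lemma differential_map [CompleteSpace E] (e : E ≃L[ℂ] E) {θ : Ioo (0 : ℝ) 1}
    (h : P.HasUniqueMinimal θ) {x : E} (hx : x ∈ P.interpSpace θ) :
    (P.map e).differential θ (e x) = e (P.differential θ x) := by
  obtain ⟨F, hF⟩ := (h x hx).1
  have hx' : e x ∈ (P.map e).interpSpace θ := by
    rw [interpSpace, mem_ofPred_eq, interpNorm_map, e.symm_apply_apply]; exact hx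
  rw [differential_eq h hx hF, differential_eq (h.map e) hx' (hF.map e),
    ← HInftyFun.deriv_center, ← HInftyFun.deriv_center]
  exact ((e : E →L[ℂ] E).hasFDerivAt.comp_hasDerivAt _ (F.hasDerivAt_center θ)).deriv.trans
    (congrArg e (F.hasDerivAt_center θ).deriv.symm)

variable {G : Type*} [Group G] {ρ : G →* (E ≃L[ℂ] E)}

/-- For a rigid pair, equivariance of the differential forces isometric actions. -/
theorem IsEquivariantOn.actsIsometricallyOn [CompleteSpace E] {θ : Ioo (0 : ℝ) 1}
    (hP : P.HasUniqueMinimal θ) (hreg : P.IsRegular) (hrigid : P.IsRigidAt θ)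
    (hρ : P.ActsIsometricallyOn ρ θ) (h : P.IsEquivariantOn ρ θ (P.interpSpace θ))
    {t : ℝ} (ht : t ∈ Ioo (0 : ℝ) 1) : P.ActsIsometricallyOn ρ t := fun g x => by
  have hinv : ∀ y, (ρ g).symm y = ρ g⁻¹ y := fun y => by
    rw [ContinuousLinearEquiv.symm_apply_eq, map_map_inv]
  -- The image of the pair under g is the competitor in rigidity: it has the same X_θ since g is
  -- isometric there, and the same differential by equivariance applied at g⁻¹y.
  have key := hrigid (P.map (ρ g)) (hreg.map _) (hP.map _)
    (fun y => by rw [interpNorm_map, hinv, hρ])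
    (fun y hy => by
      have hy' : ρ g⁻¹ y ∈ P.interpSpace θ := by
        rw [interpSpace, mem_ofPred_eq, hρ]; exact hy
      have := differential_map (ρ g) hP hy'
      rw [map_map_inv, h g _ hy', map_map_inv] at this
      exact this) t ht (ρ g x)
  rw [interpNorm_map, ContinuousLinearEquiv.symm_apply_apply] at key
  exact key.symm

end InterpolationPair

/-! ### Poisson kernels with poles near the circle: superposition to the constant 1. -/

namespace Strip

open Complex Filter Topology ComplexConjugate

/-- A real continuous function on the circle, as a complex one. -/
def toComplex (u : C(Circle, ℝ)) : C(Circle, ℂ) := ⟨fun b => (u b : ℂ), by fun_prop⟩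

@[simp] lemma toComplex_apply (u : C(Circle, ℝ)) (b : Circle) : toComplex u b = u b := rfl

@[simp] lemma toComplex_one : toComplex 1 = 1 := by ext; simp

@[simp] lemma toComplex_zero : toComplex 0 = 0 := by ext; simp

lemma toComplex_add (u v : C(Circle, ℝ)) : toComplex (u + v) = toComplex u + toComplex v := by
  ext; simp

lemma toComplex_sub (u v : C(Circle, ℝ)) : toComplex (u - v) = toComplex u - toComplex v := by
  ext; simp

lemma toComplex_smul (c : ℝ) (u : C(Circle, ℝ)) : toComplex (c • u) = (c : ℂ) • toComplex u := by
  ext; simp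

lemma norm_toComplex_le (u : C(Circle, ℝ)) : ‖toComplex u‖ ≤ ‖u‖ :=
  (ContinuousMap.norm_le _ (norm_nonneg u)).2 fun b => by
    rw [toComplex_apply, norm_real]; exact u.norm_coe_le_norm b

lemma tendsto_toComplex {u : ℕ → C(Circle, ℝ)} {v : C(Circle, ℝ)}
    (h : Tendsto u atTop (𝓝 v)) : Tendsto (fun n => toComplex (u n)) atTop (𝓝 (toComplex v)) := by
  rw [tendsto_iff_norm_sub_tendsto_zero] at h ⊢
  refine squeeze_zero (fun _ => norm_nonneg _) (fun n => ?_) h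
  rw [← toComplex_sub]
  exact norm_toComplex_le _

/-- The Poisson kernel of the disc, as a real continuous function. -/
def poissonReal (w : ℂ) : C(Circle, ℝ) := ⟨fun b => (discPoisson w b).re, by fun_prop⟩

lemma poissonReal_apply {w : ℂ} (hw : ‖w‖ < 1) (b : Circle) :
    poissonReal w b = (1 - normSq w) / normSq ((b : ℂ) - w) := by
  change (discPoisson w b).re = _
  rw [discPoisson_apply hw, ofReal_re]

lemma toComplex_poissonReal {w : ℂ} (hw : ‖w‖ < 1) :
    toComplex (poissonReal w) = discPoisson w := by
  ext b
  rw [toComplex_apply, poissonReal_apply hw, discPoisson_apply hw]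

lemma normSq_sub_smul_comm (r : ℝ) (ω b : Circle) :
    normSq ((b : ℂ) - r * ω) = normSq ((ω : ℂ) - r * b) := by
  have h1 := normSq_eq_norm_sq (b : ℂ)
  have h2 := normSq_eq_norm_sq (ω : ℂ)
  rw [Circle.norm_coe, one_pow] at h1 h2
  rw [normSq_sub, normSq_sub, normSq_mul, normSq_mul, h1, h2]
  simp only [mul_re, map_mul, conj_re, conj_im, mul_im, ofReal_re, ofReal_im, conj_ofReal]
  ring

/-- Cones that contain the Poisson kernels of all points near the circle are dense in the
nonnegative functions. -/
lemma mem_closure_of_poisson {S : Set C(Circle, ℝ)} {r : ℝ} (hr0 : 0 ≤ r) (hr1 : r < 1)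
    (hadd : ∀ u ∈ S, ∀ v ∈ S, u + v ∈ S) (hsmul : ∀ c : ℝ, 0 ≤ c → ∀ u ∈ S, c • u ∈ S)
    (hS : ∀ w : ℂ, r ≤ ‖w‖ → ‖w‖ < 1 → poissonReal w ∈ S) {u : C(Circle, ℝ)}
    (hu : ∀ b, 0 ≤ u b) : u ∈ closure S := by
  let θ : Ioo (0 : ℝ) 1 := ⟨1 / 2, by norm_num, by norm_num⟩
  have hconv : Convex ℝ (closure S) :=
    Convex.closure fun v hv w hw a b ha hb _ => hadd _ (hsmul a ha v hv) _ (hsmul b hb w hw)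
  rw [← closure_closure, Metric.mem_closure_iff]
  intro ε hε
  obtain ⟨δ, hδ, hδu⟩ := Metric.uniformContinuous_iff.1
    (CompactSpace.uniformContinuous_of_continuous u.continuous) (ε / 4) (by positivity)
  -- The three bounds keep the poles beyond radius r, keep s b within δ/2 of b, and make the tail
  -- 2‖u‖ · 2τ · 4/δ² at most ε/4.
  set τ : ℝ := min (1 - r) (min (δ / 2) (ε * δ ^ 2 / (64 * (‖u‖ + 1)))) with hτ
  have hτ0 : 0 < τ := by
    refine lt_min (by linarith) (lt_min (by positivity) (by positivity))
  have hτ1 : τ ≤ 1 - r := min_le_left _ _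
  have hτ2 : τ ≤ δ / 2 := (min_le_right _ _).trans (min_le_left _ _)
  have hτ3 : τ ≤ ε * δ ^ 2 / (64 * (‖u‖ + 1)) := (min_le_right _ _).trans (min_le_right _ _)
  set s : ℝ := 1 - τ with hs
  have hs0 : 0 ≤ s := by linarith
  have hs1 : s < 1 := by linarith
  have hsn : ∀ ω : Circle, ‖(s * ω : ℂ)‖ = s := fun ω => by
    rw [norm_mul, norm_real, Circle.norm_coe, mul_one, Real.norm_of_nonneg hs0]
  have hsn1 : ∀ ω : Circle, ‖(s * ω : ℂ)‖ < 1 := fun ω => (hsn ω).trans_lt hs1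
  have hne : ∀ p : Circle × Circle, normSq ((p.2 : ℂ) - s * p.1) ≠ 0 := fun p h => by
    rw [normSq_eq_zero, sub_eq_zero] at h
    have := hsn1 p.1
    rw [← h, Circle.norm_coe] at this
    exact lt_irrefl _ this
  let Q : C(Circle × Circle, ℝ) :=
    ⟨fun p => u p.1 * ((1 - normSq (s * p.1 : ℂ)) / normSq ((p.2 : ℂ) - s * p.1)), by
      refine Continuous.mul (by fun_prop) (Continuous.div ?_ ?_ hne) <;>
      · simp only [normSq_apply]; fun_prop⟩
  have hQ : ∀ ω, Q.curry ω = u ω • poissonReal (s * ω) := fun ω => by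
    ext b
    rw [ContinuousMap.smul_apply, poissonReal_apply (hsn1 ω)]
    rfl
  have hQS : ∀ ω, Q.curry ω ∈ closure S := fun ω => by
    rw [hQ]
    refine subset_closure (hsmul _ (hu ω) _ (hS _ ?_ (hsn1 ω)))
    rw [hsn]; linarith
  have hcont : Continuous fun x => Q.curry (bdryPt θ x) :=
    Q.curry.continuous.comp (continuous_bdryPt θ)
  have hint : Integrable (fun x => Q.curry (bdryPt θ x)) (harmonicMeasure θ) := by
    refine Integrable.of_bound ((aestronglyMeasurable_lines.2
      ⟨(hcont.comp continuous_inl).aestronglyMeasurable,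
        (hcont.comp continuous_inr).aestronglyMeasurable⟩).mono_ac
      (harmonicMeasure_absolutelyContinuous θ)) ‖Q.curry‖
      (Eventually.of_forall fun x => Q.curry.norm_coe_le_norm _)
  -- The mean of u(ω) P_{sω} over ω is an average of cone elements, hence in the closed convex hull.
  -- As |b - sω| = |ω - sb|, its value at b is the Poisson integral of u at sb, uniformly close to
  -- u(b).
  set J := ∫ x, Q.curry (bdryPt θ x) ∂harmonicMeasure θ with hJ
  have hJS : J ∈ closure S := hconv.integral_mem isClosed_closure
    (Eventually.of_forall fun x => hQS _) hint
  refine ⟨J, hJS, ?_⟩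
  rw [dist_comm, dist_eq_norm]
  refine lt_of_le_of_lt (b := ε / 2) ?_ (by linarith)
  refine (ContinuousMap.norm_le _ (by positivity)).2 fun b => ?_
  have huint : Integrable (fun x => (u (bdryPt θ x) : ℂ)) (harmonicMeasure θ) :=
    integrable_bdryPt θ (toComplex u)
  have hJb : ((J b : ℝ) : ℂ) = pairing θ huint (discPoisson (s * b)) := by
    have h1 : J b = ∫ x, Q.curry (bdryPt θ x) b ∂harmonicMeasure θ :=
      ((ContinuousMap.evalCLM ℝ b).integral_comp_comm hint).symm
    rw [h1, ← integral_complex_ofReal, pairing_apply]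
    congr with x
    rw [discPoisson_apply (hsn1 b), smul_eq_mul, ← ofReal_mul, mul_comm,
      ← normSq_sub_smul_comm s (bdryPt θ x) b]
    change ((u (bdryPt θ x) * ((1 - normSq (s * bdryPt θ x : ℂ)) /
      normSq ((b : ℂ) - s * bdryPt θ x)) : ℝ) : ℂ) = _
    rw [normSq_eq_norm_sq (s * _), normSq_eq_norm_sq (s * _), hsn, hsn]
  have hMb : ∀ ω : Circle, ‖(u ω : ℂ) - u b‖ ≤ 2 * ‖u‖ := fun ω => by
    rw [← ofReal_sub, norm_real]
    refine (norm_sub_le _ _).trans ?_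
    linarith [u.norm_coe_le_norm ω, u.norm_coe_le_norm b]
  have h := norm_pairing_discPoisson_sub_le huint (b := b) (c := (u b : ℂ)) (M := 2 * ‖u‖)
    (ε := ε / 4) hδ (by positivity) (by positivity) (Eventually.of_forall fun x => hMb _)
    (Eventually.of_forall fun x hx => by
      rw [← ofReal_sub, norm_real, ← dist_eq_norm]
      have hx' : dist (bdryPt θ x) b < δ := by rw [← dist_eq_norm] at hx; exact hx
      exact (hδu hx').le) (hsn1 b) (by
      have : (s * b : ℂ) - b = ((s - 1 : ℝ) : ℂ) * b := by push_cast; ring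
      rw [this, norm_mul, norm_real, Circle.norm_coe, mul_one, Real.norm_eq_abs, hs,
        show 1 - τ - 1 = -τ by ring, abs_neg, abs_of_pos hτ0]
      exact hτ2)
  rw [← hJb, ← ofReal_sub, norm_real, hsn] at h
  refine h.trans ?_
  have h2 : 1 - s ^ 2 ≤ 2 * τ := by rw [hs]; nlinarith
  have h3 : 2 * ‖u‖ * ((1 - s ^ 2) * (4 / δ ^ 2)) ≤ ε / 4 := by
    have h4 : τ * (64 * (‖u‖ + 1)) ≤ ε * δ ^ 2 := (le_div_iff₀ (by positivity)).1 hτ3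
    calc 2 * ‖u‖ * ((1 - s ^ 2) * (4 / δ ^ 2)) ≤ 2 * ‖u‖ * ((2 * τ) * (4 / δ ^ 2)) := by gcongr
      _ = (16 * (‖u‖ * τ)) / δ ^ 2 := by ring
      _ ≤ ε / 4 := by
        rw [div_le_iff₀ (by positivity)]
        nlinarith
  linarith

/-- The function `1` is the sum of a series of elements of such a cone, with partial sums
below `1`. -/
lemma exists_series_eq_one {S : Set C(Circle, ℝ)} (h0 : 0 ∈ S)
    (hS : ∀ u : C(Circle, ℝ), (∀ b, 0 ≤ u b) → u ∈ closure S) :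
    ∃ s : ℕ → C(Circle, ℝ), (∀ n, s n ∈ S) ∧ (Summable fun n => ‖s n‖) ∧
      (∀ n b, (∑ i ∈ Finset.range n, s i) b ≤ 1) ∧
      Tendsto (fun n => ∑ i ∈ Finset.range n, s i) atTop (𝓝 1) := by
  -- Greedy step: if v ≥ a, an element of S within a/2 of v - a leaves a remainder between a/2 and
  -- 3a/2. With a = 2^{-n} the remainders tend to 0 geometrically and stay positive, so the partial
  -- sums never exceed 1.
  have hstep : ∀ (v : C(Circle, ℝ)) (a : ℝ), ∃ s ∈ S, 0 < a → (∀ b, a ≤ v b) →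
      ∀ b, a / 2 ≤ (v - s) b ∧ (v - s) b ≤ 3 * (a / 2) := fun v a => by
    by_cases h : 0 < a ∧ ∀ b, a ≤ v b
    · obtain ⟨s, hs, hvs⟩ := Metric.mem_closure_iff.1
        (hS (v - a • 1) fun b => by simpa using h.2 b) (a / 2) (half_pos h.1)
      refine ⟨s, hs, fun _ _ b => ?_⟩
      have h1 := (ContinuousMap.dist_apply_le_dist (f := v - a • 1) (g := s) b).trans hvs.le
      rw [Real.dist_eq, abs_le] at h1
      simp only [ContinuousMap.sub_apply, ContinuousMap.smul_apply, ContinuousMap.one_apply,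
        smul_eq_mul, mul_one] at h1 ⊢
      constructor <;> linarith
    · exact ⟨0, h0, fun h1 h2 => absurd ⟨h1, h2⟩ h⟩
  choose σ hσS hσ using hstep
  let v : ℕ → C(Circle, ℝ) := fun n =>
    Nat.rec 1 (fun n w => w - σ w ((1 / 2) ^ n)) n
  have hv0 : v 0 = 1 := rfl
  have hvs : ∀ n, v (n + 1) = v n - σ (v n) ((1 / 2) ^ n) := fun n => rfl
  have hlow : ∀ n b, (1 / 2 : ℝ) ^ n ≤ v n b := fun n => by
    induction n with
    | zero => intro b; simp [hv0]
    | succ n ih =>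
      intro b
      rw [hvs, pow_succ, mul_one_div]
      exact (hσ (v n) _ (by positivity) ih b).1
  have hup : ∀ n b, v n b ≤ 3 * (1 / 2 : ℝ) ^ n := fun n => by
    cases n with
    | zero => intro b; simp [hv0]
    | succ n =>
      intro b
      rw [hvs, pow_succ, mul_one_div]
      exact (hσ (v n) _ (by positivity) (hlow n) b).2
  have hnorm : ∀ n, ‖v n‖ ≤ 3 * (1 / 2 : ℝ) ^ n := fun n =>
    (ContinuousMap.norm_le _ (by positivity)).2 fun b => by
      rw [Real.norm_of_nonneg ((by positivity : (0 : ℝ) ≤ (1 / 2) ^ n).trans (hlow n b))]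
      exact hup n b
  have hsum : ∀ n, ∑ i ∈ Finset.range n, (v i - v (i + 1)) = 1 - v n := fun n => by
    rw [Finset.sum_range_sub', hv0]
  have hgeo : Summable fun n : ℕ => 3 * (1 / 2 : ℝ) ^ n := summable_geometric_two.mul_left 3
  refine ⟨fun n => v n - v (n + 1), fun n => ?_, ?_, fun n b => ?_, ?_⟩
  · simp only [hvs, sub_sub_cancel]
    exact hσS _ _
  · refine Summable.of_nonneg_of_le (fun n => norm_nonneg _) (fun n => ?_) (hgeo.mul_left 2)
    refine (norm_sub_le _ _).trans ?_
    have h1 := hnorm n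
    have h2 := hnorm (n + 1)
    rw [pow_succ] at h2
    have h3 : (0 : ℝ) ≤ (1 / 2) ^ n := by positivity
    linarith
  · rw [hsum, ContinuousMap.sub_apply, ContinuousMap.one_apply]
    have := (by positivity : (0 : ℝ) ≤ (1 / 2) ^ n).trans (hlow n b)
    linarith
  · simp only [hsum]
    have h1 : Tendsto v atTop (𝓝 0) := squeeze_zero_norm hnorm hgeo.tendsto_atTop_zero
    simpa using tendsto_const_nhds.sub h1

/-- First moment of the Poisson kernel about its pole. -/
lemma integral_norm_discPoisson_mul_le (θ : Ioo (0 : ℝ) 1) {w : ℂ} (hw : ‖w‖ < 1) {δ : ℝ}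
    (hδ : 0 < δ) (hwδ : 1 - ‖w‖ ^ 2 ≤ δ ^ 2) :
    ∫ x, ‖(discPoisson w * (star chi - (conj w) • 1)) (bdryPt θ x)‖ ∂harmonicMeasure θ ≤ δ := by
  have hint := (integrable_bdryPt θ (discPoisson w)).norm
  have h : ∫ x, ((δ / 2) * ‖discPoisson w (bdryPt θ x)‖ + δ / 2) ∂harmonicMeasure θ = δ := by
    rw [integral_add (hint.const_mul _) (integrable_const _), integral_const_mul,
      integral_norm_discPoisson θ hw]
    simp
  refine le_trans (integral_mono (integrable_bdryPt θ _).norm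
    ((hint.const_mul _).add (integrable_const _)) fun x => ?_) h.le
  set b := bdryPt θ x
  have e1 : ‖(discPoisson w * (star chi - (conj w) • 1)) b‖ =
      ‖discPoisson w b‖ * ‖(b : ℂ) - w‖ := by
    rw [ContinuousMap.mul_apply, norm_mul, ← norm_conj ((b : ℂ) - w), map_sub]
    simp
  -- Here P_w(b)|b - w|² = 1 - |w|² exactly; the first moment then follows from 2δt ≤ t² + δ² with t
  -- = |b - w|.
  have e2 : ‖discPoisson w b‖ * ‖(b : ℂ) - w‖ ^ 2 ≤ δ ^ 2 := by
    have hb : ‖(b : ℂ) - w‖ ≠ 0 := fun h => by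
      rw [norm_eq_zero, sub_eq_zero] at h
      rw [← h, Circle.norm_coe] at hw
      exact lt_irrefl _ hw
    rw [norm_discPoisson_apply hw, normSq_eq_norm_sq, normSq_eq_norm_sq,
      div_mul_cancel₀ _ (pow_ne_zero 2 hb)]
    exact hwδ
  change ‖(discPoisson w * (star chi - (conj w) • 1)) b‖ ≤ δ / 2 * ‖discPoisson w b‖ + δ / 2
  rw [e1]
  have h2 : 0 ≤ ‖discPoisson w b‖ * (‖(b : ℂ) - w‖ - δ) ^ 2 := by positivity
  have h3 : δ * (‖discPoisson w b‖ * ‖(b : ℂ) - w‖) ≤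
      δ * (δ / 2 * ‖discPoisson w b‖ + δ / 2) := by nlinarith
  exact le_of_mul_le_mul_left h3 hδ

end Strip

/-! ### Isometry on the scale implies equivariance. -/

namespace InterpolationPair

open Complex Filter Topology ComplexConjugate Strip

variable {E : Type u} [NormedAddCommGroup E] [NormedSpace ℂ E] {P : InterpolationPair E}
  {θ : Ioo (0 : ℝ) 1}

/-- The boundary function `f` realizes the moments of `L` against the weight `u`, with pointwise
norm at most `M * u` and with an error at most `δ` in the first negative moment. -/
structure Realizes (θ : Ioo (0 : ℝ) 1) (L : C(Circle, ℂ) →L[ℂ] E) (M δ : ℝ)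
    (u : C(Circle, ℝ)) (f : P.BdryFun) : Prop where
  normAt_le : ∀ᵐ x ∂lines, normAt f x ≤ M * u (bdryPt θ x)
  moment : ∀ k : ℕ, pair θ f (chi ^ k) = L (chi ^ k * toComplex u)
  error : ‖pair θ f (star chi) - L (star chi * toComplex u)‖ ≤
    δ * ∫ x, u (bdryPt θ x) ∂harmonicMeasure θ

namespace Realizes

variable {L : C(Circle, ℂ) →L[ℂ] E} {M δ : ℝ} {u v : C(Circle, ℝ)} {f g : P.BdryFun}

protected lemma zero : Realizes θ L M δ 0 (0 : P.BdryFun) := by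
  have h : ∀ m, pair θ (0 : P.BdryFun) m = 0 := fun m => map_zero (P.pairL θ m)
  refine ⟨?_, fun k => ?_, ?_⟩
  · filter_upwards [ae_normAt_le (0 : P.BdryFun)] with x hx
    simpa using hx
  · simp [h]
  · simp [h]

protected lemma add (hf : Realizes θ L M δ u f) (hg : Realizes θ L M δ v g) :
    Realizes θ L M δ (u + v) (f + g) := by
  refine ⟨?_, fun k => ?_, ?_⟩
  · filter_upwards [normAt_add_le f g, hf.normAt_le, hg.normAt_le] with x h1 h2 h3
    rw [ContinuousMap.add_apply, mul_add]
    linarith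
  · rw [pair_add, _root_.add_apply, hf.moment, hg.moment, toComplex_add, mul_add, map_add]
  · rw [pair_add, _root_.add_apply, toComplex_add, mul_add, map_add, add_sub_add_comm]
    simp only [ContinuousMap.add_apply]
    rw [integral_add (integrable_bdryPt θ u) (integrable_bdryPt θ v), mul_add]
    exact (norm_add_le _ _).trans (add_le_add hf.error hg.error)

protected lemma smul {c : ℝ} (hc : 0 ≤ c) (hf : Realizes θ L M δ u f) :
    Realizes θ L M δ (c • u) ((c : ℂ) • f) := by
  have hn : ‖(c : ℂ)‖ = c := by rw [norm_real, Real.norm_of_nonneg hc]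
  refine ⟨?_, fun k => ?_, ?_⟩
  · filter_upwards [normAt_smul (c : ℂ) f, hf.normAt_le] with x h1 h2
    rw [h1, hn, ContinuousMap.smul_apply, smul_eq_mul, mul_left_comm]
    exact mul_le_mul_of_nonneg_left h2 hc
  · rw [pair_smul, _root_.smul_apply, hf.moment, toComplex_smul, mul_smul_comm, map_smul]
  · rw [pair_smul, _root_.smul_apply, toComplex_smul, mul_smul_comm, map_smul, ← smul_sub,
      norm_smul, hn]
    simp only [ContinuousMap.smul_apply, smul_eq_mul]
    rw [integral_const_mul, mul_left_comm]
    exact mul_le_mul_of_nonneg_left hf.error hc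

protected lemma sum {s : ℕ → C(Circle, ℝ)} {f : ℕ → P.BdryFun}
    (h : ∀ n, Realizes θ L M δ (s n) (f n)) (n : ℕ) :
    Realizes θ L M δ (∑ i ∈ Finset.range n, s i) (∑ i ∈ Finset.range n, f i) := by
  induction n with
  | zero => exact Realizes.zero
  | succ n ih =>
    rw [Finset.sum_range_succ, Finset.sum_range_succ]
    exact ih.add (h n)

lemma norm_le {C : ℝ} (hM : 0 ≤ M) (hC : 0 ≤ C) (hf : Realizes θ L M δ u f)
    (hu : ∀ b, u b ≤ C) : ‖f‖ ≤ M * C := by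
  refine norm_bdryFun_le (by positivity) ?_
  filter_upwards [hf.normAt_le] with x hx
  exact hx.trans (mul_le_mul_of_nonneg_left (hu _) hM)

end Realizes

/-- Superposition of the realizations of the Poisson kernels. -/
lemma exists_realization {L : C(Circle, ℂ) →L[ℂ] E} {M δ r : ℝ} (hM : 0 ≤ M) (hδ : 0 ≤ δ)
    (hr0 : 0 ≤ r) (hr1 : r < 1) (h : ∀ w : ℂ, r ≤ ‖w‖ → ‖w‖ < 1 →
      ∃ f : P.BdryFun, Realizes θ L M δ (poissonReal w) f) :
    ∃ f : P.BdryFun, ‖f‖ ≤ M ∧ (∀ k : ℕ, pair θ f (chi ^ k) = L (chi ^ k)) ∧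
      ‖pair θ f (star chi) - L (star chi)‖ ≤ δ := by
  let S : Set C(Circle, ℝ) := {u | ∃ f : P.BdryFun, Realizes θ L M δ u f}
  obtain ⟨s, hsS, hsum, hle, hlim⟩ := exists_series_eq_one (S := S) ⟨0, Realizes.zero⟩
    fun u hu => mem_closure_of_poisson (S := S) hr0 hr1
      (fun u ⟨f, hf⟩ v ⟨g, hg⟩ => ⟨f + g, hf.add hg⟩)
      (fun c hc u ⟨f, hf⟩ => ⟨(c : ℂ) • f, hf.smul hc⟩) h hu
  choose f hf using hsS
  -- Absolute summability comes from the norms of the weights, but the sharp bound M on the sum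
  -- comes from the partial sums of the weights being at most 1.
  have hfs : Summable f := by
    refine Summable.of_norm_bounded (hsum.mul_left M) fun n => ?_
    exact (hf n).norm_le hM (norm_nonneg _) fun b =>
      (Real.le_norm_self _).trans ((s n).norm_coe_le_norm b)
  have hF := hfs.hasSum.tendsto_sum_nat
  set F := ∑' n, f n
  have hR := Realizes.sum hf
  have hpair : ∀ m, Tendsto (fun n => pair θ (∑ i ∈ Finset.range n, f i) m) atTop
      (𝓝 (pair θ F m)) := fun m => ((P.pairL θ m).continuous.tendsto F).comp hF
  have hL : ∀ m, Tendsto (fun n => L (m * toComplex (∑ i ∈ Finset.range n, s i))) atTop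
      (𝓝 (L m)) := fun m => by
    have h1 := (tendsto_toComplex hlim).const_mul m
    rw [toComplex_one, mul_one] at h1
    exact (L.continuous.tendsto m).comp h1
  refine ⟨F, ?_, fun k => ?_, ?_⟩
  · refine le_of_tendsto hF.norm (Eventually.of_forall fun n => ?_)
    simpa using (hR n).norm_le hM zero_le_one (hle n)
  · refine tendsto_nhds_unique (hpair _) ((hL (chi ^ k)).congr fun n => ?_)
    rw [(hR n).moment]
  · refine le_of_tendsto ((hpair _).sub (hL _)).norm (Eventually.of_forall fun n => ?_)
    refine (hR n).error.trans ?_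
    have h1 : ∫ x, (∑ i ∈ Finset.range n, s i) (bdryPt θ x) ∂harmonicMeasure θ ≤ 1 := by
      refine (integral_mono (integrable_bdryPt θ _) (integrable_const (1 : ℝ))
        fun x => hle n _).trans (by simp)
    exact mul_le_of_le_one_right hδ h1

/-- A vertical translate of a function in `𝓕^∞` bounds the norms of its values. -/
lemma interpNorm_toFun_strip_le [CompleteSpace E] (F : P.HInftyFun) {z : ℂ}
    (hz : z ∈ openStrip) : P.interpNorm z.re (F.toFun z) ≤ ENNReal.ofReal F.norm := by
  have h := interpNorm_toFun_le ⟨z.re, hz⟩ (F.shift z.im)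
  rw [F.norm_shift] at h
  have e : (F.shift z.im).toFun ((⟨z.re, hz⟩ : Ioo (0 : ℝ) 1) : ℝ) = F.toFun z := by
    change F.toFun (z.re + z.im * I) = _
    rw [re_add_im]
  rwa [e] at h

/-- Minimal functions through the values of an isometric image realize the Poisson kernels. -/
lemma exists_realizes_poisson [CompleteSpace E] (hP : ∀ t ∈ Ioo (0 : ℝ) 1, P.HasUniqueMinimal t)
    (e : E →L[ℂ] E) (he : ∀ t ∈ Ioo (0 : ℝ) 1, ∀ x, P.interpNorm t (e x) = P.interpNorm t x)
    (F : P.HInftyFun) {w : ℂ} (hw : ‖w‖ < 1) {δ : ℝ} (hδ : 0 < δ) (hwδ : 1 - ‖w‖ ^ 2 ≤ δ ^ 2) :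
    ∃ f : P.BdryFun, Realizes θ (e.comp (pair θ F.data)) F.norm
      ((P.embNorm * F.norm + ‖e‖ * (P.embNorm * F.norm)) * δ) (poissonReal w) f := by
  -- At the strip point z over w, e(F z) has norm at most ‖F‖ at level Re z; its minimal function
  -- there, translated by Im z, passes through e(F z) at z and has boundary values in X₀ and X₁.
  set z := ofDisc θ w with hz
  have hwb : w ∈ Metric.ball (0 : ℂ) 1 := by simpa using hw
  have hzS : z ∈ openStrip := ofDisc_mem θ hwb
  have hzw : toDisc θ z = w := toDisc_ofDisc θ hwb
  let t : Ioo (0 : ℝ) 1 := ⟨z.re, hzS⟩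
  have hN : P.interpNorm t (e (F.toFun z)) ≤ ENNReal.ofReal F.norm := by
    rw [he t t.2]
    exact interpNorm_toFun_strip_le F hzS
  obtain ⟨G, hG1, hG2, -⟩ := exists_minimal (hP t t.2) (hN.trans_lt ENNReal.ofReal_lt_top)
  have hGn : G.norm ≤ F.norm := by
    rw [hG2]
    exact ENNReal.toReal_le_of_le_ofReal F.norm_nonneg hN
  set G' := G.shift (-z.im) with hG'
  have hG'n : ‖G'.data‖ ≤ F.norm := by
    rw [HInftyFun.norm_data, hG', G.norm_shift]; exact hGn
  have hG'z : pair θ G'.data (discPoisson w) = e (F.toFun z) := by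
    rw [← hzw, ← G'.toFun_eq θ hzS, ← hG1]
    change G.toFun (z + (-z.im : ℝ) * I) = _
    congr 1
    apply Complex.ext <;> simp [t]
  have hFz : pair θ F.data (discPoisson w) = F.toFun z := by rw [F.toFun_eq θ hzS, hzw]
  have hmom : ∀ m, pair θ (mulBdry θ (discPoisson w) G'.data) m =
      pair θ G'.data (m * discPoisson w) := fun m => by rw [pair_mulBdry, mul_comm]
  refine ⟨mulBdry θ (discPoisson w) G'.data, ?_, fun k => ?_, ?_⟩
  · filter_upwards [normAt_mulBdry θ (discPoisson w) G'.data, ae_normAt_le G'.data] with x h1 h2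
    rw [h1, norm_discPoisson_apply hw, poissonReal_apply hw, mul_comm]
    exact mul_le_mul_of_nonneg_right (h2.trans hG'n) (discPoisson_apply_nonneg hw _)
  · rw [hmom, toComplex_poissonReal hw, ContinuousLinearMap.comp_apply,
      pairing_pow_mul_discPoisson (G'.moments θ) k hw, hG'z,
      pairing_pow_mul_discPoisson (F.moments θ) k hw, hFz, map_smul]
  · have hone : ∫ x, poissonReal w (bdryPt θ x) ∂harmonicMeasure θ = 1 := by
      rw [← integral_norm_discPoisson θ hw]
      congr with x
      rw [norm_discPoisson_apply hw, poissonReal_apply hw]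
    -- Unlike the nonnegative moments, the moment against χ̄ is not determined by the value at w.
    -- Replacing χ̄ by w̄ gives equal terms on both sides and leaves an error bounded by the first
    -- moment of P_w about w.
    have hsplit : star chi * discPoisson w = conj w • discPoisson w +
        discPoisson w * (star chi - conj w • 1) := by
      rw [mul_sub, mul_smul_comm, mul_one, mul_comm]; abel
    have hint := integral_norm_discPoisson_mul_le θ hw hδ hwδ
    have hC := P.embNorm_nonneg
    have b1 := norm_pair_le θ G'.data (discPoisson w * (star chi - conj w • 1))
    have b2 := norm_pair_le θ F.data (discPoisson w * (star chi - conj w • 1))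
    rw [hmom, toComplex_poissonReal hw, ContinuousLinearMap.comp_apply, hsplit, map_add, map_add,
      map_add, map_smul, map_smul, map_smul, hG'z, hFz, add_sub_add_left_eq_sub, hone, mul_one,
      add_mul, mul_assoc ‖e‖]
    refine (norm_sub_le _ _).trans (add_le_add (b1.trans ?_) ((e.le_opNorm _).trans
      (mul_le_mul_of_nonneg_left (b2.trans ?_) (norm_nonneg e))))
    · have := F.norm_nonneg
      gcongr
    · rw [HInftyFun.norm_data]
      exact mul_le_mul_of_nonneg_left hint (mul_nonneg hC F.norm_nonneg)

/-- Automorphisms that are isometric on the whole interpolation scale commute with the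
differential. -/
lemma map_normDifferential [CompleteSpace E] (hP : ∀ t ∈ Ioo (0 : ℝ) 1, P.HasUniqueMinimal t)
    (e : E →L[ℂ] E) (he : ∀ t ∈ Ioo (0 : ℝ) 1, ∀ x, P.interpNorm t (e x) = P.interpNorm t x)
    {x : E} (hx : x ∈ P.interpSpace θ) :
    e (P.normDifferential θ x) = P.normDifferential θ (e x) := by
  obtain ⟨F, hF1, hF2, hF3⟩ := exists_minimal (hP θ θ.2) hx
  have hex : e x ∈ P.interpSpace θ := by
    rw [interpSpace, mem_ofPred_eq, he θ θ.2]; exact hx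
  set K : ℝ := P.embNorm * F.norm + ‖e‖ * (P.embNorm * F.norm) with hK
  have hK0 : 0 ≤ K := by
    have := P.embNorm_nonneg
    have := F.norm_nonneg
    positivity
  -- Each δ gives its own construction, but the result is always minimal for e x, so by uniqueness
  -- its slope is one fixed vector. The radius √(1 - δ²) ensures 1 - |w|² ≤ δ².
  have key : ∀ δ : ℝ, 0 < δ → δ < 1 →
      ‖P.normDifferential θ (e x) - e (P.normDifferential θ x)‖ ≤ K * δ := by
    intro δ hδ hδ1
    have hr0 : 0 ≤ 1 - δ ^ 2 := by nlinarith
    obtain ⟨f, hf, hfm, hfe⟩ := exists_realization (P := P) (θ := θ)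
      (L := e.comp (pair θ F.data)) (M := F.norm) (δ := K * δ) (r := √(1 - δ ^ 2))
      F.norm_nonneg (by positivity) (Real.sqrt_nonneg _)
      ((Real.sqrt_lt' one_pos).2 (by nlinarith)) fun w hw hw1 =>
        exists_realizes_poisson hP e he F hw1 hδ (by
          have := (Real.sqrt_le_left (norm_nonneg w)).1 hw
          linarith)
    have hmom : ∀ k : ℕ, k ≠ 0 → pair θ f (chi ^ k) = 0 := fun k hk => by
      rw [hfm, ContinuousLinearMap.comp_apply, F.moments θ k hk, map_zero]
    have hmin : P.IsMinimal θ (e x) (HInftyFun.ofData θ f hmom) := by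
      refine isMinimal_of_norm_le ?_ ?_
      · rw [HInftyFun.toFun_center, HInftyFun.data_ofData, ← pow_zero chi, hfm, pow_zero,
          ContinuousLinearMap.comp_apply, ← F.toFun_center, hF1]
      · rw [he θ θ.2, ← HInftyFun.norm_data, HInftyFun.data_ofData]
        refine (ENNReal.ofReal_le_ofReal hf).trans ?_
        rw [hF2]
        exact ENNReal.ofReal_toReal_le
    rw [normDifferential_eq (hP θ θ.2) hex hmin, ← hF3]
    exact hfe
  have hlim : Tendsto (fun δ : ℝ => K * δ) (𝓝[>] 0) (𝓝 0) := by
    have : Tendsto (fun δ : ℝ => K * δ) (𝓝 0) (𝓝 (K * 0)) := (continuous_const_mul K).tendsto 0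
    rw [mul_zero] at this
    exact this.mono_left nhdsWithin_le_nhds
  have h0 := ge_of_tendsto hlim (show ∀ᶠ δ in 𝓝[>] (0 : ℝ),
      ‖P.normDifferential θ (e x) - e (P.normDifferential θ x)‖ ≤ K * δ by
    filter_upwards [Ioo_mem_nhdsGT (zero_lt_one' ℝ)] with δ hδ using key δ hδ.1 hδ.2)
  exact (sub_eq_zero.1 (norm_le_zero_iff.1 h0)).symm

variable {G : Type*} [Group G] {ρ : G →* (E ≃L[ℂ] E)}

/-- Isometric actions on the whole interpolation scale make the differential equivariant. -/
theorem isEquivariantOn_of_actsIsometricallyOn [CompleteSpace E]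
    (hP : ∀ t ∈ Ioo (0 : ℝ) 1, P.HasUniqueMinimal t)
    (h : ∀ t ∈ Ioo (0 : ℝ) 1, P.ActsIsometricallyOn ρ t) :
    P.IsEquivariantOn ρ θ (P.interpSpace θ) :=
  isEquivariantOn_iff.2 fun g _ hx =>
    map_normDifferential hP (ρ g : E →L[ℂ] E) (fun t ht => h t ht g) hx

end InterpolationPair
end

theorem theorem3 {E : Type u} [NormedAddCommGroup E] [NormedSpace ℂ E] [CompleteSpace E]
    (P : InterpolationPair E) (hsum : P.IsSum) (hrigid : P.IsRigid)
    (θ : ℝ) (hθ : θ ∈ Set.Ioo (0 : ℝ) 1)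
    {G : Type*} [Group G] (ρ : G →* (E ≃L[ℂ] E)) (hρ : P.ActsIsometricallyOn ρ θ) :
    (P.IsEquivariantOn ρ θ (P.interpSpace θ) ↔
      ∀ t ∈ Set.Ioo (0 : ℝ) 1, P.ActsIsometricallyOn ρ t) ∧
    (∀ D : Submodule ℂ E, P.IsDenseInInter D → (∀ g : G, ∀ x ∈ D, ρ g x ∈ D) →
      (P.IsEquivariantOn ρ θ (D : Set E) ↔ P.IsEquivariantOn ρ θ (P.interpSpace θ)) ∧
      (P.IsEquivariantOn ρ θ (D : Set E) ↔
        ∀ t ∈ Set.Ioo (0 : ℝ) 1, P.ActsIsometricallyOn ρ t)) := by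
  obtain ⟨⟨hreg, hmin⟩, hrig⟩ := hrigid
  have hbc : P.IsEquivariantOn ρ θ (P.interpSpace θ) ↔
      ∀ t ∈ Set.Ioo (0 : ℝ) 1, P.ActsIsometricallyOn ρ t :=
    ⟨fun h t ht => h.actsIsometricallyOn (θ := ⟨θ, hθ⟩) (hmin θ hθ) hreg (hrig θ hθ) hρ ht,
      fun h => InterpolationPair.isEquivariantOn_of_actsIsometricallyOn (θ := ⟨θ, hθ⟩) hmin h⟩
  refine ⟨hbc, fun D hD hG => ?_⟩
  have hab : P.IsEquivariantOn ρ θ (D : Set E) ↔ P.IsEquivariantOn ρ θ (P.interpSpace θ) :=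
    ⟨fun h => h.of_dense (θ := ⟨θ, hθ⟩) (hmin θ hθ) hρ hD hG,
      fun h g x hx => h g x (hD.subset θ hx)⟩
  exact ⟨hab, hab.trans hbc⟩
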